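/- Let $X$ be a smooth manifold of dimension $n+1$ (without boundary, Hausdorff, $\sigma$-compact), oriented by a smooth volume form $\eta$, and let $\pi_{XY}:Y\to X$ be a smooth fibre bundle of rank $N$ (with $Y$ Hausdorff and $\sigma$-compact). Write $V_yY=\ker T_y\pi_{XY}$. The first jet bundle $J^1Y\to Y$ has as fibre over $y\in Y_x$ the set of linear maps $\gamma:T_xX\to T_yY$ with $T\pi_{XY}\circ\gamma=\mathrm{Id}_{T_xX}$. The dual jet bundle $Z\to Y$ has as fibre over $y$ the space of $z\in\Lambda^{n+1}_yY$ that vanish when contracted with two vectors of $V_yY$; the pairing is $\langle z,\gamma\rangle=\gamma^*z\in\Lambda^{n+1}_xX$. The Pontryagin bundle is $M=J^1Y\times_Y Z$, with projections $\pi_{XM}:M\to X$ and $\pi_{ZM}:M\to Z$. On $Z$ let $\Theta(z)=\pi_{YZ}^*z$ be the canonical $(n+1)$-form and $\Omega=-\mathbf d\Theta$; put $\Theta_M=\pi_{ZM}^*\Theta$ and $\Omega_M=\pi_{ZM}^*\Omega$. Let $\mathcal L=L\eta$ be a Lagrangian density, with $L:J^1Y\to\mathbb R$ smooth, let $\mathcal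 E(\gamma,z)=\langle z,\gamma\rangle-\mathcal L(\gamma)$ be the generalized energy density, regarded also as a horizontal $(n+1)$-form on $M$ by pullback along $\pi_{XM}$, and let $\Omega_{\mathcal E}=\Omega_M+\mathbf d\mathcal E$. Let $\psi:X\to M$ be a smooth section of $\pi_{XM}$. A vertical variation of $\psi$ supported in a compact set $U\subseteq X$ is a family $(\psi_\lambda)_{|\lambda|<\varepsilon}$ of sections of $\pi_{XM}$, depending smoothly on $(\lambda,x)$, with $\psi_0=\psi$ and $\psi_\lambda=\psi$ outside $U$ for all $\lambda$. The section $\psi$ is a critical point of the Hamilton–Pontryagin action $S(\psi)=\int_X\psi^*(\Theta_M-\mathcal E)$ if for every compact $U\subseteq X$ and every vertical variation $\psi_\lambda$ of $\psi$ supported in $U$ the derivative $$\frac{d}{d\lambda}\bigg|_{\lambda=0}\int_U\psi_\lambda^*(\Theta_M-\mathcal E)$$ exists and is equal to $0$. Then $\psi$ is a critical point of the Hamilton–Pontryagin action if and only if it satisfies the implicit Euler–Lagrange equations $$\psi^*(\mathcal V_M\lrcorner\,\Omega_{\mathcal E})=0\qquad\text{for every smooth }\pi_{XM}\text{-vertical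 vector field }\mathcal V_M\text{ on }M,$$ that is, for every smooth vector field $\mathcal V_M$ on $M$ with $T\pi_{XM}(\mathcal V_M)=0$. -/

import Mathlib

open Set Manifold MeasureTheory
open scoped ContDiff Topology

noncomputable section

/-! ## Differential forms on manifolds -/

section Forms

variable {E : Type*} [NormedAddCommGroup E] [NormedSpace ℝ E] {H : Type*} [TopologicalSpace H]
  (I : ModelWithCorners ℝ E H) (P : Type*) [TopologicalSpace P] [ChartedSpace H P]
  {E' : Type*} [NormedAddCommGroup E'] [NormedSpace ℝ E'] {H' : Type*} [TopologicalSpace H']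
  (I' : ModelWithCorners ℝ E' H') {P' : Type*} [TopologicalSpace P'] [ChartedSpace H' P']

/-- (Not necessarily continuous) real valued differential `k`-forms on the manifold `P`. -/
abbrev DForm (k : ℕ) : Type _ := ∀ p : P, TangentSpace I p [⋀^Fin k]→L[ℝ] ℝ

variable {P} {k : ℕ}

/-- The pullback `f^* α`. -/
def DForm.pullback (f : P → P') (α : DForm I' P' k) : DForm I P k :=
  fun p => (α (f p)).compContinuousLinearMap (mfderiv I I' f p)

/-- The expression of the form `α` in the preferred chart around `p₀`,
i.e. the pullback of `α` by the inverse of this chart. -/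
def DForm.inChart (α : DForm I P k) (p₀ : P) : E → E [⋀^Fin k]→L[ℝ] ℝ :=
  fun w => DForm.pullback 𝓘(ℝ, E) I (extChartAt I p₀).symm α w

/-- A form is smooth if its expressions in charts are smooth. -/
def DForm.IsSmooth (α : DForm I P k) : Prop :=
  ∀ p₀ : P, ContDiffOn ℝ ∞ (DForm.inChart I α p₀) (extChartAt I p₀).target

/-- The exterior derivative `dα` on a manifold without boundary: at `p` it is computed in the
preferred chart around `p`, and pulled back by this chart. -/
def DForm.d (α : DForm I P k) : DForm I P (k + 1) :=
  fun p => ContinuousAlternatingMap.compContinuousLinearMap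
    (extDeriv (DForm.inChart I α p) (extChartAt I p p))
    (mfderiv I 𝓘(ℝ, E) (extChartAt I p) p : TangentSpace I p →L[ℝ] E)

/-- The interior product (left contraction) `V ⌟ α`, inserting `V` in the first slot of `α`. -/
def DForm.interior (V : ∀ p : P, TangentSpace I p) (α : DForm I P (k + 1)) : DForm I P k :=
  fun p => ContinuousAlternatingMap.curryLeft (E := E) (α p) (V p)

end Forms

/-! ## Volume forms and integration of top-degree forms -/

/-- The vector space `ℝ^k`. -/
abbrev Eu (k : ℕ) : Type := EuclideanSpace ℝ (Fin k)

/-- A volume form on the `k`-dimensional manifold `X`: a smooth `k`-form without zeros. It also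
determines the orientation of `X`. -/
structure VolForm (k : ℕ) (X : Type*) [TopologicalSpace X] [ChartedSpace (Eu k) X] where
  form : DForm (𝓡 k) X k
  isSmooth : DForm.IsSmooth (𝓡 k) form
  ne_zero : ∀ x, form x ≠ 0

/-- The standard basis of the model space. -/
def stdFrame (k : ℕ) : Fin k → Eu k := fun i => EuclideanSpace.single i 1

section Integration

variable {k : ℕ} {X : Type*} [TopologicalSpace X] [ChartedSpace (Eu k) X]

/-- Countably many chart domains cover a `σ`-compact manifold. -/
theorem exists_seq_chart_cover (k : ℕ) (X : Type*) [TopologicalSpace X] [ChartedSpace (Eu k) X]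
    [SigmaCompactSpace X] [Nonempty X] :
    ∃ f : ℕ → X, ⋃ j, (chartAt (Eu k) (f j)).source = univ := by
  obtain ⟨s, hs, hsU⟩ := countable_cover_nhds_of_sigmaCompact
    (fun x : X => chart_source_mem_nhds (Eu k) x)
  have hne : s.Nonempty := by
    by_contra h
    rw [not_nonempty_iff_eq_empty] at h
    subst h
    simp only [mem_empty_iff_false, iUnion_of_empty, iUnion_empty] at hsU
    exact (empty_ne_univ hsU)
  obtain ⟨f, rfl⟩ := hs.exists_eq_range hne
  exact ⟨f, by simpa using hsU⟩

/-- The centres of a countable cover of `X` by chart domains. -/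
def chartSeq (k : ℕ) (X : Type*) [TopologicalSpace X] [ChartedSpace (Eu k) X]
    [SigmaCompactSpace X] [Nonempty X] : ℕ → X :=
  (exists_seq_chart_cover k X).choose

/-- The pieces of the partition of `X` obtained by making the chart domains of `chartSeq`
disjoint. -/
def chartPiece (k : ℕ) (X : Type*) [TopologicalSpace X] [ChartedSpace (Eu k) X]
    [SigmaCompactSpace X] [Nonempty X] : ℕ → Set X :=
  disjointed fun j => (chartAt (Eu k) (chartSeq k X j)).source

open scoped Classical in
/-- The measure `|η|` on `X` of a `k`-form `η`: on each piece of a countable measurable partition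
of `X` subordinate to charts, it is the image of the Lebesgue measure of the chart, weighted by
the absolute value `|η(∂₁, …, ∂ₖ)|` of the coefficient of `η` in the chart. -/
def DForm.measure [SigmaCompactSpace X] [MeasurableSpace X] (η : DForm (𝓡 k) X k) : Measure X :=
  if _h : Nonempty X then
    Measure.sum fun j : ℕ =>
      Measure.map (chartAt (Eu k) (chartSeq k X j)).symm
        ((volume.restrict ((chartAt (Eu k) (chartSeq k X j)) '' chartPiece k X j)).withDensity
          fun w => ENNReal.ofReal |DForm.inChart (𝓡 k) η (chartSeq k X j) w (stdFrame k)|)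
  else 0

/-- The function `a` with `α = a η`, for a top-degree form `α` and a volume form `η`. -/
def DForm.ratio (η : VolForm k X) (α : DForm (𝓡 k) X k) (x : X) : ℝ :=
  α x (stdFrame k) / η.form x (stdFrame k)

/-- The integral `∫_U α` of a top-degree form, with respect to the orientation of `X` given by the
volume form `η`: writing `α = a η`, it is the integral of `a` for the measure `|η|`. -/
def DForm.integral [SigmaCompactSpace X] [MeasurableSpace X] (η : VolForm k X) (U : Set X)
    (α : DForm (𝓡 k) X k) : ℝ :=
  ∫ x in U, DForm.ratio η α x ∂(DForm.measure η.form)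

end Integration

/-! ## Fibre bundles and adapted charts -/

/-- A smooth fibre bundle `proj : Y → X` of rank `N` with typical fibre `F` over an
`(n+1)`-dimensional base, i.e. a map that has smooth local trivializations around every point. -/
structure FieldBundle (n N : ℕ) (X Y F : Type*)
    [TopologicalSpace X] [ChartedSpace (Eu (n + 1)) X]
    [TopologicalSpace Y] [ChartedSpace (Eu (n + N + 1)) Y]
    [TopologicalSpace F] [ChartedSpace (Eu N) F] where
  proj : Y → X
  exists_trivialization : ∀ x : X, ∃ e : Bundle.Trivialization F proj, x ∈ e.baseSet ∧
    ContMDiffOn (𝓡 (n + N + 1)) ((𝓡 (n + 1)).prod (𝓡 N)) ∞ e e.source ∧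
    ContMDiffOn ((𝓡 (n + 1)).prod (𝓡 N)) (𝓡 (n + N + 1)) ∞ e.toOpenPartialHomeomorph.symm e.target

section Bundles

variable {n N : ℕ} {X Y F : Type*}
  [TopologicalSpace X] [ChartedSpace (Eu (n + 1)) X]
  [TopologicalSpace Y] [ChartedSpace (Eu (n + N + 1)) Y]
  [TopologicalSpace F] [ChartedSpace (Eu N) F]

/-- Adapted coordinates `(x^μ, y^A)` on `Y` : a smooth chart `base = (x^μ)` of `X` and a smooth
chart `total = (x^μ, y^A)` of `Y` whose first component is the chart of `X`. -/
structure AdaptedChart (B : FieldBundle n N X Y F) where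
  base : OpenPartialHomeomorph X (Eu (n + 1))
  total : OpenPartialHomeomorph Y (Eu (n + 1) × Eu N)
  base_smooth : ContMDiffOn (𝓡 (n + 1)) (𝓡 (n + 1)) ∞ base base.source
  base_symm_smooth : ContMDiffOn (𝓡 (n + 1)) (𝓡 (n + 1)) ∞ base.symm base.target
  total_smooth : ContMDiffOn (𝓡 (n + N + 1)) 𝓘(ℝ, Eu (n + 1) × Eu N) ∞ total total.source
  total_symm_smooth :
    ContMDiffOn 𝓘(ℝ, Eu (n + 1) × Eu N) (𝓡 (n + N + 1)) ∞ total.symm total.target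
  proj_mem : ∀ y ∈ total.source, B.proj y ∈ base.source
  total_fst : ∀ y ∈ total.source, (total y).1 = base (B.proj y)

variable (B : FieldBundle n N X Y F)

/-- Every point of `Y` lies in the domain of adapted coordinates. -/
theorem exists_adaptedChart [IsManifold (𝓡 (n + 1)) ∞ X] [IsManifold (𝓡 N) ∞ F] (y : Y) :
    ∃ c : AdaptedChart B, y ∈ c.total.source := by
  obtain ⟨e, hx, he, he'⟩ := B.exists_trivialization (B.proj y)
  have hy : y ∈ e.source := e.mem_source.2 hx
  let φ := chartAt (Eu (n + 1)) (B.proj y)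
  let χ := chartAt (Eu N) (e y).2
  have hφ : ContMDiffOn (𝓡 (n + 1)) (𝓡 (n + 1)) ∞ φ φ.source := contMDiffOn_chart
  have hφ' : ContMDiffOn (𝓡 (n + 1)) (𝓡 (n + 1)) ∞ φ.symm φ.target := contMDiffOn_chart_symm
  have hχ : ContMDiffOn (𝓡 N) (𝓡 N) ∞ χ χ.source := contMDiffOn_chart
  have hχ' : ContMDiffOn (𝓡 N) (𝓡 N) ∞ χ.symm χ.target := contMDiffOn_chart_symm
  let t : OpenPartialHomeomorph Y (Eu (n + 1) × Eu N) :=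
    e.toOpenPartialHomeomorph.trans (φ.prod χ)
  have hts : ∀ y' ∈ t.source, y' ∈ e.source ∧ (e y').1 ∈ φ.source ∧ (e y').2 ∈ χ.source := by
    intro y' hy'
    simpa [t, OpenPartialHomeomorph.trans_source] using hy'
  have htt : ∀ w ∈ t.target, w.1 ∈ φ.target ∧ w.2 ∈ χ.target ∧
      (φ.symm w.1, χ.symm w.2) ∈ e.target := by
    intro w hw
    have := hw
    simp only [t, OpenPartialHomeomorph.trans_target, mem_inter_iff, mem_preimage] at this
    exact ⟨this.1.1, this.1.2, this.2⟩
  refine ⟨⟨φ, t, hφ, hφ', ?_, ?_, ?_, ?_⟩, ?_⟩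
  · have h1 : ContMDiffOn (𝓡 (n + N + 1)) (𝓡 (n + 1)) ∞ (fun y' => φ (e y').1) t.source :=
      hφ.comp (contMDiff_fst.comp_contMDiffOn (he.mono fun y' h => (hts y' h).1))
        fun y' h => (hts y' h).2.1
    have h2 : ContMDiffOn (𝓡 (n + N + 1)) (𝓡 N) ∞ (fun y' => χ (e y').2) t.source :=
      hχ.comp (contMDiff_snd.comp_contMDiffOn (he.mono fun y' h => (hts y' h).1))
        fun y' h => (hts y' h).2.2
    exact h1.prodMk_space h2
  · have h1 : ContMDiffOn 𝓘(ℝ, Eu (n + 1) × Eu N) (𝓡 (n + 1)) ∞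
        (fun w : Eu (n + 1) × Eu N => φ.symm w.1) t.target :=
      hφ'.comp (contDiff_fst.contMDiff.contMDiffOn) fun w h => (htt w h).1
    have h2 : ContMDiffOn 𝓘(ℝ, Eu (n + 1) × Eu N) (𝓡 N) ∞
        (fun w : Eu (n + 1) × Eu N => χ.symm w.2) t.target :=
      hχ'.comp (contDiff_snd.contMDiff.contMDiffOn) fun w h => (htt w h).2.1
    exact he'.comp (h1.prodMk h2) fun w h => (htt w h).2.2
  · intro y' hy'
    have h := hts y' hy'
    rw [← e.coe_fst h.1]
    exact h.2.1
  · intro y' hy'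
    have h := hts y' hy'
    rw [← e.coe_fst h.1]
    rfl
  · have h1 : (e y).1 = B.proj y := e.coe_fst hy
    have : y ∈ e.source ∧ (e y).1 ∈ φ.source ∧ (e y).2 ∈ χ.source :=
      ⟨hy, by rw [h1]; exact mem_chart_source _ _, mem_chart_source _ _⟩
    simpa [t, OpenPartialHomeomorph.trans_source] using this


namespace AdaptedChart

variable {B} (c : AdaptedChart B)

theorem base_mdiff : c.base.MDifferentiable (𝓡 (n + 1)) (𝓡 (n + 1)) :=
  ⟨c.base_smooth.mdifferentiableOn (by simp), c.base_symm_smooth.mdifferentiableOn (by simp)⟩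

theorem total_mdiff : c.total.MDifferentiable (𝓡 (n + N + 1)) 𝓘(ℝ, Eu (n + 1) × Eu N) :=
  ⟨c.total_smooth.mdifferentiableOn (by simp), c.total_symm_smooth.mdifferentiableOn (by simp)⟩

/-- The derivative `T_x X ≃ ℝ^(n+1)` of the chart of the base. -/
def dBase {x : X} (hx : x ∈ c.base.source) : TangentSpace (𝓡 (n + 1)) x ≃L[ℝ] Eu (n + 1) :=
  c.base_mdiff.mfderiv hx

/-- The derivative `T_y Y ≃ ℝ^(n+1) × ℝ^N` of the chart of the total space. -/
def dTotal {y : Y} (hy : y ∈ c.total.source) :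
    TangentSpace (𝓡 (n + N + 1)) y ≃L[ℝ] Eu (n + 1) × Eu N :=
  c.total_mdiff.mfderiv hy

theorem mdiffAt_proj {y : Y} (hy : y ∈ c.total.source) :
    MDifferentiableAt (𝓡 (n + N + 1)) (𝓡 (n + 1)) B.proj y := by
  have h1 : MDifferentiableAt (𝓡 (n + N + 1)) 𝓘(ℝ, Eu (n + 1)) (fun y' => (c.total y').1) y :=
    (differentiableAt_fst.mdifferentiableAt).comp y (c.total_mdiff.mdifferentiableAt hy)
  have hb : B.proj y ∈ c.base.source := c.proj_mem y hy
  have h2 : MDifferentiableAt (𝓡 (n + N + 1)) (𝓡 (n + 1))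
      (fun y' => c.base.symm (c.total y').1) y := by
    refine MDifferentiableAt.comp y (g := c.base.symm) ?_ h1
    apply c.base_mdiff.mdifferentiableAt_symm
    rw [c.total_fst y hy]
    exact c.base.map_source hb
  refine h2.congr_of_eventuallyEq ?_
  filter_upwards [c.total.open_source.mem_nhds hy] with y' hy'
  rw [c.total_fst y' hy', c.base.left_inv (c.proj_mem y' hy')]

theorem fst_dTotal {y : Y} (hy : y ∈ c.total.source) (u : TangentSpace (𝓡 (n + N + 1)) y) :
    (c.dTotal hy u).1 =
      c.dBase (c.proj_mem y hy) (mfderiv (𝓡 (n + N + 1)) (𝓡 (n + 1)) B.proj y u) := by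
  have h1 : mfderiv (𝓡 (n + N + 1)) 𝓘(ℝ, Eu (n + 1)) (fun y' => (c.total y').1) y =
      (ContinuousLinearMap.fst ℝ (Eu (n + 1)) (Eu N)).comp
        (mfderiv (𝓡 (n + N + 1)) 𝓘(ℝ, Eu (n + 1) × Eu N) c.total y) := by
    have := mfderiv_comp y (I'' := 𝓘(ℝ, Eu (n + 1)))
      (g := (Prod.fst : Eu (n + 1) × Eu N → Eu (n + 1)))
      (differentiableAt_fst.mdifferentiableAt) (c.total_mdiff.mdifferentiableAt hy)
    rw [mfderiv_eq_fderiv, fderiv_fst] at this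
    exact this
  have h2 : mfderiv (𝓡 (n + N + 1)) 𝓘(ℝ, Eu (n + 1)) (fun y' => c.base (B.proj y')) y =
      (mfderiv (𝓡 (n + 1)) (𝓡 (n + 1)) c.base (B.proj y)).comp
        (mfderiv (𝓡 (n + N + 1)) (𝓡 (n + 1)) B.proj y) :=
    mfderiv_comp y (c.base_mdiff.mdifferentiableAt (c.proj_mem y hy)) (c.mdiffAt_proj hy)
  have h3 : (fun y' => (c.total y').1) =ᶠ[𝓝 y] fun y' => c.base (B.proj y') := by
    filter_upwards [c.total.open_source.mem_nhds hy] with y' hy'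
    exact c.total_fst y' hy'
  have h4 := h3.mfderiv_eq (I := 𝓡 (n + N + 1)) (I' := 𝓘(ℝ, Eu (n + 1)))
  rw [h1] at h4
  have h5 := h4.trans h2
  exact congrArg (fun T => T u) h5

/-- The coordinate change between two adapted charts of `Y`. -/
def trans (c c' : AdaptedChart B) :
    OpenPartialHomeomorph (Eu (n + 1) × Eu N) (Eu (n + 1) × Eu N) :=
  c.total.symm.trans c'.total

theorem contDiffOn_trans (c c' : AdaptedChart B) :
    ContDiffOn ℝ ∞ (c.trans c') (c.trans c').source := by
  rw [← contMDiffOn_iff_contDiffOn]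
  refine c'.total_smooth.comp (c.total_symm_smooth.mono fun w hw => ?_) fun w hw => ?_
  · simp only [trans, OpenPartialHomeomorph.trans_source, mem_inter_iff] at hw
    exact hw.1
  · simp only [trans, OpenPartialHomeomorph.trans_source, mem_inter_iff] at hw
    exact hw.2

/-- The coordinate change between the charts of the base of two adapted charts. -/
def baseTrans (c c' : AdaptedChart B) : OpenPartialHomeomorph (Eu (n + 1)) (Eu (n + 1)) :=
  c.base.symm.trans c'.base

theorem contDiffOn_baseTrans (c c' : AdaptedChart B) :
    ContDiffOn ℝ ∞ (c.baseTrans c') (c.baseTrans c').source := by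
  rw [← contMDiffOn_iff_contDiffOn]
  refine c'.base_smooth.comp (c.base_symm_smooth.mono fun w hw => ?_) fun w hw => ?_
  · simp only [baseTrans, OpenPartialHomeomorph.trans_source, mem_inter_iff] at hw
    exact hw.1
  · simp only [baseTrans, OpenPartialHomeomorph.trans_source, mem_inter_iff] at hw
    exact hw.2

theorem mem_trans_source {c c' : AdaptedChart B} {w : Eu (n + 1) × Eu N} :
    w ∈ (c.trans c').source ↔ w ∈ c.total.target ∧ c.total.symm w ∈ c'.total.source := by
  simp [trans]

theorem trans_apply (c c' : AdaptedChart B) (w : Eu (n + 1) × Eu N) :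
    c.trans c' w = c'.total (c.total.symm w) := rfl

theorem trans_mem_trans_source {c c' : AdaptedChart B} {w : Eu (n + 1) × Eu N}
    (hw : w ∈ (c.trans c').source) : c.trans c' w ∈ (c'.trans c).source := by
  rw [mem_trans_source] at hw ⊢
  rw [trans_apply, c'.total.left_inv hw.2]
  exact ⟨c'.total.map_source hw.2, c.total.map_target hw.1⟩

theorem trans_fst_mem_baseTrans_source {c c' : AdaptedChart B} {w : Eu (n + 1) × Eu N}
    (hw : w ∈ (c.trans c').source) : (c.trans c' w).1 ∈ (c'.baseTrans c).source := by
  rw [mem_trans_source] at hw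
  have hb' := c'.proj_mem _ hw.2
  have hb := c.proj_mem _ (c.total.map_target hw.1)
  simp only [baseTrans, OpenPartialHomeomorph.trans_source, mem_inter_iff, mem_preimage,
    OpenPartialHomeomorph.symm_source]
  rw [trans_apply, c'.total_fst _ hw.2, c'.base.left_inv hb']
  exact ⟨c'.base.map_source hb', hb⟩

theorem fderiv_trans {c c' : AdaptedChart B} {y : Y} (hy : y ∈ c.total.source)
    (hy' : y ∈ c'.total.source) (u : TangentSpace (𝓡 (n + N + 1)) y) :
    fderiv ℝ (c.trans c') (c.total y) (c.dTotal hy u) = c'.dTotal hy' u := by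
  have h1 := mfderiv_comp (c.total y) (f := c.total.symm) (g := c'.total)
    (I := 𝓘(ℝ, Eu (n + 1) × Eu N)) (I' := 𝓡 (n + N + 1)) (I'' := 𝓘(ℝ, Eu (n + 1) × Eu N))
    (by rw [c.total.left_inv hy]; exact c'.total_mdiff.mdifferentiableAt hy')
    (c.total_mdiff.mdifferentiableAt_symm (c.total.map_source hy))
  rw [mfderiv_eq_fderiv, c.total.left_inv hy] at h1
  have h2 := congrArg (fun T => T (c.dTotal hy u)) h1
  have h3 : mfderiv 𝓘(ℝ, Eu (n + 1) × Eu N) (𝓡 (n + N + 1)) c.total.symm (c.total y)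
      (c.dTotal hy u) = u := (c.dTotal hy).symm_apply_apply u
  refine h2.trans ?_
  exact congrArg (c'.dTotal hy') h3

theorem fderiv_baseTrans {c c' : AdaptedChart B} {x : X} (hx : x ∈ c.base.source)
    (hx' : x ∈ c'.base.source) (u : TangentSpace (𝓡 (n + 1)) x) :
    fderiv ℝ (c.baseTrans c') (c.base x) (c.dBase hx u) = c'.dBase hx' u := by
  have h1 := mfderiv_comp (c.base x) (f := c.base.symm) (g := c'.base)
    (I := 𝓡 (n + 1)) (I' := 𝓡 (n + 1)) (I'' := 𝓡 (n + 1))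
    (by rw [c.base.left_inv hx]; exact c'.base_mdiff.mdifferentiableAt hx')
    (c.base_mdiff.mdifferentiableAt_symm (c.base.map_source hx))
  rw [mfderiv_eq_fderiv, c.base.left_inv hx] at h1
  have h2 := congrArg (fun T => T (c.dBase hx u)) h1
  have h3 : mfderiv (𝓡 (n + 1)) (𝓡 (n + 1)) c.base.symm (c.base x)
      (c.dBase hx u) = u := (c.dBase hx).symm_apply_apply u
  refine h2.trans ?_
  exact congrArg (c'.dBase hx') h3

end AdaptedChart

/-! ## Smooth bundles over `Y` given by fibre coordinates over adapted charts -/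

/-- A bundle over `Y` with fibres `A y` and typical fibre the vector space `V`, given by a system
of fibre coordinates over the adapted charts of `Y`, with smooth coordinate changes. -/
structure FibreCoords (A : Y → Type*) (V : Type*) [NormedAddCommGroup V] [NormedSpace ℝ V] where
  coord : ∀ (c : AdaptedChart B) (y : Y), y ∈ c.total.source → A y ≃ V
  change : AdaptedChart B → AdaptedChart B → Eu (n + 1) × Eu N → V → V
  change_coord : ∀ (c c' : AdaptedChart B) (y : Y) (hy : y ∈ c.total.source)
    (hy' : y ∈ c'.total.source) (a : A y),
    change c c' (c.total y) (coord c y hy a) = coord c' y hy' a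
  contDiffOn_change : ∀ c c' : AdaptedChart B,
    ContDiffOn ℝ ∞ (fun q : (Eu (n + 1) × Eu N) × V => change c c' q.1 q.2)
      ((c.trans c').source ×ˢ univ)

namespace FibreCoords

variable {B}
variable {A A' : Y → Type*} {V V' : Type*} [NormedAddCommGroup V] [NormedSpace ℝ V]
  [NormedAddCommGroup V'] [NormedSpace ℝ V'] (D : FibreCoords B A V) (D' : FibreCoords B A' V')

/-- The total space of the bundle. -/
structure Total (_D : FibreCoords B A V) where
  pt : Y
  val : A pt

open scoped Classical in
/-- The coordinates defined by the adapted chart `c` on the part of the total space over its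
domain: a point `a` in the fibre over `y` is mapped to the adapted coordinates of `y` together with
the fibre coordinates of `a`. -/
def chartFun (c : AdaptedChart B) (m : D.Total) : (Eu (n + 1) × Eu N) × V :=
  if h : m.pt ∈ c.total.source then (c.total m.pt, D.coord c m.pt h m.val) else (0, 0)

open scoped Classical in
/-- The inverse of `chartFun`; the point `m₀` is only used as a value outside of the domain. -/
def chartInv (c : AdaptedChart B) (m₀ : D.Total) (q : (Eu (n + 1) × Eu N) × V) : D.Total :=
  if h : c.total.symm q.1 ∈ c.total.source then
    ⟨c.total.symm q.1, (D.coord c _ h).symm q.2⟩ else m₀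

theorem chartFun_of_mem (c : AdaptedChart B) (m : D.Total) (h : m.pt ∈ c.total.source) :
    D.chartFun c m = (c.total m.pt, D.coord c m.pt h m.val) := dif_pos h

theorem chartInv_of_mem (c : AdaptedChart B) (m₀ : D.Total) (q : (Eu (n + 1) × Eu N) × V)
    (h : c.total.symm q.1 ∈ c.total.source) :
    D.chartInv c m₀ q = ⟨c.total.symm q.1, (D.coord c _ h).symm q.2⟩ := dif_pos h

/-- The chart of the total space defined by the adapted chart `c`. -/
def chart (c : AdaptedChart B) (m₀ : D.Total) : PartialEquiv D.Total ((Eu (n + 1) × Eu N) × V) where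
  toFun := D.chartFun c
  invFun := D.chartInv c m₀
  source := {m | m.pt ∈ c.total.source}
  target := c.total.target ×ˢ univ
  map_source' := by
    intro m hm
    rw [D.chartFun_of_mem c m hm]
    exact ⟨c.total.map_source hm, mem_univ _⟩
  map_target' := by
    rintro q ⟨hq, -⟩
    have h := c.total.map_target hq
    rw [D.chartInv_of_mem c m₀ q h]
    exact h
  left_inv' := by
    rintro ⟨y, a⟩ hy
    have hy' : y ∈ c.total.source := hy
    have e : c.total.symm (c.total y) = y := c.total.left_inv hy'
    have key : ∀ (y' : Y) (_ : y' = y) (h' : y' ∈ c.total.source),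
        (⟨y', (D.coord c y' h').symm (D.coord c y hy' a)⟩ : D.Total) = ⟨y, a⟩ := by
      intro y' e' h'
      subst e'
      simp
    have h2 : c.total.symm (c.total y) ∈ c.total.source := by rw [e]; exact hy'
    rw [D.chartFun_of_mem c _ hy, D.chartInv_of_mem c m₀ _ h2]
    exact key _ e h2
  right_inv' := by
    rintro ⟨w, v⟩ ⟨hw, -⟩
    have h := c.total.map_target hw
    rw [D.chartInv_of_mem c m₀ _ h, D.chartFun_of_mem c _ h]
    exact Prod.ext (c.total.right_inv hw) (Equiv.apply_symm_apply _ _)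

theorem chart_trans_source (c c' : AdaptedChart B) (m₀ m₀' : D.Total) :
    ((D.chart c m₀).symm.trans (D.chart c' m₀')).source = (c.trans c').source ×ˢ univ := by
  ext ⟨w, v⟩
  rw [PartialEquiv.trans_source, mem_prod, AdaptedChart.mem_trans_source]
  constructor
  · rintro ⟨hw, hw'⟩
    have h1 : w ∈ c.total.target := hw.1
    have h3 : (D.chartInv c m₀ (w, v)).pt ∈ c'.total.source := hw'
    rw [D.chartInv_of_mem c m₀ _ (c.total.map_target h1)] at h3
    exact ⟨⟨h1, h3⟩, mem_univ _⟩
  · rintro ⟨⟨h1, h3⟩, -⟩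
    refine ⟨⟨h1, mem_univ _⟩, ?_⟩
    change (D.chartInv c m₀ (w, v)).pt ∈ c'.total.source
    rw [D.chartInv_of_mem c m₀ _ (c.total.map_target h1)]
    exact h3

theorem chart_trans_apply (c c' : AdaptedChart B) (m₀ m₀' : D.Total)
    {q : (Eu (n + 1) × Eu N) × V} (hq : q ∈ (c.trans c').source ×ˢ (univ : Set V)) :
    (D.chart c' m₀') ((D.chart c m₀).symm q) = (c.trans c' q.1, D.change c c' q.1 q.2) := by
  obtain ⟨w, v⟩ := q
  have hw : w ∈ (c.trans c').source := hq.1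
  rw [AdaptedChart.mem_trans_source] at hw
  have h2 := c.total.map_target hw.1
  change D.chartFun c' (D.chartInv c m₀ (w, v)) = _
  rw [D.chartInv_of_mem c m₀ _ h2, D.chartFun_of_mem c' _ hw.2]
  refine Prod.ext rfl ?_
  have h4 := D.change_coord c c' _ h2 hw.2 ((D.coord c _ h2).symm v)
  rw [c.total.right_inv hw.1, Equiv.apply_symm_apply] at h4
  exact h4.symm

theorem contDiffOn_chart_trans (c c' : AdaptedChart B) (m₀ m₀' : D.Total) :
    ContDiffOn ℝ ∞ (fun q => (D.chart c' m₀') ((D.chart c m₀).symm q))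
      ((c.trans c').source ×ˢ (univ : Set V)) := by
  have h1 : ContDiffOn ℝ ∞ (fun q : (Eu (n + 1) × Eu N) × V => c.trans c' q.1)
      ((c.trans c').source ×ˢ (univ : Set V)) :=
    (c.contDiffOn_trans c').comp contDiff_fst.contDiffOn fun q hq => hq.1
  exact (h1.prodMk (D.contDiffOn_change c c')).congr fun q hq => D.chart_trans_apply c c' m₀ m₀' hq

/-- The fibre product over `Y` of two bundles. -/
def prod : FibreCoords B (fun y => A y × A' y) (V × V') where
  coord c y hy := (D.coord c y hy).prodCongr (D'.coord c y hy)
  change c c' w v := (D.change c c' w v.1, D'.change c c' w v.2)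
  change_coord c c' y hy hy' a :=
    Prod.ext (D.change_coord c c' y hy hy' a.1) (D'.change_coord c c' y hy hy' a.2)
  contDiffOn_change c c' := by
    refine ContDiffOn.prodMk ?_ ?_
    · exact (D.contDiffOn_change c c').comp
        (contDiff_fst.prodMk (contDiff_fst.comp contDiff_snd)).contDiffOn fun q hq => ⟨hq.1, hq.2⟩
    · exact (D'.contDiffOn_change c c').comp
        (contDiff_fst.prodMk (contDiff_snd.comp contDiff_snd)).contDiffOn fun q hq => ⟨hq.1, hq.2⟩

variable [IsManifold (𝓡 (n + 1)) ∞ X] [IsManifold (𝓡 N) ∞ F]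

/-- The atlas of the total space formed by the charts of all adapted charts of `Y`. -/
def core : ChartedSpaceCore ((Eu (n + 1) × Eu N) × V) D.Total where
  atlas := {e | ∃ c m₀, e = D.chart c m₀}
  chartAt m := D.chart (exists_adaptedChart B m.pt).choose m
  mem_chart_source m := (exists_adaptedChart B m.pt).choose_spec
  chart_mem_atlas m := ⟨_, _, rfl⟩
  open_source := by
    rintro _ _ ⟨c, m₀, rfl⟩ ⟨c', m₀', rfl⟩
    rw [chart_trans_source]
    exact (c.trans c').open_source.prod isOpen_univ
  continuousOn_toFun := by
    rintro _ _ ⟨c, m₀, rfl⟩ ⟨c', m₀', rfl⟩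
    rw [chart_trans_source]
    exact (D.contDiffOn_chart_trans c c' m₀ m₀').continuousOn

instance : TopologicalSpace D.Total := D.core.toTopologicalSpace

instance : ChartedSpace ((Eu (n + 1) × Eu N) × V) D.Total := D.core.toChartedSpace

instance : IsManifold 𝓘(ℝ, (Eu (n + 1) × Eu N) × V) ∞ D.Total := by
  apply isManifold_of_contDiffOn
  intro e e' he he'
  obtain ⟨e₁, ⟨c, m₀, rfl⟩, rfl⟩ : ∃ e₁, ∃ h : e₁ ∈ D.core.atlas,
      e = D.core.openPartialHomeomorph e₁ h := by
    simpa [atlas, ChartedSpace.atlas, ChartedSpaceCore.toChartedSpace] using he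
  obtain ⟨e₂, ⟨c', m₀', rfl⟩, rfl⟩ : ∃ e₂, ∃ h : e₂ ∈ D.core.atlas,
      e' = D.core.openPartialHomeomorph e₂ h := by
    simpa [atlas, ChartedSpace.atlas, ChartedSpaceCore.toChartedSpace] using he'
  refine (D.contDiffOn_chart_trans c c' m₀ m₀').mono ?_
  rintro q ⟨hq, -⟩
  rw [← D.chart_trans_source c c' m₀ m₀']
  exact hq

end FibreCoords

/-! ## The jet bundle, the dual jet bundle and the Pontryagin bundle -/

/-- The fibre `J¹_y Y` : the linear maps `γ : T_x X → T_y Y`, `x = proj y`, with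
`T proj ∘ γ = id`. -/
def JetFibre (y : Y) : Type :=
  {γ : TangentSpace (𝓡 (n + 1)) (B.proj y) →L[ℝ] TangentSpace (𝓡 (n + N + 1)) y //
    (mfderiv (𝓡 (n + N + 1)) (𝓡 (n + 1)) B.proj y).comp γ = ContinuousLinearMap.id ℝ _}

/-- The alternating `k`-forms on `E` that vanish when two of their arguments lie in `K`. -/
def twoVanishing {E : Type*} [AddCommGroup E] [Module ℝ E] [TopologicalSpace E]
    (K : Submodule ℝ E) (k : ℕ) : Submodule ℝ (E [⋀^Fin k]→L[ℝ] ℝ) where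
  carrier := {z | ∀ (u : Fin k → E) (i j : Fin k), i ≠ j → u i ∈ K → u j ∈ K → z u = 0}
  add_mem' := by
    intro a b ha hb u i j hij hi hj
    simp [ha u i j hij hi hj, hb u i j hij hi hj]
  zero_mem' := by
    intro u i j _ _ _
    simp
  smul_mem' := by
    intro r a ha u i j hij hi hj
    simp [ha u i j hij hi hj]

/-- The vertical space `V_y Y ⊆ T_y Y`. -/
def verticalSpace (y : Y) : Submodule ℝ (TangentSpace (𝓡 (n + N + 1)) y) :=
  LinearMap.ker (mfderiv (𝓡 (n + N + 1)) (𝓡 (n + 1)) B.proj y).toLinearMap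

/-- The fibre `Z_y` : the `(n+1)`-forms on `T_y Y` that vanish when contracted with two vertical
vectors. -/
def DualFibre (y : Y) : Type := twoVanishing (verticalSpace B y) (n + 1)

/-- The typical fibre of `Z` : the `(n+1)`-forms `p dⁿ⁺¹x + p_A^μ dy^A ∧ dⁿx_μ`
on `ℝ^(n+1) × ℝ^N`. -/
abbrev DualModelFibre (n N : ℕ) : Type :=
  twoVanishing (LinearMap.ker (LinearMap.fst ℝ (Eu (n + 1)) (Eu N))) (n + 1)

variable {B}

/-- The coordinates `(v^A_μ)` of a jet `γ`, in adapted coordinates. -/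
def jetCoord (c : AdaptedChart B) (y : Y) (hy : y ∈ c.total.source) :
    JetFibre B y ≃ (Eu (n + 1) →L[ℝ] Eu N) where
  toFun γ := (ContinuousLinearMap.snd ℝ (Eu (n + 1)) (Eu N)).comp
    ((c.dTotal hy : _ →L[ℝ] _).comp (γ.1.comp ((c.dBase (c.proj_mem y hy)).symm : _ →L[ℝ] _)))
  invFun v := ⟨((c.dTotal hy).symm : _ →L[ℝ] _).comp
    (((ContinuousLinearMap.id ℝ (Eu (n + 1))).prod v).comp
      (c.dBase (c.proj_mem y hy) : _ →L[ℝ] _)), by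
    ext1 u
    apply (c.dBase (c.proj_mem y hy)).injective
    simp only [ContinuousLinearMap.comp_apply]
    rw [← c.fst_dTotal hy]
    simp⟩
  left_inv γ := by
    apply Subtype.ext
    ext1 u
    apply (c.dTotal hy).injective
    have h := c.fst_dTotal hy (γ.1 u)
    have h' : mfderiv (𝓡 (n + N + 1)) (𝓡 (n + 1)) B.proj y (γ.1 u) = u :=
      congrArg (fun T => T u) γ.2
    rw [h'] at h
    refine Prod.ext ?_ ?_
    · simp [h]
    · simp
  right_inv v := by
    ext1 u
    simp

/-- The coordinates of an element of `Z_y` : its expression as a form on `ℝ^(n+1) × ℝ^N` in adapted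
coordinates. -/
def dualCoord (c : AdaptedChart B) (y : Y) (hy : y ∈ c.total.source) :
    DualFibre B y ≃ DualModelFibre n N where
  toFun z := ⟨z.1.compContinuousLinearMap ((c.dTotal hy).symm : _ →L[ℝ] _), by
    have key : ∀ w : Eu (n + 1) × Eu N, w ∈ LinearMap.ker (LinearMap.fst ℝ (Eu (n + 1)) (Eu N)) →
        (c.dTotal hy).symm w ∈ verticalSpace B y := by
      intro w hw
      have h := c.fst_dTotal hy ((c.dTotal hy).symm w)
      have hw' : w.1 = 0 := hw
      rw [ContinuousLinearEquiv.apply_symm_apply, hw'] at h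
      exact (c.dBase (c.proj_mem y hy)).map_eq_zero_iff.1 h.symm
    intro u i j hij hi hj
    exact z.2 _ i j hij (key _ hi) (key _ hj)⟩
  invFun z := ⟨z.1.compContinuousLinearMap (c.dTotal hy : _ →L[ℝ] _), by
    have key : ∀ w, w ∈ verticalSpace B y →
        c.dTotal hy w ∈ LinearMap.ker (LinearMap.fst ℝ (Eu (n + 1)) (Eu N)) := by
      intro w hw
      have hw' : mfderiv (𝓡 (n + N + 1)) (𝓡 (n + 1)) B.proj y w = 0 := hw
      have h := c.fst_dTotal hy w
      rw [hw', map_zero] at h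
      exact h
    intro u i j hij hi hj
    exact z.2 _ i j hij (key _ hi) (key _ hj)⟩
  left_inv z := by
    apply Subtype.ext
    ext u
    simp [Function.comp_def]
  right_inv z := by
    apply Subtype.ext
    ext u
    simp [Function.comp_def]

/-- The values of a form on all tuples of vectors of a basis. -/
def basisValues (n N : ℕ) : DualModelFibre n N →ₗ[ℝ]
    ((Fin (n + 1) → Module.Free.ChooseBasisIndex ℝ (Eu (n + 1) × Eu N)) → ℝ) where
  toFun z r := z.1 fun i => Module.Free.chooseBasis ℝ (Eu (n + 1) × Eu N) (r i)
  map_add' _ _ := rfl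
  map_smul' _ _ := rfl

theorem ker_basisValues (n N : ℕ) : LinearMap.ker (basisValues n N) = ⊥ := by
  refine LinearMap.ker_eq_bot_of_injective ?_
  intro a b h
  apply Subtype.ext
  apply ContinuousAlternatingMap.toAlternatingMap_injective
  refine Module.Basis.ext_alternating (Module.Free.chooseBasis ℝ (Eu (n + 1) × Eu N)) ?_
  intro r _
  exact congrFun h r

/-- A left inverse of `basisValues`. -/
def ofBasisValues (n N : ℕ) :
    ((Fin (n + 1) → Module.Free.ChooseBasisIndex ℝ (Eu (n + 1) × Eu N)) → ℝ) →ₗ[ℝ]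
      DualModelFibre n N :=
  (LinearMap.exists_leftInverse_of_injective (K := ℝ) (V := DualModelFibre n N) (basisValues n N)
    (ker_basisValues n N)).choose

theorem ofBasisValues_basisValues (n N : ℕ) (z : DualModelFibre n N) :
    ofBasisValues n N (basisValues n N z) = z :=
  congrArg (fun T => T z)
    (LinearMap.exists_leftInverse_of_injective (K := ℝ) (V := DualModelFibre n N) (basisValues n N)
    (ker_basisValues n N)).choose_spec

variable (B)

/-- The jet bundle as a smooth bundle over `Y`. -/
def jetCoords : FibreCoords B (JetFibre B) (Eu (n + 1) →L[ℝ] Eu N) where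
  coord := jetCoord
  change c c' w v := (ContinuousLinearMap.snd ℝ (Eu (n + 1)) (Eu N)).comp
    ((fderiv ℝ (c.trans c') w).comp
      (((ContinuousLinearMap.id ℝ (Eu (n + 1))).prod v).comp
        (fderiv ℝ (c'.baseTrans c) (c.trans c' w).1)))
  change_coord c c' y hy hy' γ := by
    ext1 u
    obtain ⟨t, rfl⟩ := (c'.dBase (c'.proj_mem y hy')).surjective u
    have e1 : (c.trans c' (c.total y)).1 = c'.base (B.proj y) := by
      rw [AdaptedChart.trans_apply, c.total.left_inv hy, c'.total_fst y hy']
    have e2 : (c.dTotal hy (γ.1 t)) = (c.dBase (c.proj_mem y hy) t, (c.dTotal hy (γ.1 t)).2) := by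
      refine Prod.ext ?_ rfl
      have h' : mfderiv (𝓡 (n + N + 1)) (𝓡 (n + 1)) B.proj y (γ.1 t) = t :=
        congrArg (fun T => T t) γ.2
      rw [c.fst_dTotal hy, h']
    have e3 := AdaptedChart.fderiv_trans hy hy' (γ.1 t)
    rw [e2] at e3
    simp only [ContinuousLinearMap.comp_apply, e1,
      AdaptedChart.fderiv_baseTrans (c'.proj_mem y hy') (c.proj_mem y hy)]
    have e4 : jetCoord c y hy γ (c.dBase (c.proj_mem y hy) t) = (c.dTotal hy (γ.1 t)).2 := by
      change (c.dTotal hy (γ.1 ((c.dBase (c.proj_mem y hy)).symm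
        (c.dBase (c.proj_mem y hy) t)))).2 = _
      rw [ContinuousLinearEquiv.symm_apply_apply]
    have e5 : jetCoord c' y hy' γ (c'.dBase (c'.proj_mem y hy') t) =
        (c'.dTotal hy' (γ.1 t)).2 := by
      change (c'.dTotal hy' (γ.1 ((c'.dBase (c'.proj_mem y hy')).symm
        (c'.dBase (c'.proj_mem y hy') t)))).2 = _
      rw [ContinuousLinearEquiv.symm_apply_apply]
    rw [e5, ← e3, ← e4]
    rfl
  contDiffOn_change c c' := by
    have h1 : ContDiffOn ℝ ∞
        (fun q : (Eu (n + 1) × Eu N) × (Eu (n + 1) →L[ℝ] Eu N) => fderiv ℝ (c.trans c') q.1)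
        ((c.trans c').source ×ˢ univ) :=
      ((c.contDiffOn_trans c').fderiv_of_isOpen (c.trans c').open_source (by simp)).comp
        contDiff_fst.contDiffOn fun q hq => hq.1
    have h2 : ContDiffOn ℝ ∞
        (fun q : (Eu (n + 1) × Eu N) × (Eu (n + 1) →L[ℝ] Eu N) =>
          fderiv ℝ (c'.baseTrans c) (c.trans c' q.1).1)
        ((c.trans c').source ×ˢ univ) :=
      ((c'.contDiffOn_baseTrans c).fderiv_of_isOpen (c'.baseTrans c).open_source (by simp)).comp
        (contDiff_fst.comp_contDiffOn
          ((c.contDiffOn_trans c').comp contDiff_fst.contDiffOn fun q hq => hq.1))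
        fun q hq => AdaptedChart.trans_fst_mem_baseTrans_source hq.1
    have h3 : ContDiff ℝ ∞
        (fun q : (Eu (n + 1) × Eu N) × (Eu (n + 1) →L[ℝ] Eu N) =>
          (ContinuousLinearMap.id ℝ (Eu (n + 1))).prod q.2) := by
      have : (fun q : (Eu (n + 1) × Eu N) × (Eu (n + 1) →L[ℝ] Eu N) =>
          (ContinuousLinearMap.id ℝ (Eu (n + 1))).prod q.2) = fun q =>
          (ContinuousLinearMap.inl ℝ (Eu (n + 1)) (Eu N)) +
            (ContinuousLinearMap.inr ℝ (Eu (n + 1)) (Eu N)).comp q.2 := by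
        funext q
        ext1 u
        simp
      rw [this]
      exact contDiff_const.add (contDiff_const.clm_comp contDiff_snd)
    exact contDiffOn_const.clm_comp (h1.clm_comp (h3.contDiffOn.clm_comp h2))

/-- The dual jet bundle `Z` as a smooth bundle over `Y`. -/
def dualCoords : FibreCoords B (DualFibre B) (DualModelFibre n N) where
  coord := dualCoord
  change c c' w z := ofBasisValues n N fun r =>
    z.1 fun i => fderiv ℝ (c'.trans c) (c.trans c' w)
      (Module.Free.chooseBasis ℝ (Eu (n + 1) × Eu N) (r i))
  change_coord c c' y hy hy' z := by
    rw [← ofBasisValues_basisValues n N (dualCoord c' y hy' z)]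
    congr 1
    funext r
    have e1 : c.trans c' (c.total y) = c'.total y := by
      rw [AdaptedChart.trans_apply, c.total.left_inv hy]
    simp only [e1]
    change z.1 _ = z.1 _
    congr 1
    funext i
    change (c.dTotal hy).symm (fderiv ℝ (c'.trans c) (c'.total y)
      (Module.Free.chooseBasis ℝ (Eu (n + 1) × Eu N) (r i))) =
        (c'.dTotal hy').symm (Module.Free.chooseBasis ℝ (Eu (n + 1) × Eu N) (r i))
    have e2 := AdaptedChart.fderiv_trans hy' hy
      ((c'.dTotal hy').symm (Module.Free.chooseBasis ℝ (Eu (n + 1) × Eu N) (r i)))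
    rw [ContinuousLinearEquiv.apply_symm_apply] at e2
    rw [e2, ContinuousLinearEquiv.symm_apply_apply]
  contDiffOn_change c c' := by
    have h0 : ContDiff ℝ ∞ fun t => ofBasisValues n N t :=
      ContinuousLinearMap.contDiff (𝕜 := ℝ) (F := DualModelFibre n N)
        (LinearMap.toContinuousLinearMap (𝕜 := ℝ) (F' := DualModelFibre n N) (ofBasisValues n N))
    refine h0.comp_contDiffOn (contDiffOn_pi.2 fun r => ?_)
    have h2 : ContDiffOn ℝ ∞
        (fun q : (Eu (n + 1) × Eu N) × DualModelFibre n N =>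
          fderiv ℝ (c'.trans c) (c.trans c' q.1))
        ((c.trans c').source ×ˢ univ) :=
      ((c'.contDiffOn_trans c).fderiv_of_isOpen (c'.trans c).open_source (by simp)).comp
        ((c.contDiffOn_trans c').comp contDiff_fst.contDiffOn fun q hq => hq.1)
        fun q hq => AdaptedChart.trans_mem_trans_source hq.1
    have h3 := ContinuousMultilinearMap.contDiff (𝕜 := ℝ) (n := ∞)
      (E := fun _ : Fin (n + 1) => (Eu (n + 1) × Eu N) →L[ℝ] (Eu (n + 1) × Eu N))
      (F := ContinuousMultilinearMap ℝ (fun _ : Fin (n + 1) => Eu (n + 1) × Eu N) ℝ →L[ℝ]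
        ContinuousMultilinearMap ℝ (fun _ : Fin (n + 1) => Eu (n + 1) × Eu N) ℝ)
      (ContinuousMultilinearMap.compContinuousLinearMapContinuousMultilinear ℝ
        (fun _ : Fin (n + 1) => Eu (n + 1) × Eu N) (fun _ => Eu (n + 1) × Eu N) ℝ)
    have h4 := h3.comp_contDiffOn (contDiffOn_pi.2 fun _ : Fin (n + 1) => h2)
    have h5 : ContDiff ℝ ∞ (fun q : (Eu (n + 1) × Eu N) × DualModelFibre n N =>
        (q.2.1 : (Eu (n + 1) × Eu N) [⋀^Fin (n + 1)]→L[ℝ] ℝ)) :=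
      (ContinuousLinearMap.contDiff (𝕜 := ℝ) (E := DualModelFibre n N)
        (F := (Eu (n + 1) × Eu N) [⋀^Fin (n + 1)]→L[ℝ] ℝ)
        (Submodule.subtypeL _)).comp contDiff_snd
    have h5' : ContDiff ℝ ∞ (fun q : (Eu (n + 1) × Eu N) × DualModelFibre n N =>
        q.2.1.toContinuousMultilinearMap) :=
      (ContinuousLinearMap.contDiff (𝕜 := ℝ) (E := (Eu (n + 1) × Eu N) [⋀^Fin (n + 1)]→L[ℝ] ℝ)
        (F := ContinuousMultilinearMap ℝ (fun _ : Fin (n + 1) => Eu (n + 1) × Eu N) ℝ)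
        (ContinuousAlternatingMap.toContinuousMultilinearMapCLM ℝ)).comp h5
    have h6 := h4.clm_apply h5'.contDiffOn
    exact (ContinuousMultilinearMap.apply ℝ (fun _ : Fin (n + 1) => Eu (n + 1) × Eu N) ℝ
      (fun i => Module.Free.chooseBasis ℝ (Eu (n + 1) × Eu N) (r i))).contDiff.comp_contDiffOn h6

/-- The Pontryagin bundle `M = J¹Y ×_Y Z` as a smooth bundle over `Y`. -/
def pontryaginCoords : FibreCoords B (fun y => JetFibre B y × DualFibre B y)
    ((Eu (n + 1) →L[ℝ] Eu N) × DualModelFibre n N) :=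
  (jetCoords B).prod (dualCoords B)

/-- The total space of the first jet bundle `J¹Y`. -/
abbrev JetBundle : Type _ := (jetCoords B).Total

/-- The total space of the dual jet bundle `Z`. -/
abbrev DualJetBundle : Type _ := (dualCoords B).Total

/-- The total space of the Pontryagin bundle `M = J¹Y ×_Y Z`. -/
abbrev PontryaginBundle : Type _ := (pontryaginCoords B).Total

/-- The model vector space of `J¹Y`, with coordinates `((x^μ, y^A), v^A_μ)`. -/
abbrev JetModel (n N : ℕ) : Type := (Eu (n + 1) × Eu N) × (Eu (n + 1) →L[ℝ] Eu N)

/-- The model vector space of `Z`, with coordinates `((x^μ, y^A), (p, p_A^μ))`. -/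
abbrev DualModel (n N : ℕ) : Type := (Eu (n + 1) × Eu N) × DualModelFibre n N

/-- The model vector space of `M`, with coordinates `((x^μ, y^A), (v^A_μ, (p, p_A^μ)))`. -/
abbrev PontryaginModel (n N : ℕ) : Type :=
  (Eu (n + 1) × Eu N) × ((Eu (n + 1) →L[ℝ] Eu N) × DualModelFibre n N)

variable {B}

/-- The projection `π_{YZ} : Z → Y`. -/
def projYZ (z : DualJetBundle B) : Y := z.pt

/-- The projection `π_{XM} : M → X`. -/
def projXM (m : PontryaginBundle B) : X := B.proj m.pt

/-- The projection `M → J¹Y`. -/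
def projJM (m : PontryaginBundle B) : JetBundle B := ⟨m.pt, m.val.1⟩

/-- The projection `π_{ZM} : M → Z`. -/
def projZM (m : PontryaginBundle B) : DualJetBundle B := ⟨m.pt, m.val.2⟩

/-- The pairing `⟨z, γ⟩ = γ^* z`, an `(n+1)`-form on `T_x X`, for `m = (γ, z)` in `M`. -/
def pairing (m : PontryaginBundle B) :
    TangentSpace (𝓡 (n + 1)) (projXM m) [⋀^Fin (n + 1)]→L[ℝ] ℝ :=
  m.val.2.1.compContinuousLinearMap m.val.1.1

variable [IsManifold (𝓡 (n + 1)) ∞ X] [IsManifold (𝓡 N) ∞ F]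

variable (B) in
/-- The canonical `(n+1)`-form `Θ` on `Z`: `Θ(z) = π_{YZ}^* z`. -/
def canonicalForm : DForm 𝓘(ℝ, DualModel n N) (DualJetBundle B) (n + 1) :=
  fun z => z.val.1.compContinuousLinearMap
    (mfderiv 𝓘(ℝ, DualModel n N) (𝓡 (n + N + 1)) projYZ z)

variable (B) in
/-- The canonical multisymplectic `(n+2)`-form `Ω = -dΘ` on `Z`. -/
def multisymplecticForm : DForm 𝓘(ℝ, DualModel n N) (DualJetBundle B) (n + 2) :=
  -DForm.d 𝓘(ℝ, DualModel n N) (canonicalForm B)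

variable (B) in
/-- The form `Θ_M = π_{ZM}^* Θ` on `M`. -/
def thetaM : DForm 𝓘(ℝ, PontryaginModel n N) (PontryaginBundle B) (n + 1) :=
  DForm.pullback 𝓘(ℝ, PontryaginModel n N) 𝓘(ℝ, DualModel n N) projZM (canonicalForm B)

variable (B) in
/-- The form `Ω_M = π_{ZM}^* Ω` on `M`. -/
def omegaM : DForm 𝓘(ℝ, PontryaginModel n N) (PontryaginBundle B) (n + 2) :=
  DForm.pullback 𝓘(ℝ, PontryaginModel n N) 𝓘(ℝ, DualModel n N) projZM (multisymplecticForm B)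

/-- The generalized energy density `𝓔(γ, z) = ⟨z, γ⟩ - 𝓛(γ)` of the Lagrangian density `𝓛 = L η`,
as a map from `M` to the bundle of `(n+1)`-forms on `X`. -/
def energyDensity (η : VolForm (n + 1) X) (L : JetBundle B → ℝ) (m : PontryaginBundle B) :
    TangentSpace (𝓡 (n + 1)) (projXM m) [⋀^Fin (n + 1)]→L[ℝ] ℝ :=
  pairing m - L (projJM m) • η.form (projXM m)

/-- The generalized energy density as a horizontal `(n+1)`-form on `M`. -/
def energyForm (η : VolForm (n + 1) X) (L : JetBundle B → ℝ) :
    DForm 𝓘(ℝ, PontryaginModel n N) (PontryaginBundle B) (n + 1) :=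
  fun m => (energyDensity η L m).compContinuousLinearMap
    (mfderiv 𝓘(ℝ, PontryaginModel n N) (𝓡 (n + 1)) projXM m)

/-- The form `Ω_𝓔 = Ω_M + d𝓔` on `M`. -/
def omegaE (η : VolForm (n + 1) X) (L : JetBundle B → ℝ) :
    DForm 𝓘(ℝ, PontryaginModel n N) (PontryaginBundle B) (n + 2) :=
  omegaM B + DForm.d 𝓘(ℝ, PontryaginModel n N) (energyForm η L)

/-- Smooth sections of `π_{XM} : M → X`. -/
def IsPontryaginSection (ψ : X → PontryaginBundle B) : Prop :=
  ContMDiff (𝓡 (n + 1)) 𝓘(ℝ, PontryaginModel n N) ∞ ψ ∧ ∀ x, projXM (ψ x) = x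

/-- The Hamilton–Pontryagin action `∫_U ψ^*(Θ_M - 𝓔)` over the part `U` of `X`. -/
def hpAction [SigmaCompactSpace X] [MeasurableSpace X] (η : VolForm (n + 1) X)
    (L : JetBundle B → ℝ) (U : Set X) (ψ : X → PontryaginBundle B) : ℝ :=
  DForm.integral η U
    (DForm.pullback (𝓡 (n + 1)) 𝓘(ℝ, PontryaginModel n N) ψ (thetaM B - energyForm η L))

/-- `Ψ` is a vertical variation of the section `ψ`, supported in `U` : a smooth one-parameter family
of sections `Ψ l`, for `l` in an interval around `0`, with `Ψ 0 = ψ`, which agree with `ψ` outside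
of `U`. -/
structure IsVerticalVariation (ψ : X → PontryaginBundle B) (U : Set X)
    (Ψ : ℝ → X → PontryaginBundle B) : Prop where
  zero : Ψ 0 = ψ
  exists_interval : ∃ ε : ℝ, 0 < ε ∧
    ContMDiffOn (𝓘(ℝ, ℝ).prod (𝓡 (n + 1))) 𝓘(ℝ, PontryaginModel n N) ∞
      (fun q : ℝ × X => Ψ q.1 q.2) (Ioo (-ε) ε ×ˢ univ) ∧
    ∀ l ∈ Ioo (-ε) ε, IsPontryaginSection (Ψ l) ∧ ∀ x, x ∉ U → Ψ l x = ψ x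

/-- `ψ` is a critical point of the Hamilton–Pontryagin action: for each vertical variation
supported in a compact set `U`, the derivative at `0` of the action over `U` exists and vanishes. -/
def IsHPCritical [SigmaCompactSpace X] [MeasurableSpace X] (η : VolForm (n + 1) X)
    (L : JetBundle B → ℝ) (ψ : X → PontryaginBundle B) : Prop :=
  ∀ (U : Set X) (Ψ : ℝ → X → PontryaginBundle B), IsCompact U → IsVerticalVariation ψ U Ψ →
    HasDerivAt (fun l : ℝ => hpAction η L U (Ψ l)) 0 0

/-- Smooth `π_{XM}`-vertical vector fields on `M`. -/
def IsVerticalField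
    (V : ∀ m : PontryaginBundle B, TangentSpace 𝓘(ℝ, PontryaginModel n N) m) : Prop :=
  ContMDiff 𝓘(ℝ, PontryaginModel n N) 𝓘(ℝ, PontryaginModel n N).tangent ∞
    (fun m => (⟨m, V m⟩ : TangentBundle 𝓘(ℝ, PontryaginModel n N) (PontryaginBundle B))) ∧
  ∀ m, mfderiv 𝓘(ℝ, PontryaginModel n N) (𝓡 (n + 1)) projXM m (V m) = 0

end Bundles

end

/-!
Both sides of the equivalence concern the single `(n+1)`-form `β = Θ_M - 𝓔` on the Pontryagin bundle
`M`. The exterior derivative commutes with the pullback by `π_{ZM}`, so `Ω_M = -dΘ_M` and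
`Ω_𝓔 = -dβ` (`omegaE_eq`).

Let `Ψ` be a vertical variation of `ψ`, and let `V` be its velocity at time `0`, a vector field
along `ψ`. Pulling `β` back to the cylinder `ℝ × X` and evaluating the exterior derivative of this
pullback on the time direction and a frame of `X` gives Cartan's formula

  `d/dl (Ψ l)^* β = ψ^* (V ⌟ dβ) + d (ψ^* (V ⌟ β))` at `l = 0`

(`DForm.fderiv_pullback_family_apply`). The last term is exact with a compactly supported
primitive, so its integral vanishes by the Stokes theorem (`DForm.integral_ratio_d_eq_zero`).
Differentiating under the integral sign, the derivative of the action exists and equals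
`∫_U ψ^* (V ⌟ dβ)` (`DForm.hasDerivAt_integral_pullback_family`). The integral is defined by a
measure assembled from countably many charts; `DForm.measure_apply` shows by the change of
variables formula that it is the usual weighted Lebesgue measure in every chart, hence locally
finite and positive on nonempty open sets.

If `ψ` satisfies the implicit Euler–Lagrange equations, the integrand vanishes at each point: the
velocity of a variation by sections is vertical, and each vertical tangent vector extends to a
smooth vertical field on `M` (`exists_isVerticalField_eq`).

Conversely, let `ψ` be critical. If `g` is a test function on `X`, the family
`(l, x) ↦ Ψ (l * g x) x` is again a vertical variation, with velocity `g V`. Hence the integral of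
`g ψ^* (V ⌟ dβ)` vanishes for all `g`, and so does the continuous integrand
(`contractAlong_eq_zero_of_isHPCritical`). Every vertical tangent vector at a point `ψ x₀` arises as
the velocity of a variation, obtained by translating `ψ` along the fibres in adapted coordinates
and cutting off (`exists_verticalVariation_velocity`), which gives the Euler–Lagrange equations
at `x₀`.
-/

noncomputable section

/-! ### Smooth families of alternating forms -/

section Alternating

variable {E E' G : Type*} [NormedAddCommGroup E] [NormedSpace ℝ E]
  [NormedAddCommGroup E'] [NormedSpace ℝ E'] [NormedAddCommGroup G] [NormedSpace ℝ G] {k : ℕ}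

/-- An alternating form depends linearly on finitely many of its values, namely its values on tuples
of basis vectors. -/
theorem exists_leftInverse_basisValues_alternating (E : Type*) [NormedAddCommGroup E]
    [NormedSpace ℝ E] [FiniteDimensional ℝ E] (k : ℕ) :
    ∃ (ι : Type) (_ : Fintype ι) (v : ι → Fin k → E)
      (T : (ι → ℝ) →ₗ[ℝ] E [⋀^Fin k]→L[ℝ] ℝ), ∀ f, T (fun r => f (v r)) = f := by
  let b := Module.finBasis ℝ E
  let S : (E [⋀^Fin k]→L[ℝ] ℝ) →ₗ[ℝ] ((Fin k → Fin (Module.finrank ℝ E)) → ℝ) :=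
    { toFun := fun f r => f fun i => b (r i)
      map_add' := fun _ _ => rfl
      map_smul' := fun _ _ => rfl }
  have hS : LinearMap.ker S = ⊥ := by
    refine LinearMap.ker_eq_bot_of_injective fun f g h => ?_
    apply ContinuousAlternatingMap.toAlternatingMap_injective
    exact Module.Basis.ext_alternating b fun r _ => congrFun h r
  obtain ⟨T, hT⟩ := LinearMap.exists_leftInverse_of_injective S hS
  exact ⟨_, inferInstance, fun r i => b (r i), T, fun f => congrArg (fun A => A f) hT⟩

instance finiteDimensional_continuousAlternatingMap [FiniteDimensional ℝ E] :
    FiniteDimensional ℝ (E [⋀^Fin k]→L[ℝ] ℝ) := by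
  obtain ⟨ι, _, v, T, hT⟩ := exists_leftInverse_basisValues_alternating E k
  exact Module.Finite.of_surjective T fun f => ⟨_, hT f⟩

/-- A family of alternating forms is smooth as soon as its values on fixed vectors are. This reduces
all smoothness questions for forms to real valued functions. -/
theorem contDiffAt_alternating_iff [FiniteDimensional ℝ E] {g : G → E [⋀^Fin k]→L[ℝ] ℝ} {u : G}
    {m : ℕ∞ω} : ContDiffAt ℝ m g u ↔ ∀ v : Fin k → E, ContDiffAt ℝ m (fun u => g u v) u := by
  constructor
  · intro h v
    exact (ContinuousAlternatingMap.apply ℝ E ℝ v).contDiff.contDiffAt.comp u h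
  · intro h
    obtain ⟨ι, _, v, T, hT⟩ := exists_leftInverse_basisValues_alternating E k
    have h0 : ContDiff ℝ m (fun t => T t) :=
      ContinuousLinearMap.contDiff (LinearMap.toContinuousLinearMap T)
    have h1 : ContDiffAt ℝ m (fun u r => g u (v r)) u := contDiffAt_pi.2 fun r => h (v r)
    have h2 := h0.contDiffAt.comp u h1
    simpa only [Function.comp_def, hT] using h2

/-- Evaluating a smooth family of forms on smooth families of vectors. A vector `w` is regarded as
the linear map `t ↦ t • w`, so that the statement becomes the smoothness of composition of
multilinear maps with linear maps. -/
theorem ContDiffAt.alternating_apply {m : ℕ∞ω} {g : G → E [⋀^Fin k]→L[ℝ] ℝ}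
    {w : Fin k → G → E} {u : G} (hg : ContDiffAt ℝ m g u) (hw : ∀ i, ContDiffAt ℝ m (w i) u) :
    ContDiffAt ℝ m (fun u => g u fun i => w i u) u := by
  have h3 := ContinuousMultilinearMap.contDiff (𝕜 := ℝ) (n := m)
    (E := fun _ : Fin k => ℝ →L[ℝ] E)
    (F := ContinuousMultilinearMap ℝ (fun _ : Fin k => E) ℝ →L[ℝ]
      ContinuousMultilinearMap ℝ (fun _ : Fin k => ℝ) ℝ)
    (ContinuousMultilinearMap.compContinuousLinearMapContinuousMultilinear ℝ
      (fun _ : Fin k => ℝ) (fun _ => E) ℝ)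
  have h2 : ∀ i, ContDiffAt ℝ m (fun u => ContinuousLinearMap.toSpanSingleton ℝ (w i u)) u :=
    fun i => (ContinuousLinearMap.toSpanSingletonCLE (𝕜 := ℝ)
      (E := E)).contDiff.contDiffAt.comp u (hw i)
  have h4 := h3.contDiffAt.comp u (contDiffAt_pi.2 h2)
  have h5 : ContDiffAt ℝ m (fun u => (g u).toContinuousMultilinearMap) u :=
    (ContinuousLinearMap.contDiff (𝕜 := ℝ) (E := E [⋀^Fin k]→L[ℝ] ℝ)
      (F := ContinuousMultilinearMap ℝ (fun _ : Fin k => E) ℝ)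
      (ContinuousAlternatingMap.toContinuousMultilinearMapCLM ℝ)).contDiffAt.comp u hg
  have h6 := h4.clm_apply h5
  have h7 := (ContinuousMultilinearMap.apply ℝ (fun _ : Fin k => ℝ) ℝ
      (fun _ => (1 : ℝ))).contDiff.contDiffAt.comp u h6
  refine h7.congr_of_eventuallyEq (Filter.Eventually.of_forall fun u => ?_)
  change g u _ = g u _
  congr 1
  funext i
  change w i u = (1 : ℝ) • w i u
  rw [one_smul]

theorem ContDiffAt.alternating_comp [FiniteDimensional ℝ E] {m : ℕ∞ω}
    {g : G → E' [⋀^Fin k]→L[ℝ] ℝ}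
    {A : G → E →L[ℝ] E'} {u : G} (hg : ContDiffAt ℝ m g u) (hA : ContDiffAt ℝ m A u) :
    ContDiffAt ℝ m (fun u => (g u).compContinuousLinearMap (A u)) u :=
  contDiffAt_alternating_iff.2 fun _ =>
    hg.alternating_apply fun _ => hA.clm_apply contDiffAt_const

end Alternating

/-! ### Pullbacks and exterior derivatives of forms on manifolds -/

namespace DForm

variable {E : Type*} [NormedAddCommGroup E] [NormedSpace ℝ E]
  {P : Type*} [TopologicalSpace P] [ChartedSpace E P]
  {E' : Type*} [NormedAddCommGroup E'] [NormedSpace ℝ E']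
  {P' : Type*} [TopologicalSpace P'] [ChartedSpace E' P']
  {E'' : Type*} [NormedAddCommGroup E''] [NormedSpace ℝ E'']
  {P'' : Type*} [TopologicalSpace P''] [ChartedSpace E'' P''] {k : ℕ}

/-- A form on a vector space, as a function with values in a fixed space. -/
abbrev onVec (α : DForm 𝓘(ℝ, E) E k) : E → E [⋀^Fin k]→L[ℝ] ℝ := fun u => α u

/-- Extensionality for forms at a point, tested on vectors of the model space: the tangent spaces
are copies of the model space. -/
theorem form_ext {p : P} {a b : TangentSpace 𝓘(ℝ, E) p [⋀^Fin k]→L[ℝ] ℝ}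
    (h : ∀ v : Fin k → E, (a : E [⋀^Fin k]→L[ℝ] ℝ) v = (b : E [⋀^Fin k]→L[ℝ] ℝ) v) : a = b :=
  ContinuousAlternatingMap.ext (M := E) h

theorem apply_congr (α : DForm 𝓘(ℝ, E) P k) {p p' : P} (h : p = p') (v : Fin k → E) :
    (α p : E [⋀^Fin k]→L[ℝ] ℝ) v = (α p' : E [⋀^Fin k]→L[ℝ] ℝ) v := by
  subst h; rfl

theorem pullback_apply (f : P → P') (α : DForm 𝓘(ℝ, E') P' k) (p : P) (v : Fin k → E) :
    (pullback 𝓘(ℝ, E) 𝓘(ℝ, E') f α p : E [⋀^Fin k]→L[ℝ] ℝ) v =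
      (α (f p) : E' [⋀^Fin k]→L[ℝ] ℝ)
        fun i => (mfderiv 𝓘(ℝ, E) 𝓘(ℝ, E') f p : E →L[ℝ] E') (v i) := rfl

theorem pullback_congr {f g : P → P'} {p : P} (h : f =ᶠ[𝓝 p] g) (α : DForm 𝓘(ℝ, E') P' k) :
    pullback 𝓘(ℝ, E) 𝓘(ℝ, E') f α p = pullback 𝓘(ℝ, E) 𝓘(ℝ, E') g α p := by
  have h1 : (mfderiv 𝓘(ℝ, E) 𝓘(ℝ, E') f p : E →L[ℝ] E') = mfderiv 𝓘(ℝ, E) 𝓘(ℝ, E') g p :=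
    h.mfderiv_eq
  refine form_ext fun v => ?_
  refine (pullback_apply f α p v).trans ((apply_congr α h.eq_of_nhds _).trans ?_)
  rw [h1]
  rfl

theorem pullback_comp {f : P → P'} {g : P' → P''} {p : P}
    (hg : MDifferentiableAt 𝓘(ℝ, E') 𝓘(ℝ, E'') g (f p))
    (hf : MDifferentiableAt 𝓘(ℝ, E) 𝓘(ℝ, E') f p) (α : DForm 𝓘(ℝ, E'') P'' k) :
    pullback 𝓘(ℝ, E) 𝓘(ℝ, E'') (g ∘ f) α p =
      pullback 𝓘(ℝ, E) 𝓘(ℝ, E') f (pullback 𝓘(ℝ, E') 𝓘(ℝ, E'') g α) p := by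
  have h := mfderiv_comp p hg hf
  refine form_ext fun v => ?_
  refine (pullback_apply (g ∘ f) α p v).trans ?_
  rw [h]
  rfl

theorem pullback_id (α : DForm 𝓘(ℝ, E) P k) (p : P) :
    pullback 𝓘(ℝ, E) 𝓘(ℝ, E) id α p = α p := by
  refine form_ext fun v => ?_
  refine (pullback_apply id α p v).trans ?_
  rw [mfderiv_id]
  rfl

theorem inChart_eq (α : DForm 𝓘(ℝ, E) P k) (p : P) :
    inChart 𝓘(ℝ, E) α p = pullback 𝓘(ℝ, E) 𝓘(ℝ, E) (extChartAt 𝓘(ℝ, E) p).symm α := rfl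

variable [IsManifold 𝓘(ℝ, E) ∞ P] [IsManifold 𝓘(ℝ, E') ∞ P']

theorem mdifferentiableAt_extChartAt_symm' {p : P} {w : E}
    (hw : w ∈ (extChartAt 𝓘(ℝ, E) p).target) :
    MDifferentiableAt 𝓘(ℝ, E) 𝓘(ℝ, E) (extChartAt 𝓘(ℝ, E) p).symm w :=
  (((contMDiffOn_extChartAt_symm (I := 𝓘(ℝ, E)) (n := ∞) p) w hw).contMDiffAt
    ((isOpen_extChartAt_target p).mem_nhds hw)).mdifferentiableAt (by simp)

theorem contMDiffAt_extChartAt'' {p q : P} (hq : q ∈ (extChartAt 𝓘(ℝ, E) p).source) :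
    ContMDiffAt 𝓘(ℝ, E) 𝓘(ℝ, E) ∞ (extChartAt 𝓘(ℝ, E) p) q :=
  contMDiffAt_extChartAt' (by rwa [extChartAt_source] at hq)

theorem mdifferentiableAt_extChartAt'' {p q : P} (hq : q ∈ (extChartAt 𝓘(ℝ, E) p).source) :
    MDifferentiableAt 𝓘(ℝ, E) 𝓘(ℝ, E) (extChartAt 𝓘(ℝ, E) p) q :=
  (contMDiffAt_extChartAt'' hq).mdifferentiableAt (by simp)

omit [IsManifold 𝓘(ℝ, E) ∞ P] in
/-- A pullback is computed through any chart of the target manifold. -/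
theorem pullback_eq_pullback_inChart {f : P → P'} {p : P} {p' : P'}
    (hf : MDifferentiableAt 𝓘(ℝ, E) 𝓘(ℝ, E') f p)
    (hp : f p ∈ (extChartAt 𝓘(ℝ, E') p').source) (α : DForm 𝓘(ℝ, E') P' k) :
    pullback 𝓘(ℝ, E) 𝓘(ℝ, E') f α p =
      pullback 𝓘(ℝ, E) 𝓘(ℝ, E') (extChartAt 𝓘(ℝ, E') p' ∘ f) (inChart 𝓘(ℝ, E') α p') p := by
  rw [inChart_eq, ← pullback_comp]
  · refine pullback_congr ?_ α
    filter_upwards [hf.continuousAt.preimage_mem_nhds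
      ((isOpen_extChartAt_source (I := 𝓘(ℝ, E')) p').mem_nhds hp)] with q hq
    exact ((extChartAt 𝓘(ℝ, E') p').left_inv hq).symm
  · exact mdifferentiableAt_extChartAt_symm' ((extChartAt 𝓘(ℝ, E') p').map_source hp)
  · exact (mdifferentiableAt_extChartAt'' hp).comp p hf

/-- A form is recovered from its expression in any chart. -/
theorem eq_pullback_inChart {p p' : P} (hp : p ∈ (extChartAt 𝓘(ℝ, E) p').source)
    (α : DForm 𝓘(ℝ, E) P k) :
    α p = pullback 𝓘(ℝ, E) 𝓘(ℝ, E) (extChartAt 𝓘(ℝ, E) p') (inChart 𝓘(ℝ, E) α p') p := by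
  rw [← pullback_id α p]
  exact pullback_eq_pullback_inChart mdifferentiableAt_id hp α

theorem contDiffAt_chart_comp {f : E → P'} {u : E} {p' : P'}
    (hf : ContMDiffAt 𝓘(ℝ, E) 𝓘(ℝ, E') ∞ f u)
    (hp : f u ∈ (extChartAt 𝓘(ℝ, E') p').source) :
    ContDiffAt ℝ ∞ (extChartAt 𝓘(ℝ, E') p' ∘ f) u :=
  ((contMDiffAt_extChartAt'' hp).comp u hf).contDiffAt

/-- Near `u`, the pullback of a form on `P'` by `f : E → P'` is the pullback of its expression in a
chart by the expression of `f` in this chart. -/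
theorem pullback_eventuallyEq {f : E → P'} {u : E} {p' : P'}
    (hf : ContMDiffAt 𝓘(ℝ, E) 𝓘(ℝ, E') ∞ f u)
    (hp : f u ∈ (extChartAt 𝓘(ℝ, E') p').source) (α : DForm 𝓘(ℝ, E') P' k) :
    onVec (pullback 𝓘(ℝ, E) 𝓘(ℝ, E') f α) =ᶠ[𝓝 u] fun u =>
      (inChart 𝓘(ℝ, E') α p' ((extChartAt 𝓘(ℝ, E') p' ∘ f) u)).compContinuousLinearMap
        (fderiv ℝ (extChartAt 𝓘(ℝ, E') p' ∘ f) u) := by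
  have h1 : ∀ᶠ u' in 𝓝 u, ContMDiffAt 𝓘(ℝ, E) 𝓘(ℝ, E') 1 f u' :=
    contMDiffAt_iff_contMDiffAt_nhds (by simp) |>.1 (hf.of_le (by simp))
  filter_upwards [h1, hf.continuousAt.preimage_mem_nhds
      ((isOpen_extChartAt_source (I := 𝓘(ℝ, E')) p').mem_nhds hp)] with q hq hq'
  refine (pullback_eq_pullback_inChart (hq.mdifferentiableAt (by simp)) hq' α).trans ?_
  rw [← mfderiv_eq_fderiv]
  rfl

omit [IsManifold 𝓘(ℝ, E) ∞ P] in
theorem IsSmooth.contDiffAt {α : DForm 𝓘(ℝ, E) P k} (hα : IsSmooth 𝓘(ℝ, E) α) {p : P} {w : E}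
    (hw : w ∈ (extChartAt 𝓘(ℝ, E) p).target) : ContDiffAt ℝ ∞ (inChart 𝓘(ℝ, E) α p) w :=
  (hα p).contDiffAt ((isOpen_extChartAt_target p).mem_nhds hw)

/-- The pullback of a smooth form by a smooth map on a vector space is smooth. -/
theorem IsSmooth.contDiffAt_pullback [FiniteDimensional ℝ E] {α : DForm 𝓘(ℝ, E') P' k}
    (hα : IsSmooth 𝓘(ℝ, E') α) {f : E → P'} {u : E} (hf : ContMDiffAt 𝓘(ℝ, E) 𝓘(ℝ, E') ∞ f u) :
    ContDiffAt ℝ ∞ (onVec (pullback 𝓘(ℝ, E) 𝓘(ℝ, E') f α)) u := by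
  have hp := mem_extChartAt_source (I := 𝓘(ℝ, E')) (f u)
  refine ContDiffAt.congr_of_eventuallyEq ?_ (pullback_eventuallyEq hf hp α)
  have h1 := contDiffAt_chart_comp hf hp
  refine ContDiffAt.alternating_comp ?_ (h1.fderiv_right (m := ∞) (by simp))
  exact ContDiffAt.comp u (hα.contDiffAt ((extChartAt 𝓘(ℝ, E') (f u)).map_source hp)) h1

theorem IsSmooth.pullback [FiniteDimensional ℝ E] {α : DForm 𝓘(ℝ, E') P' k}
    (hα : IsSmooth 𝓘(ℝ, E') α) {f : P → P'} (hf : ContMDiff 𝓘(ℝ, E) 𝓘(ℝ, E') ∞ f) :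
    IsSmooth 𝓘(ℝ, E) (DForm.pullback 𝓘(ℝ, E) 𝓘(ℝ, E') f α) := by
  intro p w hw
  have h1 : ContMDiffAt 𝓘(ℝ, E) 𝓘(ℝ, E') ∞ (f ∘ (extChartAt 𝓘(ℝ, E) p).symm) w :=
    hf.contMDiffAt.comp w ((contMDiffOn_extChartAt_symm (I := 𝓘(ℝ, E)) (n := ∞) p w hw).contMDiffAt
      ((isOpen_extChartAt_target p).mem_nhds hw))
  have h2 := IsSmooth.contDiffAt_pullback hα h1
  refine (h2.congr_of_eventuallyEq ?_).contDiffWithinAt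
  filter_upwards [(isOpen_extChartAt_target p).mem_nhds hw] with w' hw'
  exact (pullback_comp (hf.mdifferentiable (by simp) _)
    (mdifferentiableAt_extChartAt_symm' hw') α).symm

/-- Naturality of the exterior derivative, for maps on a vector space. -/
theorem extDeriv_pullback_eq {α : DForm 𝓘(ℝ, E') P' k} {f : E → P'} {u : E}
    (hf : ContMDiffAt 𝓘(ℝ, E) 𝓘(ℝ, E') ∞ f u)
    (hα : DifferentiableAt ℝ (inChart 𝓘(ℝ, E') α (f u)) (extChartAt 𝓘(ℝ, E') (f u) (f u))) :
    extDeriv (onVec (DForm.pullback 𝓘(ℝ, E) 𝓘(ℝ, E') f α)) u =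
      DForm.pullback 𝓘(ℝ, E) 𝓘(ℝ, E') f (d 𝓘(ℝ, E') α) u := by
  have hp := mem_extChartAt_source (I := 𝓘(ℝ, E')) (f u)
  have h1 := contDiffAt_chart_comp hf hp
  rw [(pullback_eventuallyEq hf hp α).extDeriv_eq]
  rw [_root_.extDeriv_pullback (f := extChartAt 𝓘(ℝ, E') (f u) ∘ f) (r := ∞) hα h1
    (by rw [minSmoothness_of_isRCLikeNormedField]; exact WithTop.coe_le_coe.2 le_top)]
  have h2 := mfderiv_comp u (mdifferentiableAt_extChartAt'' hp) (hf.mdifferentiableAt (by simp))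
  rw [← mfderiv_eq_fderiv, h2]
  rfl

/-- Naturality of the exterior derivative. -/
theorem d_pullback_eq {α : DForm 𝓘(ℝ, E') P' k} {f : P → P'} {p : P}
    (hf : ContMDiffAt 𝓘(ℝ, E) 𝓘(ℝ, E') ∞ f p)
    (hα : DifferentiableAt ℝ (inChart 𝓘(ℝ, E') α (f p)) (extChartAt 𝓘(ℝ, E') (f p) (f p))) :
    d 𝓘(ℝ, E) (DForm.pullback 𝓘(ℝ, E) 𝓘(ℝ, E') f α) p =
      DForm.pullback 𝓘(ℝ, E) 𝓘(ℝ, E') f (d 𝓘(ℝ, E') α) p := by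
  set e := extChartAt 𝓘(ℝ, E) p with he
  have hp : p ∈ e.source := mem_extChartAt_source (I := 𝓘(ℝ, E)) p
  have hep : e.symm (e p) = p := e.left_inv hp
  have hs : ContMDiffAt 𝓘(ℝ, E) 𝓘(ℝ, E) ∞ e.symm (e p) :=
    (contMDiffOn_extChartAt_symm (I := 𝓘(ℝ, E)) (n := ∞) p _ (e.map_source hp)).contMDiffAt
      ((isOpen_extChartAt_target p).mem_nhds (e.map_source hp))
  have h1 : ContMDiffAt 𝓘(ℝ, E) 𝓘(ℝ, E') ∞ (f ∘ e.symm) (e p) := by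
    refine ContMDiffAt.comp (e p) ?_ hs
    rwa [hep]
  have h2 : (inChart 𝓘(ℝ, E) (DForm.pullback 𝓘(ℝ, E) 𝓘(ℝ, E') f α) p) =ᶠ[𝓝 (e p)]
      onVec (DForm.pullback 𝓘(ℝ, E) 𝓘(ℝ, E') (f ∘ e.symm) α) := by
    have h3 : ∀ᶠ p' in 𝓝 p, ContMDiffAt 𝓘(ℝ, E) 𝓘(ℝ, E') 1 f p' :=
      contMDiffAt_iff_contMDiffAt_nhds (by simp) |>.1 (hf.of_le (by simp))
    have h4 : Filter.Tendsto e.symm (𝓝 (e p)) (𝓝 p) := by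
      have := hs.continuousAt.tendsto
      rwa [hep] at this
    filter_upwards [(isOpen_extChartAt_target p).mem_nhds (e.map_source hp),
      h4.eventually h3] with w hw hw'
    exact (pullback_comp (hw'.mdifferentiableAt (by simp))
      (mdifferentiableAt_extChartAt_symm' hw) α).symm
  -- The derivative of `f^* α` is computed in the chart `e`, where the pullback is by `f ∘ e.symm`.
  have h5 := extDeriv_pullback_eq (α := α) h1 (by simpa only [Function.comp_apply, hep] using hα)
  have h6 : d 𝓘(ℝ, E) (DForm.pullback 𝓘(ℝ, E) 𝓘(ℝ, E') f α) p =
      DForm.pullback 𝓘(ℝ, E) 𝓘(ℝ, E) e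
        (DForm.pullback 𝓘(ℝ, E) 𝓘(ℝ, E') (f ∘ e.symm) (d 𝓘(ℝ, E') α)) p := by
    have h7 := h2.extDeriv_eq.trans h5
    refine form_ext fun v => ?_
    exact congrArg (fun T : E [⋀^Fin (k + 1)]→L[ℝ] ℝ =>
      T fun i => (mfderiv 𝓘(ℝ, E) 𝓘(ℝ, E) e p : E →L[ℝ] E) (v i)) h7
  rw [h6, ← pullback_comp (h1.mdifferentiableAt (by simp)) (mdifferentiableAt_extChartAt'' hp)]
  refine pullback_congr ?_ _
  filter_upwards [(isOpen_extChartAt_source (I := 𝓘(ℝ, E)) p).mem_nhds hp] with q hq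
  exact congrArg f (e.left_inv hq)

omit [IsManifold 𝓘(ℝ, E) ∞ P] in
theorem IsSmooth.differentiableAt {α : DForm 𝓘(ℝ, E) P k} (hα : IsSmooth 𝓘(ℝ, E) α) (p : P) :
    DifferentiableAt ℝ (inChart 𝓘(ℝ, E) α p) (extChartAt 𝓘(ℝ, E) p p) :=
  (hα.contDiffAt (mem_extChartAt_target p)).differentiableAt (by simp)

/-- The exterior derivative may be computed in any chart. -/
theorem extDeriv_inChart {α : DForm 𝓘(ℝ, E) P k} (hα : IsSmooth 𝓘(ℝ, E) α) {p : P} {w : E}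
    (hw : w ∈ (extChartAt 𝓘(ℝ, E) p).target) :
    extDeriv (inChart 𝓘(ℝ, E) α p) w = inChart 𝓘(ℝ, E) (d 𝓘(ℝ, E) α) p w :=
  extDeriv_pullback_eq ((contMDiffOn_extChartAt_symm (I := 𝓘(ℝ, E)) (n := ∞) p w hw).contMDiffAt
      ((isOpen_extChartAt_target p).mem_nhds hw)) (hα.differentiableAt _)

omit [IsManifold 𝓘(ℝ, E) ∞ P] in
theorem d_sub {α β : DForm 𝓘(ℝ, E) P k} (hα : IsSmooth 𝓘(ℝ, E) α) (hβ : IsSmooth 𝓘(ℝ, E) β) :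
    d 𝓘(ℝ, E) (α - β) = d 𝓘(ℝ, E) α - d 𝓘(ℝ, E) β := by
  funext p
  have h : extDeriv (inChart 𝓘(ℝ, E) (α - β) p) (extChartAt 𝓘(ℝ, E) p p) =
      extDeriv (inChart 𝓘(ℝ, E) α p) (extChartAt 𝓘(ℝ, E) p p) -
        extDeriv (inChart 𝓘(ℝ, E) β p) (extChartAt 𝓘(ℝ, E) p p) := by
    have e1 : inChart 𝓘(ℝ, E) (α - β) p = inChart 𝓘(ℝ, E) α p - inChart 𝓘(ℝ, E) β p := rfl
    rw [e1, extDeriv, fderiv_sub (hα.differentiableAt p) (hβ.differentiableAt p)]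
    ext v
    simp [extDeriv, ContinuousAlternatingMap.alternatizeUncurryFin_apply, smul_sub,
      Finset.sum_sub_distrib]
  refine form_ext fun v => ?_
  exact congrArg (fun T : E [⋀^Fin (k + 1)]→L[ℝ] ℝ =>
    T fun i => (mfderiv 𝓘(ℝ, E) 𝓘(ℝ, E) (extChartAt 𝓘(ℝ, E) p) p : E →L[ℝ] E) (v i)) h

end DForm

/-! ### The measure of a volume form in charts -/

theorem ContinuousAlternatingMap.apply_comp_stdFrame {k : ℕ} (f : Eu k [⋀^Fin k]→L[ℝ] ℝ)
    (A : Eu k →L[ℝ] Eu k) : (f fun i => A (stdFrame k i)) = A.det * f (stdFrame k) := by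
  have hb : ⇑(EuclideanSpace.basisFun (Fin k) ℝ).toBasis = stdFrame k := by
    funext i
    simp [stdFrame]
  have h := AlternatingMap.eq_smul_basis_det (EuclideanSpace.basisFun (Fin k) ℝ).toBasis
    f.toAlternatingMap
  have h1 : ∀ v, f v = f (stdFrame k) * (EuclideanSpace.basisFun (Fin k) ℝ).toBasis.det v := by
    intro v
    have := congrArg (fun T => T v) h
    rw [hb] at this
    exact this
  rw [h1, mul_comm]
  congr 1
  have h2 := Module.Basis.det_comp (EuclideanSpace.basisFun (Fin k) ℝ).toBasis A.toLinearMap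
    (stdFrame k)
  refine Eq.trans h2 ?_
  rw [← hb, Module.Basis.det_self, mul_one]

theorem ContinuousAlternatingMap.eq_zero_of_stdFrame {k : ℕ} {f : Eu k [⋀^Fin k]→L[ℝ] ℝ}
    (h : f (stdFrame k) = 0) : f = 0 := by
  have hb : ⇑(EuclideanSpace.basisFun (Fin k) ℝ).toBasis = stdFrame k := by
    funext i
    simp [stdFrame]
  ext v
  refine (congrArg (fun T => T v) (AlternatingMap.eq_smul_basis_det
      (EuclideanSpace.basisFun (Fin k) ℝ).toBasis f.toAlternatingMap)).trans ?_
  rw [hb]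
  change f (stdFrame k) * _ = 0
  rw [h, zero_mul]

theorem OpenPartialHomeomorph.measurableSet_image {X H : Type*} [TopologicalSpace X]
    [MeasurableSpace X] [BorelSpace X] [TopologicalSpace H] [MeasurableSpace H] [BorelSpace H]
    (e : OpenPartialHomeomorph X H) {A : Set X} (hA : MeasurableSet A) (hAe : A ⊆ e.source) :
    MeasurableSet (e '' A) := by
  have h1 : Measurable fun u : e.target => e.symm u :=
    (continuousOn_iff_continuous_domRestrict.1 e.continuousOn_symm).measurable
  have h2 := MeasurableSet.subtype_image e.open_target.measurableSet (h1 hA)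
  convert h2 using 1
  ext u
  constructor
  · rintro ⟨x, hx, rfl⟩
    refine ⟨⟨e x, e.map_source (hAe hx)⟩, ?_, rfl⟩
    simpa [e.left_inv (hAe hx)] using hx
  · rintro ⟨⟨u, hu⟩, hx, rfl⟩
    exact ⟨e.symm u, hx, e.right_inv hu⟩

namespace DForm

variable {k : ℕ} {X : Type*} [TopologicalSpace X] [ChartedSpace (Eu k) X]

/-- The coefficient `α(∂₁, …, ∂ₖ)` of a top-degree form in the preferred chart around `x`. -/
def coeff (α : DForm (𝓡 k) X k) (x : X) (u : Eu k) : ℝ := inChart (𝓡 k) α x u (stdFrame k)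

theorem contDiffAt_coeff {α : DForm (𝓡 k) X k} (hα : IsSmooth (𝓡 k) α) {x : X} {u : Eu k}
    (hu : u ∈ (chartAt (Eu k) x).target) : ContDiffAt ℝ ∞ (coeff α x) u :=
  contDiffAt_alternating_iff.1 (hα.contDiffAt (by simpa using hu)) _

theorem continuousOn_coeff {α : DForm (𝓡 k) X k} (hα : IsSmooth (𝓡 k) α) (x : X) :
    ContinuousOn (coeff α x) (chartAt (Eu k) x).target :=
  fun _ hu => (contDiffAt_coeff hα hu).continuousAt.continuousWithinAt

variable [IsManifold (𝓡 k) ∞ X]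

/-- The value of a form on `stdFrame` at `x`, which refers to the preferred chart at `x`, in terms
of its coefficient in the preferred chart around another point `x₀`. -/
theorem coeff_eq_apply (α : DForm (𝓡 k) X k) {x₀ x : X}
    (hx : x ∈ (chartAt (Eu k) x₀).source) :
    (α x : Eu k [⋀^Fin k]→L[ℝ] ℝ) (stdFrame k) =
      (mfderiv (𝓡 k) (𝓡 k) (chartAt (Eu k) x₀) x : Eu k →L[ℝ] Eu k).det *
        coeff α x₀ (chartAt (Eu k) x₀ x) := by
  have hx' : x ∈ (extChartAt (𝓡 k) x₀).source := by rwa [extChartAt_source]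
  have h := congrArg (fun T : Eu k [⋀^Fin k]→L[ℝ] ℝ => T (stdFrame k)) (eq_pullback_inChart hx' α)
  exact h.trans (ContinuousAlternatingMap.apply_comp_stdFrame
    (inChart (𝓡 k) α x₀ (chartAt (Eu k) x₀ x))
    (mfderiv (𝓡 k) (𝓡 k) (chartAt (Eu k) x₀) x : Eu k →L[ℝ] Eu k))

/-- The function `a` with `α = a η` is computed in any chart. -/
theorem ratio_eq (η : VolForm k X) (α : DForm (𝓡 k) X k) {x₀ x : X}
    (hx : x ∈ (chartAt (Eu k) x₀).source) :
    ratio η α x = coeff α x₀ (chartAt (Eu k) x₀ x) / coeff η.form x₀ (chartAt (Eu k) x₀ x) := by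
  have h1 := coeff_eq_apply α hx
  have h2 := coeff_eq_apply η.form hx
  have h3 : (η.form x : Eu k [⋀^Fin k]→L[ℝ] ℝ) (stdFrame k) ≠ 0 := fun h =>
    η.ne_zero x (ContinuousAlternatingMap.eq_zero_of_stdFrame h)
  rw [h2] at h3
  have h4 : ratio η α x = (α x : Eu k [⋀^Fin k]→L[ℝ] ℝ) (stdFrame k) /
    (η.form x : Eu k [⋀^Fin k]→L[ℝ] ℝ) (stdFrame k) := rfl
  rw [h4, h1, h2, mul_div_mul_left _ _ (left_ne_zero_of_mul h3)]

theorem coeff_volForm_ne_zero (η : VolForm k X) {x₀ : X} {u : Eu k}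
    (hu : u ∈ (chartAt (Eu k) x₀).target) : coeff η.form x₀ u ≠ 0 := by
  have hx := (chartAt (Eu k) x₀).map_target hu
  have h2 := coeff_eq_apply η.form hx
  have h3 : (η.form _ : Eu k [⋀^Fin k]→L[ℝ] ℝ) (stdFrame k) ≠ 0 := fun h =>
    η.ne_zero ((chartAt (Eu k) x₀).symm u) (ContinuousAlternatingMap.eq_zero_of_stdFrame h)
  rw [h2, (chartAt (Eu k) x₀).right_inv hu] at h3
  exact right_ne_zero_of_mul h3

/-- The transformation law of the coefficient of a top-degree form under a change of charts. -/
theorem coeff_change (α : DForm (𝓡 k) X k) {x₀ x₁ : X} {u : Eu k}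
    (hu : u ∈ (chartAt (Eu k) x₀).target)
    (hu' : (chartAt (Eu k) x₀).symm u ∈ (chartAt (Eu k) x₁).source) :
    DifferentiableAt ℝ (fun u => chartAt (Eu k) x₁ ((chartAt (Eu k) x₀).symm u)) u ∧
    coeff α x₀ u =
      (fderiv ℝ (fun u => chartAt (Eu k) x₁ ((chartAt (Eu k) x₀).symm u)) u).det *
        coeff α x₁ (chartAt (Eu k) x₁ ((chartAt (Eu k) x₀).symm u)) := by
  have hu1 : u ∈ (extChartAt (𝓡 k) x₀).target := by simpa using hu
  have hu2 : (extChartAt (𝓡 k) x₀).symm u ∈ (extChartAt (𝓡 k) x₁).source := by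
    rw [extChartAt_source]; exact hu'
  have h0 := mdifferentiableAt_extChartAt_symm' hu1
  constructor
  · exact ((mdifferentiableAt_extChartAt'' hu2).comp u h0).differentiableAt
  · have h := congrArg (fun T : Eu k [⋀^Fin k]→L[ℝ] ℝ => T (stdFrame k))
      (pullback_eq_pullback_inChart h0 hu2 α)
    rw [← mfderiv_eq_fderiv]
    exact h.trans (ContinuousAlternatingMap.apply_comp_stdFrame
      (inChart (𝓡 k) α x₁ (chartAt (Eu k) x₁ ((chartAt (Eu k) x₀).symm u)))
      (mfderiv (𝓡 k) (𝓡 k) (fun u => chartAt (Eu k) x₁ ((chartAt (Eu k) x₀).symm u)) u :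
        Eu k →L[ℝ] Eu k))

variable [SigmaCompactSpace X] [MeasurableSpace X] [BorelSpace X]

omit [IsManifold (𝓡 k) ∞ X] in
theorem measurableSet_chartPiece [Nonempty X] (j : ℕ) : MeasurableSet (chartPiece k X j) :=
  MeasurableSet.disjointed (fun j => (chartAt (Eu k) (chartSeq k X j)).open_source.measurableSet) j

omit [IsManifold (𝓡 k) ∞ X] [MeasurableSpace X] [BorelSpace X] in
theorem chartPiece_subset [Nonempty X] (j : ℕ) :
    chartPiece k X j ⊆ (chartAt (Eu k) (chartSeq k X j)).source := disjointed_subset _ j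

omit [IsManifold (𝓡 k) ∞ X] [MeasurableSpace X] [BorelSpace X] in
theorem iUnion_chartPiece [Nonempty X] : ⋃ j, chartPiece k X j = univ := by
  rw [chartPiece, iUnion_disjointed]
  exact (exists_seq_chart_cover k X).choose_spec

/-- In every chart, the measure of a form is the Lebesgue measure weighted by the absolute value
of its coefficient: the pieces of the partition in the definition of the measure are moved to the
chart around `x₀` by the change of variables formula. -/
theorem measure_apply (η : DForm (𝓡 k) X k) (x₀ : X) {s : Set X} (hs : MeasurableSet s)
    (hsx : s ⊆ (chartAt (Eu k) x₀).source) :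
    DForm.measure η s = ∫⁻ u in chartAt (Eu k) x₀ '' s, ENNReal.ofReal |coeff η x₀ u| := by
  classical
  have : Nonempty X := ⟨x₀⟩
  set c := chartAt (Eu k) x₀ with hc
  rw [DForm.measure, dif_pos this, Measure.sum_apply _ hs]
  have key : ∀ j : ℕ, Measure.map (chartAt (Eu k) (chartSeq k X j)).symm
        ((volume.restrict ((chartAt (Eu k) (chartSeq k X j)) '' chartPiece k X j)).withDensity
          fun w => ENNReal.ofReal |DForm.inChart (𝓡 k) η (chartSeq k X j) w (stdFrame k)|) s =
      ∫⁻ u in c '' (s ∩ chartPiece k X j), ENNReal.ofReal |coeff η x₀ u| := by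
    intro j
    set cj := chartAt (Eu k) (chartSeq k X j) with hcj
    have hpj : chartPiece k X j ⊆ cj.source := chartPiece_subset j
    have hA := (measurableSet_chartPiece (k := k) (X := X) j)
    have hAj := cj.measurableSet_image hA hpj
    have hsA := cj.measurableSet_image (hs.inter hA) (inter_subset_right.trans hpj)
    have hsub : cj '' chartPiece k X j ⊆ cj.target := by
      rintro _ ⟨x, hx, rfl⟩; exact cj.map_source (hpj hx)
    have hae : AEMeasurable cj.symm
        ((volume.restrict (cj '' chartPiece k X j)).withDensity
          fun w => ENNReal.ofReal |DForm.inChart (𝓡 k) η (chartSeq k X j) w (stdFrame k)|) :=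
      ((cj.continuousOn_symm.mono hsub).aemeasurable hAj).mono_ac
        (withDensity_absolutelyContinuous _ _)
    have hset : ∀ u ∈ cj '' chartPiece k X j,
        (u ∈ cj.symm ⁻¹' s ↔ u ∈ cj '' (s ∩ chartPiece k X j)) := by
      rintro _ ⟨x, hx, rfl⟩
      rw [mem_preimage, cj.left_inv (hpj hx)]
      constructor
      · intro h; exact ⟨x, ⟨h, hx⟩, rfl⟩
      · rintro ⟨y, ⟨hy, hy'⟩, e⟩
        rwa [← cj.injOn (hpj hy') (hpj hx) e]
    rw [Measure.map_apply_of_aemeasurable hae hs]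
    have e1 : ((volume.restrict (cj '' chartPiece k X j)).withDensity
          fun w => ENNReal.ofReal |DForm.inChart (𝓡 k) η (chartSeq k X j) w (stdFrame k)|)
            (cj.symm ⁻¹' s) =
        ((volume.restrict (cj '' chartPiece k X j)).withDensity
          fun w => ENNReal.ofReal |DForm.inChart (𝓡 k) η (chartSeq k X j) w (stdFrame k)|)
            (cj '' (s ∩ chartPiece k X j)) := by
      apply measure_congr
      have : ∀ᵐ u ∂((volume.restrict (cj '' chartPiece k X j)).withDensity
          fun w => ENNReal.ofReal |DForm.inChart (𝓡 k) η (chartSeq k X j) w (stdFrame k)|),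
          u ∈ cj '' chartPiece k X j :=
        (withDensity_absolutelyContinuous _ _).ae_le (ae_restrict_mem hAj)
      filter_upwards [this] with u hu
      exact propext (hset u hu)
    rw [e1, withDensity_apply _ hsA, Measure.restrict_restrict hsA,
      inter_eq_left.2 (image_mono inter_subset_right)]
    have e2 : c '' (s ∩ chartPiece k X j) =
        (fun u => c (cj.symm u)) '' (cj '' (s ∩ chartPiece k X j)) := by
      rw [image_image]
      refine image_congr fun x hx => ?_
      rw [cj.left_inv (hpj hx.2)]
    have hmem : ∀ u ∈ cj '' (s ∩ chartPiece k X j), u ∈ cj.target ∧ cj.symm u ∈ c.source := by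
      rintro _ ⟨x, hx, rfl⟩
      rw [cj.left_inv (hpj hx.2)]
      exact ⟨cj.map_source (hpj hx.2), hsx hx.1⟩
    -- Under the change of charts, the coefficient is multiplied by the Jacobian determinant.
    rw [e2, lintegral_image_eq_lintegral_abs_det_fderiv_mul volume hsA
      (f' := fun u => fderiv ℝ (fun u => c (cj.symm u)) u)]
    · refine setLIntegral_congr_fun hsA fun u hu => ?_
      have h := (coeff_change η (hmem u hu).1 (hmem u hu).2).2
      change ENNReal.ofReal |coeff η (chartSeq k X j) u| = _
      rw [h, abs_mul, ENNReal.ofReal_mul (abs_nonneg _)]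
    · intro u hu
      exact (coeff_change η (hmem u hu).1 (hmem u hu).2).1.hasFDerivAt.hasFDerivWithinAt
    · intro u hu v hv e
      have := c.injOn (hmem u hu).2 (hmem v hv).2 e
      exact cj.symm.injOn (hmem u hu).1 (hmem v hv).1 this
  simp_rw [key]
  rw [← lintegral_iUnion]
  · rw [← image_iUnion, ← inter_iUnion, iUnion_chartPiece, inter_univ]
  · intro j
    exact c.measurableSet_image (hs.inter (measurableSet_chartPiece j))
      (inter_subset_left.trans hsx)
  · intro i j hij
    have hd : Disjoint (chartPiece k X i) (chartPiece k X j) := disjoint_disjointed _ hij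
    refine disjoint_left.2 ?_
    rintro _ ⟨x, hx, rfl⟩ ⟨y, hy, e⟩
    have := c.injOn (hsx hy.1) (hsx hx.1) e
    subst this
    exact disjoint_left.1 hd hx.2 hy.2

/-- `measure_apply` as an equality of measures. -/
theorem restrict_measure_eq (η : DForm (𝓡 k) X k) (x₀ : X) :
    (DForm.measure η).restrict (chartAt (Eu k) x₀).source =
      Measure.map (chartAt (Eu k) x₀).symm
        ((volume.restrict (chartAt (Eu k) x₀).target).withDensity
          fun u => ENNReal.ofReal |coeff η x₀ u|) ∧
      AEMeasurable (chartAt (Eu k) x₀).symm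
        ((volume.restrict (chartAt (Eu k) x₀).target).withDensity
          fun u => ENNReal.ofReal |coeff η x₀ u|) := by
  set c := chartAt (Eu k) x₀ with hc
  have hae : AEMeasurable c.symm ((volume.restrict c.target).withDensity
      fun u => ENNReal.ofReal |coeff η x₀ u|) :=
    (c.continuousOn_symm.aemeasurable c.open_target.measurableSet).mono_ac
      (withDensity_absolutelyContinuous _ _)
  refine ⟨Measure.ext fun s hs => ?_, hae⟩
  have hs' := hs.inter c.open_source.measurableSet
  rw [Measure.restrict_apply hs, Measure.map_apply_of_aemeasurable hae hs,
    measure_apply η x₀ hs' inter_subset_right]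
  have hsA := c.measurableSet_image hs' inter_subset_right
  have e1 : ((volume.restrict c.target).withDensity fun u => ENNReal.ofReal |coeff η x₀ u|)
      (c.symm ⁻¹' s) = ((volume.restrict c.target).withDensity
        fun u => ENNReal.ofReal |coeff η x₀ u|) (c '' (s ∩ c.source)) := by
    apply measure_congr
    have : ∀ᵐ u ∂((volume.restrict c.target).withDensity
        fun u => ENNReal.ofReal |coeff η x₀ u|), u ∈ c.target :=
      (withDensity_absolutelyContinuous _ _).ae_le (ae_restrict_mem c.open_target.measurableSet)
    filter_upwards [this] with u hu
    refine propext ⟨fun h => ⟨c.symm u, ⟨h, c.map_target hu⟩, c.right_inv hu⟩, ?_⟩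
    rintro ⟨x, hx, rfl⟩
    change c.symm (c x) ∈ s
    rw [c.left_inv hx.2]
    exact hx.1
  rw [e1, withDensity_apply _ hsA, Measure.restrict_restrict hsA]
  have h3 : c '' (s ∩ c.source) ⊆ c.target := by
    rintro _ ⟨x, hx, rfl⟩
    exact c.map_source hx.2
  rw [inter_eq_left.2 h3]

/-- The integral of a function supported in a chart domain. -/
theorem integral_measure_eq {η : DForm (𝓡 k) X k} (hη : IsSmooth (𝓡 k) η) (x₀ : X) {g : X → ℝ}
    (hg : Continuous g) (hg0 : ∀ x, x ∉ (chartAt (Eu k) x₀).source → g x = 0) :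
    ∫ x, g x ∂(DForm.measure η) = ∫ u in (chartAt (Eu k) x₀).target,
      |coeff η x₀ u| * g ((chartAt (Eu k) x₀).symm u) := by
  obtain ⟨h1, h2⟩ := restrict_measure_eq η x₀
  rw [← setIntegral_eq_integral_of_forall_compl_eq_zero hg0, h1,
    integral_map h2 hg.aestronglyMeasurable,
    integral_withDensity_eq_integral_toReal_smul₀]
  · refine integral_congr_ae (Filter.Eventually.of_forall fun u => ?_)
    simp
  · exact ((continuousOn_coeff hη x₀).abs.aemeasurable
      (chartAt (Eu k) x₀).open_target.measurableSet).ennreal_ofReal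
  · exact Filter.Eventually.of_forall fun u => ENNReal.ofReal_lt_top

theorem isLocallyFiniteMeasure_measure {η : DForm (𝓡 k) X k} (hη : IsSmooth (𝓡 k) η) :
    IsLocallyFiniteMeasure (DForm.measure η) := by
  refine ⟨fun x₀ => ?_⟩
  set c := chartAt (Eu k) x₀ with hc
  have hx : x₀ ∈ c.source := mem_chart_source _ _
  obtain ⟨K, hK, hKx, hKt⟩ := exists_compact_subset c.open_target (c.map_source hx)
  have hO : IsOpen (c.source ∩ c ⁻¹' _root_.interior K) :=
    c.isOpen_inter_preimage _root_.isOpen_interior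
  refine ⟨c.source ∩ c ⁻¹' _root_.interior K, hO.mem_nhds ⟨hx, hKx⟩, ?_⟩
  rw [measure_apply η x₀ hO.measurableSet inter_subset_left]
  have hsub : c '' (c.source ∩ c ⁻¹' _root_.interior K) ⊆ K := by
    rintro _ ⟨x, hx, rfl⟩; exact _root_.interior_subset hx.2
  refine (lintegral_mono_set hsub).trans_lt ?_
  have hi : IntegrableOn (coeff η x₀) K :=
    ((continuousOn_coeff hη x₀).mono hKt).integrableOn_compact hK
  have := hi.2
  simpa [HasFiniteIntegral, ← ofReal_norm] using this

theorem isOpenPosMeasure_measure (η : VolForm k X) :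
    (DForm.measure η.form).IsOpenPosMeasure := by
  refine ⟨fun O hO hne h0 => ?_⟩
  obtain ⟨x₀, hx₀⟩ := hne
  set c := chartAt (Eu k) x₀ with hc
  have hO' : IsOpen (O ∩ c.source) := hO.inter c.open_source
  have h1 := measure_mono_null inter_subset_left h0 (s := O ∩ c.source)
  rw [measure_apply η.form x₀ hO'.measurableSet inter_subset_right] at h1
  have hsub : c '' (O ∩ c.source) ⊆ c.target := by
    rintro _ ⟨x, hx, rfl⟩; exact c.map_source hx.2
  have hopen : IsOpen (c '' (O ∩ c.source)) :=
    c.isOpen_image_of_subset_source hO' inter_subset_right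
  rw [lintegral_eq_zero_iff' ((((continuousOn_coeff η.isSmooth x₀).mono hsub).abs.aemeasurable
    hopen.measurableSet).ennreal_ofReal)] at h1
  have h2 : ∀ᵐ u ∂(volume.restrict (c '' (O ∩ c.source))), False := by
    filter_upwards [h1, ae_restrict_mem hopen.measurableSet] with u hu hu'
    have := coeff_volForm_ne_zero η (hsub hu')
    simp at hu
    exact this hu
  have h3 : volume (c '' (O ∩ c.source)) = 0 := by
    simpa [Filter.eventually_false_iff_eq_bot] using h2
  exact (hopen.measure_pos volume ⟨c x₀, x₀, ⟨hx₀, mem_chart_source _ _⟩, rfl⟩).ne' h3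

end DForm

/-! ### The Stokes theorem for compactly supported forms -/

/-- The integral of a directional derivative of a compactly supported function vanishes: integrate
by parts against the constant function `1`. -/
theorem integral_fderiv_eq_zero_of_hasCompactSupport {k : ℕ} {h : Eu k → ℝ} (hh : ContDiff ℝ ∞ h)
    (hc : HasCompactSupport h) (v : Eu k) :
    Integrable (fun u => fderiv ℝ h u v) ∧ ∫ u, fderiv ℝ h u v = 0 := by
  have h1 : Continuous fun u => fderiv ℝ h u v :=
    (hh.continuous_fderiv (by simp)).clm_apply continuous_const
  have h2 : HasCompactSupport fun u => fderiv ℝ h u v := hc.fderiv_apply ℝ v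
  have h3 := h1.integrable_of_hasCompactSupport h2 (μ := volume)
  have h4 := integral_mul_fderiv_eq_neg_fderiv_mul_of_integrable (μ := volume)
    (f := fun _ : Eu k => (1 : ℝ)) (g := h) (v := v) (by simp) (by simpa using h3)
    (by simpa using hh.continuous.integrable_of_hasCompactSupport hc)
    (fun x _ => by fun_prop) (fun x _ => hh.differentiable (by simp) x)
  refine ⟨h3, ?_⟩
  simpa using h4

namespace DForm

section Smooth

variable {E : Type*} [NormedAddCommGroup E] [NormedSpace ℝ E]
  {P : Type*} [TopologicalSpace P] [ChartedSpace E P] {k : ℕ}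

theorem d_add {α β : DForm 𝓘(ℝ, E) P k} (hα : IsSmooth 𝓘(ℝ, E) α) (hβ : IsSmooth 𝓘(ℝ, E) β) :
    d 𝓘(ℝ, E) (α + β) = d 𝓘(ℝ, E) α + d 𝓘(ℝ, E) β := by
  funext p
  have h : extDeriv (inChart 𝓘(ℝ, E) (α + β) p) (extChartAt 𝓘(ℝ, E) p p) =
      extDeriv (inChart 𝓘(ℝ, E) α p) (extChartAt 𝓘(ℝ, E) p p) +
        extDeriv (inChart 𝓘(ℝ, E) β p) (extChartAt 𝓘(ℝ, E) p p) :=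
    extDeriv_add (hα.differentiableAt p) (hβ.differentiableAt p)
  refine form_ext fun v => ?_
  exact congrArg (fun T : E [⋀^Fin (k + 1)]→L[ℝ] ℝ =>
    T fun i => (mfderiv 𝓘(ℝ, E) 𝓘(ℝ, E) (extChartAt 𝓘(ℝ, E) p) p : E →L[ℝ] E) (v i)) h

theorem d_zero : d 𝓘(ℝ, E) (0 : DForm 𝓘(ℝ, E) P k) = 0 := by
  have h0 : IsSmooth 𝓘(ℝ, E) (0 : DForm 𝓘(ℝ, E) P k) := fun p => contDiffOn_const (c := 0)
  have h := d_add h0 h0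
  rw [add_zero] at h
  simpa using h

theorem IsSmooth.add {α β : DForm 𝓘(ℝ, E) P k} (hα : IsSmooth 𝓘(ℝ, E) α)
    (hβ : IsSmooth 𝓘(ℝ, E) β) : IsSmooth 𝓘(ℝ, E) (α + β) :=
  fun p => (hα p).add (hβ p)

theorem IsSmooth.sub {α β : DForm 𝓘(ℝ, E) P k} (hα : IsSmooth 𝓘(ℝ, E) α)
    (hβ : IsSmooth 𝓘(ℝ, E) β) : IsSmooth 𝓘(ℝ, E) (α - β) :=
  fun p => (hα p).sub (hβ p)

variable [IsManifold 𝓘(ℝ, E) ∞ P]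

theorem IsSmooth.smul {α : DForm 𝓘(ℝ, E) P k} (hα : IsSmooth 𝓘(ℝ, E) α) {f : P → ℝ}
    (hf : ContMDiff 𝓘(ℝ, E) 𝓘(ℝ, ℝ) ∞ f) :
    IsSmooth 𝓘(ℝ, E) (fun p => f p • α p : DForm 𝓘(ℝ, E) P k) := fun p => by
  have h1 : ContDiffOn ℝ ∞ (f ∘ (extChartAt 𝓘(ℝ, E) p).symm) (extChartAt 𝓘(ℝ, E) p).target :=
    contMDiffOn_iff_contDiffOn.1 (hf.comp_contMDiffOn (contMDiffOn_extChartAt_symm p))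
  exact h1.smul (hα p)

theorem IsSmooth.d {α : DForm 𝓘(ℝ, E) P k} (hα : IsSmooth 𝓘(ℝ, E) α) :
    IsSmooth 𝓘(ℝ, E) (DForm.d 𝓘(ℝ, E) α) := by
  intro p
  have h1 : ContDiffOn ℝ ∞ (extDeriv (inChart 𝓘(ℝ, E) α p)) (extChartAt 𝓘(ℝ, E) p).target := by
    have h2 := (hα p).fderiv_of_isOpen (isOpen_extChartAt_target p) (m := ∞) (by simp)
    exact (ContinuousLinearMap.contDiff (𝕜 := ℝ)
      (ContinuousAlternatingMap.alternatizeUncurryFinCLM ℝ E ℝ)).comp_contDiffOn h2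
  exact h1.congr fun w hw => (extDeriv_inChart hα hw).symm

end Smooth

section Stokes

variable {k n : ℕ} {X : Type*} [TopologicalSpace X]

theorem continuous_ratio [ChartedSpace (Eu k) X] [IsManifold (𝓡 k) ∞ X] (η : VolForm k X)
    {α : DForm (𝓡 k) X k} (hα : IsSmooth (𝓡 k) α) : Continuous (ratio η α) := by
  refine continuous_iff_continuousAt.2 fun x₀ => ?_
  set c := chartAt (Eu k) x₀ with hc
  have hx : x₀ ∈ c.source := mem_chart_source _ _
  have h1 : ContinuousAt (fun x => coeff α x₀ (c x) / coeff η.form x₀ (c x)) x₀ := by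
    have hcx := c.continuousAt hx
    have ht := c.map_source hx
    exact (ContinuousAt.comp (f := c) (contDiffAt_coeff hα ht).continuousAt hcx).div
      (ContinuousAt.comp (f := c) (contDiffAt_coeff η.isSmooth ht).continuousAt hcx)
      (coeff_volForm_ne_zero η ht)
  refine h1.congr ?_
  filter_upwards [c.open_source.mem_nhds hx] with x hx'
  exact (ratio_eq η α hx').symm

variable [ChartedSpace (Eu (n + 1)) X]

/-- The exterior derivative does not enlarge the support. -/
theorem d_apply_eq_zero {σ : DForm (𝓡 (n + 1)) X n} {K : Set X} (hK : IsClosed K)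
    (hσ : ∀ x, x ∉ K → σ x = 0) {x : X} (hx : x ∉ K) : d (𝓡 (n + 1)) σ x = 0 := by
  set e := extChartAt (𝓡 (n + 1)) x with he
  have h1 : inChart (𝓡 (n + 1)) σ x =ᶠ[𝓝 (e x)] fun _ => 0 := by
    have h2 : Filter.Tendsto e.symm (𝓝 (e x)) (𝓝 x) := by
      have := (continuousAt_extChartAt_symm (I := 𝓡 (n + 1)) x).tendsto
      rwa [extChartAt_to_inv] at this
    filter_upwards [h2.eventually (hK.isOpen_compl.mem_nhds hx)] with w hw
    change (σ (e.symm w)).compContinuousLinearMap _ = 0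
    rw [hσ _ hw]
    rfl
  have h3 : extDeriv (inChart (𝓡 (n + 1)) σ x) (e x) = 0 := by
    rw [h1.extDeriv_eq, extDeriv, fderiv_const_apply]
    ext v
    simp [ContinuousAlternatingMap.alternatizeUncurryFin_apply]
  refine form_ext fun v => ?_
  exact congrArg (fun T : Eu (n + 1) [⋀^Fin (n + 1)]→L[ℝ] ℝ =>
    T fun i => (mfderiv (𝓡 (n + 1)) (𝓡 (n + 1)) e x : Eu (n + 1) →L[ℝ] Eu (n + 1)) (v i)) h3

variable [IsManifold (𝓡 (n + 1)) ∞ X]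

/-- In a chart, `dσ` for an `n`-form `σ` on an `(n+1)`-manifold is a divergence. -/
theorem coeff_d {σ : DForm (𝓡 (n + 1)) X n} (hσ : IsSmooth (𝓡 (n + 1)) σ) {x₀ : X}
    {u : Eu (n + 1)} (hu : u ∈ (chartAt (Eu (n + 1)) x₀).target) :
    coeff (d (𝓡 (n + 1)) σ) x₀ u = ∑ i : Fin (n + 1), (-1) ^ i.val •
      fderiv ℝ (fun w => inChart (𝓡 (n + 1)) σ x₀ w (i.removeNth (stdFrame (n + 1)))) u
        (stdFrame (n + 1) i) := by
  have hu' : u ∈ (extChartAt (𝓡 (n + 1)) x₀).target := by simpa using hu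
  rw [coeff, ← extDeriv_inChart hσ hu',
    extDeriv_apply ((hσ.contDiffAt hu').differentiableAt (by simp))]

variable [T2Space X] [SigmaCompactSpace X] [MeasurableSpace X] [BorelSpace X]

/-- The Stokes theorem for forms supported in a chart domain. -/
theorem integral_ratio_d_eq_zero_of_chart (η : VolForm (n + 1) X) {σ : DForm (𝓡 (n + 1)) X n}
    (hσ : IsSmooth (𝓡 (n + 1)) σ) {K : Set X} (hK : IsCompact K) (hσK : ∀ x, x ∉ K → σ x = 0)
    {x₀ : X} (hKx : K ⊆ (chartAt (Eu (n + 1)) x₀).source) :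
    ∫ x, ratio η (d (𝓡 (n + 1)) σ) x ∂(DForm.measure η.form) = 0 := by
  classical
  set c := chartAt (Eu (n + 1)) x₀ with hc
  have hct : (extChartAt (𝓡 (n + 1)) x₀).target = c.target := by simp [hc]
  have h0 : ∀ x, x ∉ K → ratio η (d (𝓡 (n + 1)) σ) x = 0 := fun x hx => by
    have := d_apply_eq_zero hK.isClosed hσK hx
    rw [ratio, this]
    exact zero_div _
  rw [integral_measure_eq η.isSmooth x₀ (continuous_ratio η hσ.d) fun x hx => h0 x fun h =>
    hx (hKx h)]
  -- The integrand is `s * coeff (dσ)`, where `s` is the sign of the coefficient of `η`. As `s` is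
  -- locally constant, it may be moved inside the derivatives.
  set s : Eu (n + 1) → ℝ := fun u => |coeff η.form x₀ u| / coeff η.form x₀ u with hs
  have hsc : ∀ u ∈ c.target, s =ᶠ[𝓝 u] fun _ => s u := by
    intro u hu
    have h1 := (contDiffAt_coeff η.isSmooth hu).continuousAt
    rcases lt_or_gt_of_ne (coeff_volForm_ne_zero η hu) with h | h
    · filter_upwards [h1.eventually (gt_mem_nhds h)] with w hw
      simp only [hs]
      rw [abs_of_neg hw, abs_of_neg h, neg_div, neg_div, div_self hw.ne, div_self h.ne]
    · filter_upwards [h1.eventually (lt_mem_nhds h)] with w hw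
      simp only [hs]
      rw [abs_of_pos hw, abs_of_pos h, div_self hw.ne', div_self h.ne']
  set g : Fin (n + 1) → Eu (n + 1) → ℝ := fun i u => c.target.indicator (fun w =>
    s w * inChart (𝓡 (n + 1)) σ x₀ w (i.removeNth (stdFrame (n + 1)))) u with hg
  have hKc : IsCompact (c '' K) := hK.image_of_continuousOn (c.continuousOn.mono hKx)
  have hgK : ∀ i u, u ∉ c '' K → g i u = 0 := by
    intro i u hu
    by_cases hut : u ∈ c.target
    · have h2 : c.symm u ∉ K := fun h => hu ⟨_, h, c.right_inv hut⟩
      have h3 : inChart (𝓡 (n + 1)) σ x₀ u = 0 := by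
        change (σ (c.symm u)).compContinuousLinearMap _ = 0
        rw [hσK _ h2]
        rfl
      simp only [hg, indicator_of_mem hut, h3]
      exact mul_zero _
    · exact indicator_of_notMem hut _
  have hgt : ∀ i u, u ∈ c.target → g i =ᶠ[𝓝 u] fun w =>
      s u * inChart (𝓡 (n + 1)) σ x₀ w (i.removeNth (stdFrame (n + 1))) := by
    intro i u hu
    filter_upwards [hsc u hu, c.open_target.mem_nhds hu] with w hw hw'
    simp only [hg, indicator_of_mem hw', hw]
  have hgd : ∀ i, ContDiff ℝ ∞ (g i) := by
    intro i
    refine contDiff_iff_contDiffAt.2 fun u => ?_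
    by_cases hu : u ∈ c.target
    · refine ContDiffAt.congr_of_eventuallyEq ?_ (hgt i u hu)
      exact contDiffAt_const.mul (contDiffAt_alternating_iff.1
        (hσ.contDiffAt (by rwa [hct])) _)
    · have hu' : u ∉ c '' K := by
        rintro ⟨x, hx, rfl⟩
        exact hu (c.map_source (hKx hx))
      refine ContDiffAt.congr_of_eventuallyEq (contDiffAt_const (c := 0)) ?_
      filter_upwards [hKc.isClosed.isOpen_compl.mem_nhds hu'] with w hw
      exact hgK i w hw
  have hgc : ∀ i, HasCompactSupport (g i) := fun i =>
    HasCompactSupport.intro hKc fun u hu => hgK i u hu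
  have hint := fun i => integral_fderiv_eq_zero_of_hasCompactSupport (hgd i) (hgc i)
    (stdFrame (n + 1) i)
  have e1 : ∀ u ∈ c.target, |coeff η.form x₀ u| * ratio η (d (𝓡 (n + 1)) σ) (c.symm u) =
      ∑ i : Fin (n + 1), (-1) ^ i.val * fderiv ℝ (g i) u (stdFrame (n + 1) i) := by
    intro u hu
    rw [ratio_eq η _ (c.map_target hu), ← hc, c.right_inv hu, coeff_d hσ hu, mul_div_left_comm,
      Finset.sum_mul]
    refine Finset.sum_congr rfl fun i _ => ?_
    rw [(hgt i u hu).fderiv_eq, fderiv_const_mul ((contDiffAt_alternating_iff.1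
        (hσ.contDiffAt (by rwa [hct])) _).differentiableAt (by simp))]
    simp [hs]
    ring
  rw [setIntegral_congr_fun c.open_target.measurableSet e1,
    setIntegral_eq_integral_of_forall_compl_eq_zero]
  · rw [integral_finsetSum]
    · refine Finset.sum_eq_zero fun i _ => ?_
      rw [integral_const_mul, (hint i).2, mul_zero]
    · exact fun i _ => (hint i).1.const_mul _
  · intro u hu
    have hu' : u ∉ c '' K := by
      rintro ⟨x, hx, rfl⟩
      exact hu (c.map_source (hKx hx))
    refine Finset.sum_eq_zero fun i _ => ?_
    have : g i =ᶠ[𝓝 u] fun _ => 0 := by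
      filter_upwards [hKc.isClosed.isOpen_compl.mem_nhds hu'] with w hw
      exact hgK i w hw
    rw [this.fderiv_eq]
    simp

/-- The Stokes theorem: an exact form with compactly supported primitive has integral zero. A
partition of unity reduces it to forms supported in chart domains. -/
theorem integral_ratio_d_eq_zero (η : VolForm (n + 1) X) {σ : DForm (𝓡 (n + 1)) X n}
    (hσ : IsSmooth (𝓡 (n + 1)) σ) {K : Set X} (hK : IsCompact K) (hσK : ∀ x, x ∉ K → σ x = 0) :
    ∫ x, ratio η (d (𝓡 (n + 1)) σ) x ∂(DForm.measure η.form) = 0 := by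
  classical
  have := isLocallyFiniteMeasure_measure η.isSmooth
  obtain ⟨ρ, hρ⟩ := SmoothPartitionOfUnity.exists_isSubordinate_chartAt_source (𝓡 (n + 1)) X
  have hfin := ρ.locallyFinite.finite_nonempty_inter_compact hK
  set t := hfin.toFinset with ht
  let τ : X → DForm (𝓡 (n + 1)) X n := fun i x => ρ i x • σ x
  have hτs : ∀ i, IsSmooth (𝓡 (n + 1)) (τ i) := fun i => hσ.smul (ρ i).contMDiff
  have hτ0 : ∀ i x, x ∉ K ∩ tsupport (ρ i) → τ i x = 0 := by
    intro i x hx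
    by_cases hxK : x ∈ K
    · have h1 : ρ i x = 0 := image_eq_zero_of_notMem_tsupport fun h => hx ⟨hxK, h⟩
      change ρ i x • σ x = 0
      rw [h1, zero_smul]
    · change ρ i x • σ x = 0
      rw [hσK x hxK, smul_zero]
  have hτK : ∀ i, IsCompact (K ∩ tsupport (ρ i)) := fun i => hK.inter_right (isClosed_tsupport _)
  have hτ : ∀ i, ∫ x, ratio η (d (𝓡 (n + 1)) (τ i)) x ∂(DForm.measure η.form) = 0 := fun i =>
    integral_ratio_d_eq_zero_of_chart η (hτs i) (hτK i) (hτ0 i) (inter_subset_right.trans (hρ i))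
  have hτi : ∀ i, Integrable (ratio η (d (𝓡 (n + 1)) (τ i))) (DForm.measure η.form) := fun i =>
    (continuous_ratio η (hτs i).d).integrable_of_hasCompactSupport
      (HasCompactSupport.intro (hτK i) fun x hx => by
        rw [ratio, d_apply_eq_zero (hτK i).isClosed (hτ0 i) hx]
        exact zero_div _)
  have key : ∀ t : Finset X, IsSmooth (𝓡 (n + 1)) (∑ i ∈ t, τ i) ∧
      Integrable (ratio η (d (𝓡 (n + 1)) (∑ i ∈ t, τ i))) (DForm.measure η.form) ∧
      ∫ x, ratio η (d (𝓡 (n + 1)) (∑ i ∈ t, τ i)) x ∂(DForm.measure η.form) = 0 := by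
    intro t
    induction t using Finset.induction_on with
    | empty =>
      have h1 : ratio η (0 : DForm (𝓡 (n + 1)) X (n + 1)) = fun _ => 0 := by
        funext x
        exact zero_div _
      rw [Finset.sum_empty, d_zero, h1]
      exact ⟨fun p => contDiffOn_const (c := 0), integrable_zero _ _ _, integral_zero _ _⟩
    | insert i t hi ih =>
      have h1 : ∀ α β : DForm (𝓡 (n + 1)) X (n + 1),
          ratio η (α + β) = fun x => ratio η α x + ratio η β x := by
        intro α β
        funext x
        exact add_div _ _ _
      rw [Finset.sum_insert hi, d_add (hτs i) ih.1, h1]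
      refine ⟨(hτs i).add ih.1, (hτi i).add ih.2.1, ?_⟩
      rw [integral_add (hτi i) ih.2.1, hτ i, ih.2.2, add_zero]
  have hsum : ∑ i ∈ t, τ i = σ := by
    funext x
    rw [Finset.sum_apply]
    change ∑ i ∈ t, ρ i x • σ x = σ x
    by_cases hx : x ∈ K
    · rw [← Finset.sum_smul, ρ.sum_finsupport' x (mem_univ x), one_smul]
      intro i hi
      rw [ht, hfin.mem_toFinset]
      exact ⟨x, by simpa using hi, hx⟩
    · rw [hσK x hx]
      simp
  rw [← hsum]
  exact (key t).2.2

end Stokes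

end DForm

/-! ### The first variation formula -/

namespace DForm

variable {n m : ℕ} {X : Type*} [TopologicalSpace X] [ChartedSpace (Eu (n + 1)) X]
  {E : Type*} [NormedAddCommGroup E] [NormedSpace ℝ E]
  {M : Type*} [TopologicalSpace M] [ChartedSpace E M]

/-- The velocity at time `0` of a family of maps `Ψ l : X → M`, a vector field along `Ψ 0`. -/
def velocity (Ψ : ℝ → X → M) (x : X) : TangentSpace 𝓘(ℝ, E) (Ψ 0 x) :=
  (mfderiv 𝓘(ℝ, ℝ) 𝓘(ℝ, E) (fun l => Ψ l x) 0 : ℝ →L[ℝ] E) 1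

/-- The form `(Ψ 0)^* (V ⌟ γ)`, where `V` is the velocity of the family `Ψ` at time `0`. -/
def contractAlong (Ψ : ℝ → X → M) (γ : DForm 𝓘(ℝ, E) M (m + 1)) : DForm (𝓡 (n + 1)) X m :=
  fun x => ContinuousAlternatingMap.compContinuousLinearMap
    (ContinuousAlternatingMap.curryLeft (E := E) (γ (Ψ 0 x)) (velocity Ψ x))
    (mfderiv (𝓡 (n + 1)) 𝓘(ℝ, E) (Ψ 0) x : Eu (n + 1) →L[ℝ] E)

/-- A family of maps, with its domain `X` read in the preferred chart around `x₀`. -/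
def familyInChart (Ψ : ℝ → X → M) (x₀ : X) (q : ℝ × Eu (n + 1)) : M :=
  Ψ q.1 ((extChartAt (𝓡 (n + 1)) x₀).symm q.2)

variable [IsManifold (𝓡 (n + 1)) ∞ X] {Ψ : ℝ → X → M} {ε : ℝ}
  (hΨ : ContMDiffOn (𝓘(ℝ, ℝ).prod (𝓡 (n + 1))) 𝓘(ℝ, E) ∞
    (fun q : ℝ × X => Ψ q.1 q.2) (Ioo (-ε) ε ×ˢ univ))
include hΨ

omit [IsManifold (𝓡 (n + 1)) ∞ X] in
theorem contMDiffAt_family {l : ℝ} (hl : l ∈ Ioo (-ε) ε) (x : X) :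
    ContMDiffAt (𝓘(ℝ, ℝ).prod (𝓡 (n + 1))) 𝓘(ℝ, E) ∞ (fun q : ℝ × X => Ψ q.1 q.2) (l, x) :=
  (hΨ (l, x) ⟨hl, mem_univ _⟩).contMDiffAt
    ((isOpen_Ioo.prod isOpen_univ).mem_nhds ⟨hl, mem_univ _⟩)

omit [IsManifold (𝓡 (n + 1)) ∞ X] in
theorem contMDiff_family_slice {l : ℝ} (hl : l ∈ Ioo (-ε) ε) :
    ContMDiff (𝓡 (n + 1)) 𝓘(ℝ, E) ∞ (Ψ l) := fun x =>
  ContMDiffAt.comp (f := fun x : X => (l, x)) (g := fun q : ℝ × X => Ψ q.1 q.2) x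
    (contMDiffAt_family hΨ hl x) (contMDiffAt_const.prodMk contMDiffAt_id)

theorem contMDiffAt_familyInChart {x₀ : X} {l : ℝ} {u : Eu (n + 1)} (hl : l ∈ Ioo (-ε) ε)
    (hu : u ∈ (extChartAt (𝓡 (n + 1)) x₀).target) :
    ContMDiffAt 𝓘(ℝ, ℝ × Eu (n + 1)) 𝓘(ℝ, E) ∞ (familyInChart Ψ x₀) (l, u) := by
  have h1 : ContMDiffAt 𝓘(ℝ, ℝ × Eu (n + 1)) (𝓡 (n + 1)) ∞
      (fun q : ℝ × Eu (n + 1) => (extChartAt (𝓡 (n + 1)) x₀).symm q.2) (l, u) :=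
    ContMDiffAt.comp (g := (extChartAt (𝓡 (n + 1)) x₀).symm) (l, u)
      ((contMDiffOn_extChartAt_symm (I := 𝓡 (n + 1)) (n := ∞) x₀ u hu).contMDiffAt
        ((isOpen_extChartAt_target x₀).mem_nhds hu)) contDiff_snd.contMDiff.contMDiffAt
  have h2 : ContMDiffAt 𝓘(ℝ, ℝ × Eu (n + 1)) 𝓘(ℝ, ℝ) ∞
      (fun q : ℝ × Eu (n + 1) => q.1) (l, u) := contDiff_fst.contMDiff.contMDiffAt
  exact ContMDiffAt.comp (g := fun q : ℝ × X => Ψ q.1 q.2) (l, u)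
    (contMDiffAt_family hΨ hl _) (h2.prodMk h1)

theorem mfderiv_familyInChart_inr {x₀ : X} {l : ℝ} {u : Eu (n + 1)} (hl : l ∈ Ioo (-ε) ε)
    (hu : u ∈ (extChartAt (𝓡 (n + 1)) x₀).target) (v : Eu (n + 1)) :
    (mfderiv 𝓘(ℝ, ℝ × Eu (n + 1)) 𝓘(ℝ, E) (familyInChart Ψ x₀) (l, u) :
        ℝ × Eu (n + 1) →L[ℝ] E) (0, v) =
      (mfderiv (𝓡 (n + 1)) 𝓘(ℝ, E) (Ψ l) ((extChartAt (𝓡 (n + 1)) x₀).symm u) :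
          Eu (n + 1) →L[ℝ] E)
        ((mfderiv (𝓡 (n + 1)) (𝓡 (n + 1)) (extChartAt (𝓡 (n + 1)) x₀).symm u :
          Eu (n + 1) →L[ℝ] Eu (n + 1)) v) := by
  have h1 := mfderiv_comp u (I := 𝓡 (n + 1)) (f := fun u : Eu (n + 1) => (l, u))
    (g := familyInChart Ψ x₀)
    ((contMDiffAt_familyInChart hΨ hl hu).mdifferentiableAt (by simp))
    (DifferentiableAt.mdifferentiableAt (by fun_prop))
  have h2 := mfderiv_comp u (I := 𝓡 (n + 1)) (f := (extChartAt (𝓡 (n + 1)) x₀).symm) (g := Ψ l)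
    ((contMDiff_family_slice hΨ hl).mdifferentiable (by simp) _)
    (mdifferentiableAt_extChartAt_symm' hu)
  have h3 := h1.symm.trans h2
  have h4 := congrArg (fun T : Eu (n + 1) →L[ℝ] E => T v) h3
  refine Eq.trans ?_ h4
  have h5 : (mfderiv (𝓡 (n + 1)) 𝓘(ℝ, ℝ × Eu (n + 1)) (fun u : Eu (n + 1) => (l, u)) u :
      Eu (n + 1) →L[ℝ] ℝ × Eu (n + 1)) = ContinuousLinearMap.inr ℝ ℝ (Eu (n + 1)) := by
    rw [mfderiv_eq_fderiv]
    exact (hasFDerivAt_prodMk_right l u).fderiv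
  exact (congrArg (fun w : ℝ × Eu (n + 1) => (mfderiv 𝓘(ℝ, ℝ × Eu (n + 1)) 𝓘(ℝ, E)
    (familyInChart Ψ x₀) (l, u) : ℝ × Eu (n + 1) →L[ℝ] E) w)
    (congrArg (fun T : Eu (n + 1) →L[ℝ] ℝ × Eu (n + 1) => T v) h5)).symm

theorem mfderiv_familyInChart_inl {x₀ : X} {u : Eu (n + 1)} (hε : (0 : ℝ) ∈ Ioo (-ε) ε)
    (hu : u ∈ (extChartAt (𝓡 (n + 1)) x₀).target) :
    (mfderiv 𝓘(ℝ, ℝ × Eu (n + 1)) 𝓘(ℝ, E) (familyInChart Ψ x₀) (0, u) :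
        ℝ × Eu (n + 1) →L[ℝ] E) (1, 0) =
      (velocity Ψ ((extChartAt (𝓡 (n + 1)) x₀).symm u) : E) := by
  have h1 := mfderiv_comp (0 : ℝ) (I := 𝓘(ℝ, ℝ)) (f := fun l : ℝ => (l, u))
    (g := familyInChart Ψ x₀)
    ((contMDiffAt_familyInChart hΨ hε hu).mdifferentiableAt (by simp))
    (DifferentiableAt.mdifferentiableAt (by fun_prop))
  have h4 := congrArg (fun T : ℝ →L[ℝ] E => T 1) h1
  refine Eq.trans ?_ h4.symm
  have h5 : (mfderiv 𝓘(ℝ, ℝ) 𝓘(ℝ, ℝ × Eu (n + 1)) (fun l : ℝ => (l, u)) 0 :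
      ℝ →L[ℝ] ℝ × Eu (n + 1)) = ContinuousLinearMap.inl ℝ ℝ (Eu (n + 1)) := by
    rw [mfderiv_eq_fderiv]
    exact (hasFDerivAt_prodMk_left (0 : ℝ) u).fderiv
  exact (congrArg (fun w : ℝ × Eu (n + 1) => (mfderiv 𝓘(ℝ, ℝ × Eu (n + 1)) 𝓘(ℝ, E)
    (familyInChart Ψ x₀) (0, u) : ℝ × Eu (n + 1) →L[ℝ] E) w)
    (congrArg (fun T : ℝ →L[ℝ] ℝ × Eu (n + 1) => T 1) h5)).symm

/-- In a chart, the pullback by a member of the family is a restriction of the pullback of the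
form to the cylinder `ℝ × X`. -/
theorem inChart_pullback_family {x₀ : X} {l : ℝ} {u : Eu (n + 1)} (hl : l ∈ Ioo (-ε) ε)
    (hu : u ∈ (extChartAt (𝓡 (n + 1)) x₀).target) (γ : DForm 𝓘(ℝ, E) M m)
    (v : Fin m → Eu (n + 1)) :
    inChart (𝓡 (n + 1)) (DForm.pullback (𝓡 (n + 1)) 𝓘(ℝ, E) (Ψ l) γ) x₀ u v =
      onVec (DForm.pullback 𝓘(ℝ, ℝ × Eu (n + 1)) 𝓘(ℝ, E) (familyInChart Ψ x₀) γ) (l, u)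
        fun i => (0, v i) := by
  change (γ _ : E [⋀^Fin m]→L[ℝ] ℝ) _ = (γ _ : E [⋀^Fin m]→L[ℝ] ℝ) _
  refine congrArg (γ (Ψ l ((extChartAt (𝓡 (n + 1)) x₀).symm u)) : E [⋀^Fin m]→L[ℝ] ℝ) ?_
  funext i
  exact (mfderiv_familyInChart_inr hΨ hl hu (v i)).symm

/-- In a chart, the contraction with the velocity is the contraction of the pullback to the
cylinder `ℝ × X` with the time direction. -/
theorem inChart_contractAlong {x₀ : X} {u : Eu (n + 1)} (hε : (0 : ℝ) ∈ Ioo (-ε) ε)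
    (hu : u ∈ (extChartAt (𝓡 (n + 1)) x₀).target) (γ : DForm 𝓘(ℝ, E) M (m + 1))
    (v : Fin m → Eu (n + 1)) :
    inChart (𝓡 (n + 1)) (contractAlong Ψ γ) x₀ u v =
      onVec (DForm.pullback 𝓘(ℝ, ℝ × Eu (n + 1)) 𝓘(ℝ, E) (familyInChart Ψ x₀) γ) (0, u)
        (Fin.cons (1, 0) fun i => (0, v i)) := by
  change (γ _ : E [⋀^Fin (m + 1)]→L[ℝ] ℝ) _ = (γ _ : E [⋀^Fin (m + 1)]→L[ℝ] ℝ) _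
  refine congrArg (γ (Ψ 0 ((extChartAt (𝓡 (n + 1)) x₀).symm u)) : E [⋀^Fin (m + 1)]→L[ℝ] ℝ) ?_
  funext i
  refine Fin.cases ?_ (fun i => ?_) i
  · exact (mfderiv_familyInChart_inl hΨ hε hu).symm
  · exact (mfderiv_familyInChart_inr hΨ hε hu (v i)).symm

variable [IsManifold 𝓘(ℝ, E) ∞ M]

theorem contDiffAt_pullback_familyInChart {γ : DForm 𝓘(ℝ, E) M m} (hγ : IsSmooth 𝓘(ℝ, E) γ)
    {x₀ : X} {l : ℝ} {u : Eu (n + 1)} (hl : l ∈ Ioo (-ε) ε)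
    (hu : u ∈ (extChartAt (𝓡 (n + 1)) x₀).target) :
    ContDiffAt ℝ ∞ (onVec
      (DForm.pullback 𝓘(ℝ, ℝ × Eu (n + 1)) 𝓘(ℝ, E) (familyInChart Ψ x₀) γ)) (l, u) :=
  hγ.contDiffAt_pullback (contMDiffAt_familyInChart hΨ hl hu)

theorem isSmooth_contractAlong (hε : (0 : ℝ) ∈ Ioo (-ε) ε) {γ : DForm 𝓘(ℝ, E) M (m + 1)}
    (hγ : IsSmooth 𝓘(ℝ, E) γ) : IsSmooth (𝓡 (n + 1)) (contractAlong Ψ γ) := by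
  intro x₀ u hu
  refine ContDiffAt.contDiffWithinAt (contDiffAt_alternating_iff.2 fun v => ?_)
  have h1 : ContDiffAt ℝ ∞ (fun u => onVec
      (DForm.pullback 𝓘(ℝ, ℝ × Eu (n + 1)) 𝓘(ℝ, E) (familyInChart Ψ x₀) γ) (0, u)
        (Fin.cons (1, 0) fun i => (0, v i))) u := by
    have h2 := contDiffAt_alternating_iff.1 (contDiffAt_pullback_familyInChart hΨ hγ hε hu)
      (Fin.cons (1, 0) fun i => (0, v i))
    exact ContDiffAt.comp (f := fun u : Eu (n + 1) => ((0 : ℝ), u)) u h2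
      (contDiffAt_const.prodMk contDiffAt_id)
  refine h1.congr_of_eventuallyEq ?_
  filter_upwards [(isOpen_extChartAt_target x₀).mem_nhds hu] with w hw
  exact inChart_contractAlong hΨ hε hw γ v

/-- Cartan's formula: the time derivative at `0` of the coefficient of `(Ψ l)^* β` is the
coefficient of `(Ψ 0)^* (V ⌟ dβ) + d ((Ψ 0)^* (V ⌟ β))`. It is obtained by evaluating the exterior
derivative of the pullback of `β` to the cylinder `ℝ × X` on the time direction and a frame
of `X`. -/
theorem fderiv_pullback_family_apply (hε : (0 : ℝ) ∈ Ioo (-ε) ε)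
    {β : DForm 𝓘(ℝ, E) M (n + 1)} (hβ : IsSmooth 𝓘(ℝ, E) β) {x₀ : X} {u : Eu (n + 1)}
    (hu : u ∈ (chartAt (Eu (n + 1)) x₀).target) :
    fderiv ℝ (fun q => onVec (DForm.pullback 𝓘(ℝ, ℝ × Eu (n + 1)) 𝓘(ℝ, E)
        (familyInChart Ψ x₀) β) q fun i => (0, stdFrame (n + 1) i)) (0, u) (1, 0) =
      coeff (contractAlong Ψ (d 𝓘(ℝ, E) β)) x₀ u +
        coeff (d (𝓡 (n + 1)) (contractAlong Ψ β)) x₀ u := by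
  have hu' : u ∈ (extChartAt (𝓡 (n + 1)) x₀).target := by simpa using hu
  set B := onVec (DForm.pullback 𝓘(ℝ, ℝ × Eu (n + 1)) 𝓘(ℝ, E) (familyInChart Ψ x₀) β) with hB
  have hBd : ContDiffAt ℝ ∞ B (0, u) := contDiffAt_pullback_familyInChart hΨ hβ hε hu'
  have h1 : coeff (contractAlong Ψ (d 𝓘(ℝ, E) β)) x₀ u =
      extDeriv B (0, u) (Fin.cons (1, 0) fun i => (0, stdFrame (n + 1) i)) := by
    rw [hB, extDeriv_pullback_eq (contMDiffAt_familyInChart hΨ hε hu') (hβ.differentiableAt _)]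
    exact inChart_contractAlong hΨ hε hu' _ _
  have h2 : ∀ i : Fin (n + 1),
      fderiv ℝ (fun w => inChart (𝓡 (n + 1)) (contractAlong Ψ β) x₀ w
          (i.removeNth (stdFrame (n + 1)))) u (stdFrame (n + 1) i) =
        fderiv ℝ (fun q => B q (Fin.cons (1, 0)
          (i.removeNth fun i => (0, stdFrame (n + 1) i)))) (0, u) (0, stdFrame (n + 1) i) := by
    intro i
    have h3 : (fun w => inChart (𝓡 (n + 1)) (contractAlong Ψ β) x₀ w
          (i.removeNth (stdFrame (n + 1)))) =ᶠ[𝓝 u]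
        (fun q => B q (Fin.cons (1, 0) (i.removeNth fun i => (0, stdFrame (n + 1) i)))) ∘
          fun w => ((0 : ℝ), w) := by
      filter_upwards [(isOpen_extChartAt_target x₀).mem_nhds hu'] with w hw
      exact inChart_contractAlong hΨ hε hw β _
    rw [h3.fderiv_eq, fderiv_comp u
      ((contDiffAt_alternating_iff.1 hBd _).differentiableAt (by simp)) (by fun_prop)]
    have h5 : fderiv ℝ (fun w : Eu (n + 1) => ((0 : ℝ), w)) u =
      ContinuousLinearMap.inr ℝ ℝ (Eu (n + 1)) := (hasFDerivAt_prodMk_right (0 : ℝ) u).fderiv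
    rw [h5]
    rfl
  -- On constant vector fields, the exterior derivative is an alternating sum of directional
  -- derivatives. Its first term is the time derivative, and the others form the coefficient of
  -- `-d ((Ψ 0)^* (V ⌟ β))`.
  have hrem : ∀ i : Fin (n + 1), i.succ.removeNth (Fin.cons ((1 : ℝ), (0 : Eu (n + 1)))
      fun i => ((0 : ℝ), stdFrame (n + 1) i) : Fin (n + 2) → ℝ × Eu (n + 1)) =
      Fin.cons (1, 0) (i.removeNth fun i => (0, stdFrame (n + 1) i)) := by
    intro i
    funext j
    refine Fin.cases ?_ (fun j => ?_) j
    · simp [Fin.removeNth]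
    · simp [Fin.removeNth]
  rw [h1, coeff_d (isSmooth_contractAlong hΨ hε hβ) hu,
    extDeriv_apply (hBd.differentiableAt (by simp)), Fin.sum_univ_succ]
  simp only [Fin.cons_zero, Fin.cons_succ, h2, hrem, Fin.removeNth_zero, Fin.tail_cons,
    Fin.val_zero, pow_zero, one_smul, Fin.val_succ, pow_succ]
  rw [add_assoc, ← Finset.sum_add_distrib, Finset.sum_eq_zero, add_zero]
  intro i _
  simp

omit [IsManifold 𝓘(ℝ, E) ∞ M] in
theorem ratio_pullback_family (η : VolForm (n + 1) X) (β : DForm 𝓘(ℝ, E) M (n + 1)) {x₀ x : X}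
    (hx : x ∈ (chartAt (Eu (n + 1)) x₀).source) {l : ℝ} (hl : l ∈ Ioo (-ε) ε) :
    ratio η (DForm.pullback (𝓡 (n + 1)) 𝓘(ℝ, E) (Ψ l) β) x =
      (onVec (DForm.pullback 𝓘(ℝ, ℝ × Eu (n + 1)) 𝓘(ℝ, E) (familyInChart Ψ x₀) β)
        (l, chartAt (Eu (n + 1)) x₀ x) fun i => (0, stdFrame (n + 1) i)) /
      coeff η.form x₀ (chartAt (Eu (n + 1)) x₀ x) := by
  rw [ratio_eq η _ hx]
  congr 1
  refine inChart_pullback_family hΨ hl ?_ β _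
  simpa using (chartAt (Eu (n + 1)) x₀).map_source hx

theorem hasDerivAt_ratio_pullback_family (η : VolForm (n + 1) X) {β : DForm 𝓘(ℝ, E) M (n + 1)}
    (hβ : IsSmooth 𝓘(ℝ, E) β) {x₀ x : X}
    (hx : x ∈ (chartAt (Eu (n + 1)) x₀).source) {l : ℝ} (hl : l ∈ Ioo (-ε) ε) :
    HasDerivAt (fun l => ratio η (DForm.pullback (𝓡 (n + 1)) 𝓘(ℝ, E) (Ψ l) β) x)
      (fderiv ℝ (fun q => onVec (DForm.pullback 𝓘(ℝ, ℝ × Eu (n + 1)) 𝓘(ℝ, E)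
        (familyInChart Ψ x₀) β) q fun i => (0, stdFrame (n + 1) i))
          (l, chartAt (Eu (n + 1)) x₀ x) (1, 0) /
        coeff η.form x₀ (chartAt (Eu (n + 1)) x₀ x)) l := by
  set u := chartAt (Eu (n + 1)) x₀ x with hu
  have hu' : u ∈ (extChartAt (𝓡 (n + 1)) x₀).target := by
    simpa using (chartAt (Eu (n + 1)) x₀).map_source hx
  have h1 := ((contDiffAt_alternating_iff.1 (contDiffAt_pullback_familyInChart hΨ hβ hl hu')
    fun i => (0, stdFrame (n + 1) i)).differentiableAt (by simp)).hasFDerivAt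
  have h2 : HasDerivAt (fun l : ℝ => (l, u)) (1, 0) l :=
    (hasDerivAt_id l).prodMk (hasDerivAt_const l u)
  have h3 := (h1.comp_hasDerivAt l h2).div_const (coeff η.form x₀ u)
  refine h3.congr_of_eventuallyEq ?_
  filter_upwards [isOpen_Ioo.mem_nhds hl] with l' hl'
  exact ratio_pullback_family hΨ η β hx hl'

theorem continuousAt_deriv_ratio (η : VolForm (n + 1) X) {β : DForm 𝓘(ℝ, E) M (n + 1)}
    (hβ : IsSmooth 𝓘(ℝ, E) β) {l : ℝ} (hl : l ∈ Ioo (-ε) ε) (x₀ : X) :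
    ContinuousAt (fun q : ℝ × X => deriv
      (fun l => ratio η (DForm.pullback (𝓡 (n + 1)) 𝓘(ℝ, E) (Ψ l) β) q.2) q.1) (l, x₀) := by
  set c := chartAt (Eu (n + 1)) x₀ with hc
  have hx : x₀ ∈ c.source := mem_chart_source _ _
  have hu := c.map_source hx
  have hu' : c x₀ ∈ (extChartAt (𝓡 (n + 1)) x₀).target := by simpa using hu
  have h1 := contDiffAt_alternating_iff.1 (contDiffAt_pullback_familyInChart hΨ hβ hl hu')
    fun i => (0, stdFrame (n + 1) i)
  have h2 := ((h1.fderiv_right (m := ∞) (by simp)).continuousAt).clm_apply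
    (continuousAt_const (y := ((1 : ℝ), (0 : Eu (n + 1)))))
  have h3 : ContinuousAt (fun q : ℝ × X => (q.1, c q.2)) (l, x₀) :=
    continuousAt_fst.prodMk (ContinuousAt.comp (f := Prod.snd) (c.continuousAt hx) continuousAt_snd)
  have h4 : ContinuousAt (fun q : ℝ × X => coeff η.form x₀ (c q.2)) (l, x₀) :=
    ContinuousAt.comp (g := coeff η.form x₀) (contDiffAt_coeff η.isSmooth hu).continuousAt
      (ContinuousAt.comp (f := Prod.snd) (c.continuousAt hx) continuousAt_snd)
  have h5 := (ContinuousAt.comp (f := fun q : ℝ × X => (q.1, c q.2)) h2 h3).div h4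
    (coeff_volForm_ne_zero η hu)
  refine h5.congr ?_
  filter_upwards [(isOpen_Ioo.prod c.open_source).mem_nhds ⟨hl, hx⟩] with q hq
  exact (hasDerivAt_ratio_pullback_family hΨ η hβ hq.2 hq.1).deriv.symm

/-- Cartan's formula for the function `a` with `(Ψ l)^* β = a η`. -/
theorem deriv_ratio_zero (η : VolForm (n + 1) X) (hε : (0 : ℝ) ∈ Ioo (-ε) ε)
    {β : DForm 𝓘(ℝ, E) M (n + 1)} (hβ : IsSmooth 𝓘(ℝ, E) β) (x : X) :
    deriv (fun l => ratio η (DForm.pullback (𝓡 (n + 1)) 𝓘(ℝ, E) (Ψ l) β) x) 0 =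
      ratio η (contractAlong Ψ (d 𝓘(ℝ, E) β)) x +
        ratio η (d (𝓡 (n + 1)) (contractAlong Ψ β)) x := by
  have hx : x ∈ (chartAt (Eu (n + 1)) x).source := mem_chart_source _ _
  rw [(hasDerivAt_ratio_pullback_family hΨ η hβ hx hε).deriv,
    fderiv_pullback_family_apply hΨ hε hβ ((chartAt (Eu (n + 1)) x).map_source hx), add_div,
    ← ratio_eq η _ hx, ← ratio_eq η _ hx]

theorem continuous_ratio_contractAlong_d (η : VolForm (n + 1) X) (hε : (0 : ℝ) ∈ Ioo (-ε) ε)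
    {β : DForm 𝓘(ℝ, E) M (n + 1)} (hβ : IsSmooth 𝓘(ℝ, E) β) :
    Continuous (ratio η (contractAlong Ψ (d 𝓘(ℝ, E) β))) :=
  continuous_ratio η (isSmooth_contractAlong hΨ hε hβ.d)

variable [T2Space X] [SigmaCompactSpace X] [MeasurableSpace X] [BorelSpace X]

/-- The first variation formula: for a family `Ψ` of maps that is constant outside of the compact
set `U`, the derivative at `0` of `∫_U (Ψ l)^* β` is `∫_U (Ψ 0)^* (V ⌟ dβ)`.
The boundary term `d ((Ψ 0)^* (V ⌟ β))` of Cartan's formula integrates to zero because the velocity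
`V` vanishes outside of `U`. -/
theorem hasDerivAt_integral_pullback_family (η : VolForm (n + 1) X)
    (hε : (0 : ℝ) ∈ Ioo (-ε) ε) {β : DForm 𝓘(ℝ, E) M (n + 1)} (hβ : IsSmooth 𝓘(ℝ, E) β)
    {U : Set X} (hU : IsCompact U) (hΨU : ∀ l ∈ Ioo (-ε) ε, ∀ x, x ∉ U → Ψ l x = Ψ 0 x) :
    HasDerivAt (fun l => integral η U (DForm.pullback (𝓡 (n + 1)) 𝓘(ℝ, E) (Ψ l) β))
      (integral η U (contractAlong Ψ (d 𝓘(ℝ, E) β))) 0 := by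
  have := isLocallyFiniteMeasure_measure η.isSmooth
  set μ := DForm.measure η.form with hμ
  have hε0 : 0 < ε := hε.2
  have hsub : Icc (-(ε / 2)) (ε / 2) ⊆ Ioo (-ε) ε := fun l hl =>
    ⟨by linarith [hl.1], by linarith [hl.2]⟩
  obtain ⟨C, hC⟩ := (isCompact_Icc.prod hU).exists_bound_of_continuousOn
    (f := fun q : ℝ × X => deriv
      (fun l => ratio η (DForm.pullback (𝓡 (n + 1)) 𝓘(ℝ, E) (Ψ l) β) q.2) q.1)
    (s := Icc (-(ε / 2)) (ε / 2) ×ˢ U) fun q hq =>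
      (continuousAt_deriv_ratio hΨ η hβ (hsub hq.1) q.2).continuousWithinAt
  have hcont : ∀ l ∈ Ioo (-ε) ε,
      Continuous (ratio η (DForm.pullback (𝓡 (n + 1)) 𝓘(ℝ, E) (Ψ l) β)) := fun l hl =>
    continuous_ratio η (IsSmooth.pullback hβ (contMDiff_family_slice hΨ hl))
  have h1 : Continuous fun x => deriv
      (fun l => ratio η (DForm.pullback (𝓡 (n + 1)) 𝓘(ℝ, E) (Ψ l) β) x) 0 :=
    continuous_iff_continuousAt.2 fun x => ContinuousAt.comp (f := fun x : X => ((0 : ℝ), x))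
      (continuousAt_deriv_ratio hΨ η hβ hε x) (by fun_prop)
  have hmain := (hasDerivAt_integral_of_dominated_loc_of_deriv_le (μ := μ.restrict U)
    (F := fun l x => ratio η (DForm.pullback (𝓡 (n + 1)) 𝓘(ℝ, E) (Ψ l) β) x)
    (F' := fun l x => deriv
      (fun l => ratio η (DForm.pullback (𝓡 (n + 1)) 𝓘(ℝ, E) (Ψ l) β) x) l)
    (x₀ := (0 : ℝ)) (s := Icc (-(ε / 2)) (ε / 2)) (bound := fun _ => C)
    (Icc_mem_nhds (by linarith) (by linarith))
    (by filter_upwards [isOpen_Ioo.mem_nhds hε] with l hl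
        exact (hcont l hl).aestronglyMeasurable)
    ((hcont 0 hε).continuousOn.integrableOn_compact hU) h1.aestronglyMeasurable
    (by filter_upwards [ae_restrict_mem hU.measurableSet] with x hx l hl
        exact hC (l, x) ⟨hl, hx⟩)
    (continuousOn_const.integrableOn_compact hU)
    (Filter.Eventually.of_forall fun x l hl =>
      (hasDerivAt_ratio_pullback_family hΨ η hβ (mem_chart_source (Eu (n + 1)) x)
        (hsub hl)).differentiableAt.hasDerivAt)).2
  have hσ := isSmooth_contractAlong hΨ hε hβ
  have hσU : ∀ x, x ∉ U → contractAlong (n := n) Ψ β x = 0 := by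
    intro x hx
    have hv : (velocity Ψ x : E) = 0 := by
      have h2 : (fun l => Ψ l x) =ᶠ[𝓝 0] fun _ => Ψ 0 x := by
        filter_upwards [isOpen_Ioo.mem_nhds hε] with l hl
        exact hΨU l hl x hx
      have h3 : (mfderiv 𝓘(ℝ, ℝ) 𝓘(ℝ, E) (fun l => Ψ l x) 0 : ℝ →L[ℝ] E) = 0 :=
        h2.mfderiv_eq.trans mfderiv_const
      exact congrArg (fun T : ℝ →L[ℝ] E => T 1) h3
    refine form_ext fun v => ?_
    change (β (Ψ 0 x) : E [⋀^Fin (n + 1)]→L[ℝ] ℝ) (Fin.cons (velocity Ψ x : E) _) = 0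
    exact ContinuousAlternatingMap.map_coord_zero (β (Ψ 0 x) : E [⋀^Fin (n + 1)]→L[ℝ] ℝ) 0 hv
  have hdσ : ∀ x, x ∉ U → ratio η (d (𝓡 (n + 1)) (contractAlong Ψ β)) x = 0 := by
    intro x hx
    rw [ratio, d_apply_eq_zero hU.isClosed hσU hx]
    exact zero_div _
  have hval : ∫ x in U, deriv
      (fun l => ratio η (DForm.pullback (𝓡 (n + 1)) 𝓘(ℝ, E) (Ψ l) β) x) 0 ∂μ =
      integral η U (contractAlong Ψ (d 𝓘(ℝ, E) β)) := by
    simp_rw [deriv_ratio_zero hΨ η hε hβ]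
    rw [integral_add
      ((continuous_ratio_contractAlong_d hΨ η hε hβ).continuousOn.integrableOn_compact hU)
      ((continuous_ratio η hσ.d).continuousOn.integrableOn_compact hU),
      setIntegral_eq_integral_of_forall_compl_eq_zero hdσ,
      integral_ratio_d_eq_zero η hσ hU hσU, add_zero]
    rfl
  rw [← hval]
  exact hmain

end DForm

/-! ### Charts and projections of the bundles over `Y` -/

section FibreBundles

variable {n N : ℕ} {X Y F : Type*}
  [TopologicalSpace X] [ChartedSpace (Eu (n + 1)) X]
  [TopologicalSpace Y] [ChartedSpace (Eu (n + N + 1)) Y]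
  [TopologicalSpace F] [ChartedSpace (Eu N) F] {B : FieldBundle n N X Y F}
  [IsManifold (𝓡 (n + 1)) ∞ X] [IsManifold (𝓡 N) ∞ F]

variable (B) in
/-- The adapted chart around `y` that is used for the preferred charts of the bundles over `Y`. -/
def adaptedChartAt (y : Y) : AdaptedChart B := (exists_adaptedChart B y).choose

variable (B) in
theorem mem_adaptedChartAt_source (y : Y) : y ∈ (adaptedChartAt B y).total.source :=
  (exists_adaptedChart B y).choose_spec

namespace FibreCoords

variable {A A' : Y → Type*} {V V' : Type*} [NormedAddCommGroup V] [NormedSpace ℝ V]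
  [NormedAddCommGroup V'] [NormedSpace ℝ V'] {D : FibreCoords B A V} {D' : FibreCoords B A' V'}

theorem extChartAt_symm_apply (m : D.Total) (q : (Eu (n + 1) × Eu N) × V) :
    (extChartAt 𝓘(ℝ, (Eu (n + 1) × Eu N) × V) m).symm q =
      D.chartInv (adaptedChartAt B m.pt) m q := rfl

theorem mem_chartAt_source {m m' : D.Total} :
    m' ∈ (chartAt ((Eu (n + 1) × Eu N) × V) m).source ↔
      m'.pt ∈ (adaptedChartAt B m.pt).total.source := Iff.rfl

theorem mem_extChartAt_source' {m m' : D.Total} :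
    m' ∈ (extChartAt 𝓘(ℝ, (Eu (n + 1) × Eu N) × V) m).source ↔
      m'.pt ∈ (adaptedChartAt B m.pt).total.source := by
  rw [extChartAt_source]
  exact Iff.rfl

theorem mem_extChartAt_target {m : D.Total} {q : (Eu (n + 1) × Eu N) × V} :
    q ∈ (extChartAt 𝓘(ℝ, (Eu (n + 1) × Eu N) × V) m).target ↔
      q.1 ∈ (adaptedChartAt B m.pt).total.target := by
  have h : (extChartAt 𝓘(ℝ, (Eu (n + 1) × Eu N) × V) m).target =
      (chartAt ((Eu (n + 1) × Eu N) × V) m).target := by simp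
  rw [h]
  exact ⟨fun h => h.1, fun h => ⟨h, mem_univ _⟩⟩

theorem extChartAt_eq {m m' : D.Total} (h : m'.pt ∈ (adaptedChartAt B m.pt).total.source) :
    extChartAt 𝓘(ℝ, (Eu (n + 1) × Eu N) × V) m m' =
      ((adaptedChartAt B m.pt).total m'.pt, D.coord _ m'.pt h m'.val) :=
  D.chartFun_of_mem _ _ h

theorem pt_extChartAt_symm {m : D.Total} {q : (Eu (n + 1) × Eu N) × V}
    (h : q.1 ∈ (adaptedChartAt B m.pt).total.target) :
    ((extChartAt 𝓘(ℝ, (Eu (n + 1) × Eu N) × V) m).symm q).pt =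
      (adaptedChartAt B m.pt).total.symm q.1 := by
  rw [extChartAt_symm_apply, D.chartInv_of_mem _ _ _ ((adaptedChartAt B m.pt).total.map_target h)]

theorem contMDiffAt_extChartAt_total {m m' : D.Total}
    (h : m'.pt ∈ (adaptedChartAt B m.pt).total.source) :
    ContMDiffAt 𝓘(ℝ, (Eu (n + 1) × Eu N) × V) 𝓘(ℝ, (Eu (n + 1) × Eu N) × V) ∞
      (extChartAt 𝓘(ℝ, (Eu (n + 1) × Eu N) × V) m) m' :=
  DForm.contMDiffAt_extChartAt'' (mem_extChartAt_source'.2 h)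

theorem contMDiff_pt : ContMDiff 𝓘(ℝ, (Eu (n + 1) × Eu N) × V) (𝓡 (n + N + 1)) ∞
    (Total.pt : D.Total → Y) := by
  intro m
  have hm := mem_adaptedChartAt_source B m.pt
  set c := adaptedChartAt B m.pt with hc
  have h1 := contMDiffAt_extChartAt_total (D := D) hm
  have h2 : ContMDiffAt 𝓘(ℝ, (Eu (n + 1) × Eu N) × V) 𝓘(ℝ, Eu (n + 1) × Eu N) ∞
      (fun m' => (extChartAt 𝓘(ℝ, (Eu (n + 1) × Eu N) × V) m m').1) m :=
    ContMDiffAt.comp (g := Prod.fst) m contDiff_fst.contMDiff.contMDiffAt h1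
  have h3 : ContMDiffAt 𝓘(ℝ, (Eu (n + 1) × Eu N) × V) (𝓡 (n + N + 1)) ∞
      (fun m' => c.total.symm (extChartAt 𝓘(ℝ, (Eu (n + 1) × Eu N) × V) m m').1) m := by
    refine ContMDiffAt.comp (g := c.total.symm) m ?_ h2
    have : (extChartAt 𝓘(ℝ, (Eu (n + 1) × Eu N) × V) m m).1 ∈ c.total.target := by
      rw [extChartAt_eq hm]
      exact c.total.map_source hm
    exact (c.total_symm_smooth _ this).contMDiffAt (c.total.open_target.mem_nhds this)
  refine h3.congr_of_eventuallyEq ?_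
  filter_upwards [(isOpen_extChartAt_source (I := 𝓘(ℝ, (Eu (n + 1) × Eu N) × V)) m).mem_nhds
    (mem_extChartAt_source m)] with m' hm'
  rw [mem_extChartAt_source'] at hm'
  rw [extChartAt_eq hm', c.total.left_inv hm']

theorem contMDiff_proj_pt : ContMDiff 𝓘(ℝ, (Eu (n + 1) × Eu N) × V) (𝓡 (n + 1)) ∞
    (fun m : D.Total => B.proj m.pt) := by
  intro m
  have hm := mem_adaptedChartAt_source B m.pt
  set c := adaptedChartAt B m.pt with hc
  have h1 := contMDiffAt_extChartAt_total (D := D) hm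
  have h2 : ContMDiffAt 𝓘(ℝ, (Eu (n + 1) × Eu N) × V) (𝓡 (n + 1)) ∞
      (fun m' => (extChartAt 𝓘(ℝ, (Eu (n + 1) × Eu N) × V) m m').1.1) m :=
    ContMDiffAt.comp (g := fun q : (Eu (n + 1) × Eu N) × V => q.1.1) m
      (contDiff_fst.fst.contMDiff.contMDiffAt) h1
  have h3 : ContMDiffAt 𝓘(ℝ, (Eu (n + 1) × Eu N) × V) (𝓡 (n + 1)) ∞
      (fun m' => c.base.symm (extChartAt 𝓘(ℝ, (Eu (n + 1) × Eu N) × V) m m').1.1) m := by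
    refine ContMDiffAt.comp (g := c.base.symm) m ?_ h2
    have : (extChartAt 𝓘(ℝ, (Eu (n + 1) × Eu N) × V) m m).1.1 ∈ c.base.target := by
      rw [extChartAt_eq hm]
      change (c.total m.pt).1 ∈ _
      rw [c.total_fst _ hm]
      exact c.base.map_source (c.proj_mem _ hm)
    exact (c.base_symm_smooth _ this).contMDiffAt (c.base.open_target.mem_nhds this)
  refine h3.congr_of_eventuallyEq ?_
  filter_upwards [(isOpen_extChartAt_source (I := 𝓘(ℝ, (Eu (n + 1) × Eu N) × V)) m).mem_nhds
    (mem_extChartAt_source m)] with m' hm'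
  rw [mem_extChartAt_source'] at hm'
  rw [extChartAt_eq hm', c.total_fst _ hm', c.base.left_inv (c.proj_mem _ hm')]

/-- A fibre preserving map that is linear in fibre coordinates is smooth. -/
theorem contMDiff_fibreMap (g : ∀ y, A y → A' y) (T : V →L[ℝ] V')
    (h : ∀ (c : AdaptedChart B) (y : Y) (hy : y ∈ c.total.source) (a : A y),
      D'.coord c y hy (g y a) = T (D.coord c y hy a)) :
    ContMDiff 𝓘(ℝ, (Eu (n + 1) × Eu N) × V) 𝓘(ℝ, (Eu (n + 1) × Eu N) × V') ∞
      (fun m : D.Total => (⟨m.pt, g m.pt m.val⟩ : D'.Total)) := by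
  intro m
  set I := 𝓘(ℝ, (Eu (n + 1) × Eu N) × V)
  set I' := 𝓘(ℝ, (Eu (n + 1) × Eu N) × V')
  set f : D.Total → D'.Total := fun m => ⟨m.pt, g m.pt m.val⟩ with hf
  have hm := mem_adaptedChartAt_source B m.pt
  have h1 := contMDiffAt_extChartAt_total (D := D) hm
  have h2 : ContMDiffAt I I' ∞ (fun m' => (Prod.map id T (extChartAt I m m') :
      (Eu (n + 1) × Eu N) × V')) m :=
    ContMDiffAt.comp (g := fun q : (Eu (n + 1) × Eu N) × V => (Prod.map id T q :
      (Eu (n + 1) × Eu N) × V')) m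
      ((contDiff_fst.prodMk (T.contDiff.comp contDiff_snd)).contMDiff.contMDiffAt) h1
  have key : ∀ m' : D.Total, m'.pt ∈ (adaptedChartAt B m.pt).total.source →
      Prod.map id T (extChartAt I m m') = extChartAt I' (f m) (f m') := by
    intro m' hm'
    rw [extChartAt_eq hm', extChartAt_eq (m := f m) (m' := f m') hm']
    exact Prod.ext rfl (h _ _ _ _).symm
  have h3 : ContMDiffAt I I' ∞
      (fun m' => (extChartAt I' (f m)).symm (Prod.map id T (extChartAt I m m'))) m := by
    refine ContMDiffAt.comp (g := (extChartAt I' (f m)).symm) m ?_ h2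
    rw [key m hm]
    exact (contMDiffOn_extChartAt_symm (f m) _ (_root_.mem_extChartAt_target _)).contMDiffAt
      ((isOpen_extChartAt_target _).mem_nhds (_root_.mem_extChartAt_target _))
  refine h3.congr_of_eventuallyEq ?_
  filter_upwards [(isOpen_extChartAt_source (I := I) m).mem_nhds
    (mem_extChartAt_source m)] with m' hm'
  rw [mem_extChartAt_source'] at hm'
  rw [key m' hm', (extChartAt I' (f m)).left_inv (mem_extChartAt_source'.2 hm')]

/-- Points over different points of `Y` are separated in `Y`, and points over the same point of `Y`
lie in a common chart. -/
instance [T2Space Y] : T2Space D.Total := by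
  refine ⟨fun m m' hne => ?_⟩
  by_cases h : m.pt = m'.pt
  · have hm : m ∈ (chartAt ((Eu (n + 1) × Eu N) × V) m).source := mem_chart_source _ _
    have hm' : m' ∈ (chartAt ((Eu (n + 1) × Eu N) × V) m).source := by
      rw [mem_chartAt_source, ← h]
      exact mem_adaptedChartAt_source B m.pt
    set e := chartAt ((Eu (n + 1) × Eu N) × V) m
    obtain ⟨u, v, hu, hv, hmu, hmv, huv⟩ := t2_separation fun h => hne (e.injOn hm hm' h)
    refine ⟨e.source ∩ e ⁻¹' u, e.source ∩ e ⁻¹' v, e.isOpen_inter_preimage hu,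
      e.isOpen_inter_preimage hv, ⟨hm, hmu⟩, ⟨hm', hmv⟩, ?_⟩
    exact (huv.preimage e).mono inter_subset_right inter_subset_right
  · obtain ⟨u, v, hu, hv, hmu, hmv, huv⟩ := t2_separation h
    have hc : Continuous (Total.pt : D.Total → Y) := contMDiff_pt.continuous
    exact ⟨_, _, hu.preimage hc, hv.preimage hc, hmu, hmv, huv.preimage _⟩

/-- The derivative of the projection to `Y`, in adapted coordinates. -/
theorem dTotal_mfderiv_pt {m : D.Total} {m' : D.Total}
    (h : m'.pt ∈ (adaptedChartAt B m.pt).total.source) (v : (Eu (n + 1) × Eu N) × V) :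
    (adaptedChartAt B m.pt).dTotal h
      ((mfderiv 𝓘(ℝ, (Eu (n + 1) × Eu N) × V) (𝓡 (n + N + 1)) (Total.pt : D.Total → Y) m' :
          (Eu (n + 1) × Eu N) × V →L[ℝ] Eu (n + N + 1)) v) =
      ((mfderiv 𝓘(ℝ, (Eu (n + 1) × Eu N) × V) 𝓘(ℝ, (Eu (n + 1) × Eu N) × V)
        (extChartAt 𝓘(ℝ, (Eu (n + 1) × Eu N) × V) m) m' :
          (Eu (n + 1) × Eu N) × V →L[ℝ] (Eu (n + 1) × Eu N) × V) v).1 := by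
  set c := adaptedChartAt B m.pt with hc
  set I := 𝓘(ℝ, (Eu (n + 1) × Eu N) × V)
  have h1 := mfderiv_comp (I := I) (I'' := 𝓘(ℝ, Eu (n + 1) × Eu N)) m'
    (f := (Total.pt : D.Total → Y)) (g := c.total) (c.total_mdiff.mdifferentiableAt h) (contMDiff_pt.mdifferentiable (by simp) m')
  have h2 := mfderiv_comp (I := I) (I'' := 𝓘(ℝ, Eu (n + 1) × Eu N)) m' (f := extChartAt I m)
    (g := (Prod.fst : (Eu (n + 1) × Eu N) × V → _)) differentiableAt_fst.mdifferentiableAt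
    ((contMDiffAt_extChartAt_total (D := D) h).mdifferentiableAt (by simp))
  have h3 : c.total ∘ (Total.pt : D.Total → Y) =ᶠ[𝓝 m'] Prod.fst ∘ extChartAt I m := by
    filter_upwards [(isOpen_extChartAt_source (I := I) m).mem_nhds
      (mem_extChartAt_source'.2 h)] with m'' hm''
    rw [mem_extChartAt_source'] at hm''
    rw [Function.comp_apply, Function.comp_apply, extChartAt_eq hm'']
  have h4 := (h1.symm.trans h3.mfderiv_eq).trans h2
  rw [mfderiv_eq_fderiv, fderiv_fst] at h4
  exact congrArg (fun T : (Eu (n + 1) × Eu N) × V →L[ℝ] Eu (n + 1) × Eu N => T v) h4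

theorem mfderiv_proj_pt (m' : D.Total) (v : (Eu (n + 1) × Eu N) × V) :
    (mfderiv 𝓘(ℝ, (Eu (n + 1) × Eu N) × V) (𝓡 (n + 1)) (fun m : D.Total => B.proj m.pt) m' :
      (Eu (n + 1) × Eu N) × V →L[ℝ] Eu (n + 1)) v =
    (mfderiv (𝓡 (n + N + 1)) (𝓡 (n + 1)) B.proj m'.pt : Eu (n + N + 1) →L[ℝ] Eu (n + 1))
      ((mfderiv 𝓘(ℝ, (Eu (n + 1) × Eu N) × V) (𝓡 (n + N + 1)) (Total.pt : D.Total → Y) m' :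
        (Eu (n + 1) × Eu N) × V →L[ℝ] Eu (n + N + 1)) v) := by
  have h1 := mfderiv_comp (I := 𝓘(ℝ, (Eu (n + 1) × Eu N) × V)) (I'' := 𝓡 (n + 1)) m'
    (f := (Total.pt : D.Total → Y)) (g := B.proj)
    ((adaptedChartAt B m'.pt).mdiffAt_proj (mem_adaptedChartAt_source B m'.pt))
    (contMDiff_pt.mdifferentiable (by simp) m')
  exact congrArg (fun T : (Eu (n + 1) × Eu N) × V →L[ℝ] Eu (n + 1) => T v) h1

/-- The derivative of the projection to `X`, in adapted coordinates. -/
theorem dBase_mfderiv_proj_pt {m : D.Total} {m' : D.Total}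
    (h : m'.pt ∈ (adaptedChartAt B m.pt).total.source) (v : (Eu (n + 1) × Eu N) × V) :
    (adaptedChartAt B m.pt).dBase ((adaptedChartAt B m.pt).proj_mem _ h)
      ((mfderiv 𝓘(ℝ, (Eu (n + 1) × Eu N) × V) (𝓡 (n + 1)) (fun m : D.Total => B.proj m.pt) m' :
          (Eu (n + 1) × Eu N) × V →L[ℝ] Eu (n + 1)) v) =
      ((mfderiv 𝓘(ℝ, (Eu (n + 1) × Eu N) × V) 𝓘(ℝ, (Eu (n + 1) × Eu N) × V)
        (extChartAt 𝓘(ℝ, (Eu (n + 1) × Eu N) × V) m) m' :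
          (Eu (n + 1) × Eu N) × V →L[ℝ] (Eu (n + 1) × Eu N) × V) v).1.1 := by
  rw [← dTotal_mfderiv_pt h v, AdaptedChart.fst_dTotal]
  exact congrArg _ (mfderiv_proj_pt m' v)

end FibreCoords

end FibreBundles

/-! ### Smoothness of the forms on the Pontryagin bundle -/

section PontryaginForms

variable {n N : ℕ} {X Y F : Type*}
  [TopologicalSpace X] [ChartedSpace (Eu (n + 1)) X]
  [TopologicalSpace Y] [ChartedSpace (Eu (n + N + 1)) Y]
  [TopologicalSpace F] [ChartedSpace (Eu N) F] {B : FieldBundle n N X Y F}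

/-- The derivatives of a chart and of its inverse compose to the identity of the model space. -/
theorem DForm.mfderiv_extChartAt_mfderiv_symm {E : Type*} [NormedAddCommGroup E] [NormedSpace ℝ E]
    {P : Type*} [TopologicalSpace P] [ChartedSpace E P] [IsManifold 𝓘(ℝ, E) ∞ P] {p : P} {w : E}
    (hw : w ∈ (extChartAt 𝓘(ℝ, E) p).target) (v : E) :
    (mfderiv 𝓘(ℝ, E) 𝓘(ℝ, E) (extChartAt 𝓘(ℝ, E) p) ((extChartAt 𝓘(ℝ, E) p).symm w) : E →L[ℝ] E)
      ((mfderiv 𝓘(ℝ, E) 𝓘(ℝ, E) (extChartAt 𝓘(ℝ, E) p).symm w : E →L[ℝ] E) v) = v := by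
  have h1 := mfderiv_comp w
    (mdifferentiableAt_extChartAt'' ((extChartAt 𝓘(ℝ, E) p).map_target hw))
    (mdifferentiableAt_extChartAt_symm' hw)
  have h2 : extChartAt 𝓘(ℝ, E) p ∘ (extChartAt 𝓘(ℝ, E) p).symm =ᶠ[𝓝 w] id := by
    filter_upwards [(isOpen_extChartAt_target p).mem_nhds hw] with w' hw'
    exact (extChartAt 𝓘(ℝ, E) p).right_inv hw'
  have h3 := h1.symm.trans h2.mfderiv_eq
  rw [mfderiv_id] at h3
  exact congrArg (fun T : E →L[ℝ] E => T v) h3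

/-- A form is smooth if its values on constant vector fields of the charts are smooth. -/
theorem DForm.isSmooth_of_inChart_apply {E : Type*} [NormedAddCommGroup E] [NormedSpace ℝ E]
    [FiniteDimensional ℝ E] {P : Type*} [TopologicalSpace P] [ChartedSpace E P] {k : ℕ}
    {α : DForm 𝓘(ℝ, E) P k} (g : E → (Fin k → E) → ℝ) (hg : ∀ v, ContDiff ℝ ∞ fun q => g q v)
    (h : ∀ p, ∀ q ∈ (extChartAt 𝓘(ℝ, E) p).target, ∀ v, inChart 𝓘(ℝ, E) α p q v = g q v) :
    IsSmooth 𝓘(ℝ, E) α := by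
  intro p q hq
  refine ContDiffAt.contDiffWithinAt (contDiffAt_alternating_iff.2 fun v => ?_)
  refine (hg v).contDiffAt.congr_of_eventuallyEq ?_
  filter_upwards [(isOpen_extChartAt_target p).mem_nhds hq] with w hw
  exact h p w hw v

/-- `Θ` evaluated on constant vector fields is smooth in the coordinates of `Z`. -/
theorem contDiff_dualModel_apply {W : Type*} [NormedAddCommGroup W] [NormedSpace ℝ W] {k : ℕ}
    (S : Submodule ℝ (W [⋀^Fin k]→L[ℝ] ℝ)) (w : Fin k → W) :
    ContDiff ℝ ∞ fun q : W × S => (q.2 : W [⋀^Fin k]→L[ℝ] ℝ) w := by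
  have h : ContDiff ℝ ∞ fun z : S => (z : W [⋀^Fin k]→L[ℝ] ℝ) :=
    ContinuousLinearMap.contDiff (𝕜 := ℝ) (E := S) (F := W [⋀^Fin k]→L[ℝ] ℝ) S.subtypeL
  exact (ContinuousAlternatingMap.apply ℝ W ℝ w).contDiff.comp (h.comp contDiff_snd)

/-- The pairing `⟨z, γ⟩` evaluated on constant vector fields is smooth in the coordinates of `M`. -/
theorem contDiff_pontryaginModel_apply {W₁ W₂ : Type*} [NormedAddCommGroup W₁] [NormedSpace ℝ W₁]
    [NormedAddCommGroup W₂] [NormedSpace ℝ W₂] {k : ℕ}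
    (S : Submodule ℝ ((W₁ × W₂) [⋀^Fin k]→L[ℝ] ℝ)) (w : Fin k → W₁) :
    ContDiff ℝ ∞ fun q : (W₁ × W₂) × ((W₁ →L[ℝ] W₂) × S) =>
      (q.2.2 : (W₁ × W₂) [⋀^Fin k]→L[ℝ] ℝ) fun i => (w i, q.2.1 (w i)) := by
  have h : ContDiff ℝ ∞ fun z : S => (z : (W₁ × W₂) [⋀^Fin k]→L[ℝ] ℝ) :=
    ContinuousLinearMap.contDiff (𝕜 := ℝ) (E := S) (F := (W₁ × W₂) [⋀^Fin k]→L[ℝ] ℝ) S.subtypeL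
  exact contDiff_iff_contDiffAt.2 fun _ => ContDiffAt.alternating_apply
    (h.comp contDiff_snd.snd).contDiffAt
      fun _ => contDiffAt_const.prodMk (contDiffAt_snd.fst.clm_apply contDiffAt_const)

/-- A point `z` of the dual jet bundle is recovered from its coordinates. -/
theorem DualFibre.apply_eq (c : AdaptedChart B) {y : Y} (hy : y ∈ c.total.source)
    (z : DualFibre B y) (u : Fin (n + 1) → Eu (n + N + 1)) :
    (z.1 : Eu (n + N + 1) [⋀^Fin (n + 1)]→L[ℝ] ℝ) u =
      (dualCoord c y hy z).1 fun i => c.dTotal hy (u i) := by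
  change _ = (z.1 : Eu (n + N + 1) [⋀^Fin (n + 1)]→L[ℝ] ℝ)
    fun i => (c.dTotal hy).symm (c.dTotal hy (u i))
  congr 1
  funext i
  exact ((c.dTotal hy).symm_apply_apply (u i)).symm

/-- In adapted coordinates, a jet is the graph of its coordinate matrix `v^A_μ`. -/
theorem JetFibre.dTotal_apply (c : AdaptedChart B) {y : Y} (hy : y ∈ c.total.source)
    (γ : JetFibre B y) (t : TangentSpace (𝓡 (n + 1)) (B.proj y)) :
    c.dTotal hy (γ.1 t) =
      (c.dBase (c.proj_mem y hy) t, jetCoord c y hy γ (c.dBase (c.proj_mem y hy) t)) := by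
  have h' : mfderiv (𝓡 (n + N + 1)) (𝓡 (n + 1)) B.proj y (γ.1 t) = t :=
    congrArg (fun T => T t) γ.2
  refine Prod.ext ?_ ?_
  · rw [c.fst_dTotal hy, h']
  · change _ = (c.dTotal hy (γ.1 ((c.dBase (c.proj_mem y hy)).symm
      (c.dBase (c.proj_mem y hy) t)))).2
    rw [ContinuousLinearEquiv.symm_apply_apply]

variable [IsManifold (𝓡 (n + 1)) ∞ X] [IsManifold (𝓡 N) ∞ F]

namespace FibreCoords

variable {A : Y → Type*} {V : Type*} [NormedAddCommGroup V] [NormedSpace ℝ V]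
  {D : FibreCoords B A V}

theorem pt_extChartAt_symm_mem {m : D.Total} {q : (Eu (n + 1) × Eu N) × V}
    (h : q ∈ (extChartAt 𝓘(ℝ, (Eu (n + 1) × Eu N) × V) m).target) :
    ((extChartAt 𝓘(ℝ, (Eu (n + 1) × Eu N) × V) m).symm q).pt ∈
      (adaptedChartAt B m.pt).total.source :=
  mem_extChartAt_source'.1 ((extChartAt 𝓘(ℝ, (Eu (n + 1) × Eu N) × V) m).map_target h)

theorem coord_extChartAt_symm {m : D.Total} {q : (Eu (n + 1) × Eu N) × V}
    (h : q ∈ (extChartAt 𝓘(ℝ, (Eu (n + 1) × Eu N) × V) m).target) :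
    D.coord _ _ (pt_extChartAt_symm_mem h)
      ((extChartAt 𝓘(ℝ, (Eu (n + 1) × Eu N) × V) m).symm q).val = q.2 := by
  have h1 := (extChartAt 𝓘(ℝ, (Eu (n + 1) × Eu N) × V) m).right_inv h
  rw [extChartAt_eq (pt_extChartAt_symm_mem h)] at h1
  exact congrArg Prod.snd h1

end FibreCoords

/-- In adapted coordinates, `Θ = p dⁿ⁺¹x + p_A^μ dy^A ∧ dⁿx_μ`. -/
theorem inChart_canonicalForm {z : DualJetBundle B} {q : DualModel n N}
    (hq : q ∈ (extChartAt 𝓘(ℝ, DualModel n N) z).target) (v : Fin (n + 1) → DualModel n N) :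
    DForm.inChart 𝓘(ℝ, DualModel n N) (canonicalForm B) z q v = q.2.1 fun i => (v i).1 := by
  have hm := FibreCoords.pt_extChartAt_symm_mem hq
  have h1 := DualFibre.apply_eq (adaptedChartAt B z.pt) hm
    ((extChartAt 𝓘(ℝ, DualModel n N) z).symm q).val
    fun i => (mfderiv 𝓘(ℝ, DualModel n N) (𝓡 (n + N + 1)) projYZ
      ((extChartAt 𝓘(ℝ, DualModel n N) z).symm q) : DualModel n N →L[ℝ] Eu (n + N + 1))
      ((mfderiv 𝓘(ℝ, DualModel n N) 𝓘(ℝ, DualModel n N)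
        (extChartAt 𝓘(ℝ, DualModel n N) z).symm q : DualModel n N →L[ℝ] DualModel n N) (v i))
  refine Eq.trans h1 ?_
  have h2 : dualCoord _ _ hm ((extChartAt 𝓘(ℝ, DualModel n N) z).symm q).val = q.2 :=
    FibreCoords.coord_extChartAt_symm hq
  rw [h2]
  congr 1
  funext i
  refine (FibreCoords.dTotal_mfderiv_pt hm _).trans ?_
  rw [DForm.mfderiv_extChartAt_mfderiv_symm hq]

variable (B) in
theorem isSmooth_canonicalForm : DForm.IsSmooth 𝓘(ℝ, DualModel n N) (canonicalForm B) := by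
  refine DForm.isSmooth_of_inChart_apply (fun q v => q.2.1 fun i => (v i).1) (fun v => ?_)
    fun z q hq v => inChart_canonicalForm hq v
  exact contDiff_dualModel_apply _ fun i => (v i).1

theorem contMDiff_projZM : ContMDiff 𝓘(ℝ, PontryaginModel n N) 𝓘(ℝ, DualModel n N) ∞
    (projZM : PontryaginBundle B → DualJetBundle B) :=
  FibreCoords.contMDiff_fibreMap (D := pontryaginCoords B) (D' := dualCoords B)
    (fun _ a => a.2) (ContinuousLinearMap.snd ℝ _ _) fun _ _ _ _ => rfl

theorem contMDiff_projJM : ContMDiff 𝓘(ℝ, PontryaginModel n N) 𝓘(ℝ, JetModel n N) ∞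
    (projJM : PontryaginBundle B → JetBundle B) :=
  FibreCoords.contMDiff_fibreMap (D := pontryaginCoords B) (D' := jetCoords B)
    (fun _ a => a.1) (ContinuousLinearMap.fst ℝ _ _) fun _ _ _ _ => rfl

theorem contMDiff_projXM : ContMDiff 𝓘(ℝ, PontryaginModel n N) (𝓡 (n + 1)) ∞
    (projXM : PontryaginBundle B → X) :=
  FibreCoords.contMDiff_proj_pt

variable (B) in
/-- The pairing `⟨z, γ⟩`, as a horizontal form on the Pontryagin bundle. -/
def pairingForm : DForm 𝓘(ℝ, PontryaginModel n N) (PontryaginBundle B) (n + 1) :=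
  fun m => (pairing m).compContinuousLinearMap
    (mfderiv 𝓘(ℝ, PontryaginModel n N) (𝓡 (n + 1)) projXM m)

/-- In adapted coordinates, `⟨z, γ⟩ = (p + p_A^μ v^A_μ) dⁿ⁺¹x`. -/
theorem inChart_pairingForm {m : PontryaginBundle B} {q : PontryaginModel n N}
    (hq : q ∈ (extChartAt 𝓘(ℝ, PontryaginModel n N) m).target)
    (v : Fin (n + 1) → PontryaginModel n N) :
    DForm.inChart 𝓘(ℝ, PontryaginModel n N) (pairingForm B) m q v =
      q.2.2.1 fun i => ((v i).1.1, q.2.1 (v i).1.1) := by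
  have hm := FibreCoords.pt_extChartAt_symm_mem hq
  set m' := (extChartAt 𝓘(ℝ, PontryaginModel n N) m).symm q with hm'
  set w : Fin (n + 1) → Eu (n + 1) := fun i =>
    (mfderiv 𝓘(ℝ, PontryaginModel n N) (𝓡 (n + 1)) projXM m' : PontryaginModel n N →L[ℝ] Eu (n + 1))
      ((mfderiv 𝓘(ℝ, PontryaginModel n N) 𝓘(ℝ, PontryaginModel n N)
        (extChartAt 𝓘(ℝ, PontryaginModel n N) m).symm q :
          PontryaginModel n N →L[ℝ] PontryaginModel n N) (v i)) with hw
  have h1 := DualFibre.apply_eq (adaptedChartAt B m.pt) hm m'.val.2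
    fun i => m'.val.1.1 (w i)
  refine Eq.trans h1 ?_
  have h2 : (jetCoord _ _ hm m'.val.1, dualCoord _ _ hm m'.val.2) = q.2 :=
    FibreCoords.coord_extChartAt_symm hq
  have h3 : jetCoord _ _ hm m'.val.1 = q.2.1 := congrArg Prod.fst h2
  have h4 : dualCoord _ _ hm m'.val.2 = q.2.2 := congrArg Prod.snd h2
  rw [h4]
  congr 1
  funext i
  refine (JetFibre.dTotal_apply _ hm m'.val.1 (w i)).trans ?_
  rw [h3]
  have h5 : (adaptedChartAt B m.pt).dBase ((adaptedChartAt B m.pt).proj_mem _ hm) (w i) =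
      (v i).1.1 := by
    refine (FibreCoords.dBase_mfderiv_proj_pt hm _).trans ?_
    rw [DForm.mfderiv_extChartAt_mfderiv_symm hq]
  rw [h5]

variable (B) in
theorem isSmooth_pairingForm : DForm.IsSmooth 𝓘(ℝ, PontryaginModel n N) (pairingForm B) := by
  refine DForm.isSmooth_of_inChart_apply
    (fun q v => q.2.2.1 fun i => ((v i).1.1, q.2.1 (v i).1.1)) (fun v => ?_)
    fun z q hq v => inChart_pairingForm hq v
  exact contDiff_pontryaginModel_apply _ fun i => (v i).1.1

variable (η : VolForm (n + 1) X) {L : JetBundle B → ℝ}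
  (hL : ContMDiff 𝓘(ℝ, JetModel n N) 𝓘(ℝ, ℝ) ∞ L)
include hL

theorem isSmooth_energyForm : DForm.IsSmooth 𝓘(ℝ, PontryaginModel n N) (energyForm η L) :=
  (isSmooth_pairingForm B).sub
    ((DForm.IsSmooth.pullback η.isSmooth contMDiff_projXM).smul (hL.comp contMDiff_projJM))

omit hL in
variable (B) in
theorem isSmooth_thetaM : DForm.IsSmooth 𝓘(ℝ, PontryaginModel n N) (thetaM B) :=
  DForm.IsSmooth.pullback (isSmooth_canonicalForm B) contMDiff_projZM

theorem isSmooth_thetaM_sub_energyForm :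
    DForm.IsSmooth 𝓘(ℝ, PontryaginModel n N) (thetaM B - energyForm η L) :=
  (isSmooth_thetaM B).sub (isSmooth_energyForm η hL)

/-- `Ω_𝓔` is exact: it is minus the exterior derivative of the Lagrangian form `Θ_M - 𝓔`.
The exterior derivative commutes with the pullback by `π_{ZM}`. -/
theorem omegaE_eq : omegaE η L =
    -DForm.d 𝓘(ℝ, PontryaginModel n N) (thetaM B - energyForm η L) := by
  have h1 : omegaM B = -DForm.d 𝓘(ℝ, PontryaginModel n N) (thetaM B) := by
    funext m
    have h2 := DForm.d_pullback_eq (α := canonicalForm B) (contMDiff_projZM (B := B) m)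
      ((isSmooth_canonicalForm B).differentiableAt _)
    exact (congrArg Neg.neg h2).symm
  rw [DForm.d_sub (isSmooth_thetaM B) (isSmooth_energyForm η hL), omegaE, h1]
  abel

end PontryaginForms

/-! ### Extending tangent vectors to vector fields and to variations -/

section Extensions

variable {n : ℕ} {E : Type*} [NormedAddCommGroup E] [NormedSpace ℝ E]
  {M : Type*} [TopologicalSpace M] [ChartedSpace E M] [IsManifold 𝓘(ℝ, E) ∞ M]

/-- A tangent vector `w` extends to a smooth vector field that, wherever it does not vanish, is a
multiple of the constant vector field `w` of the chart around the base point of `w`. -/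
theorem exists_vectorField_extension [FiniteDimensional ℝ E] [T2Space M] (m₀ : M) (w : E) :
    ∃ V : ∀ m : M, TangentSpace 𝓘(ℝ, E) m,
      ContMDiff 𝓘(ℝ, E) 𝓘(ℝ, E).tangent ∞ (fun m => (⟨m, V m⟩ : TangentBundle 𝓘(ℝ, E) M)) ∧
      V m₀ = w ∧ ∀ m, (V m : E) = 0 ∨ (m ∈ (extChartAt 𝓘(ℝ, E) m₀).source ∧ ∃ r : ℝ,
        (mfderiv 𝓘(ℝ, E) 𝓘(ℝ, E) (extChartAt 𝓘(ℝ, E) m₀) m : E →L[ℝ] E) (V m) = r • w) := by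
  let t := trivializationAt E (TangentSpace 𝓘(ℝ, E)) m₀
  let σ : ∀ m : M, TangentSpace 𝓘(ℝ, E) m := fun m => t.symm m w
  have hbase : t.baseSet = (chartAt E m₀).source := TangentBundle.trivializationAt_baseSet m₀
  have hσ : ContMDiffOn 𝓘(ℝ, E) (𝓘(ℝ, E).prod 𝓘(ℝ, E)) ∞
      (fun m => (⟨m, σ m⟩ : TangentBundle 𝓘(ℝ, E) M)) t.baseSet := by
    refine (t.contMDiffOn_section_baseSet_iff (IB := 𝓘(ℝ, E)) (n := ∞) (s := σ)).2 ?_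
    refine (contMDiffOn_const (c := w)).congr fun m hm => ?_
    exact congrArg Prod.snd (t.apply_mk_symm hm w)
  have hcoord : ∀ m ∈ t.baseSet,
      (mfderiv 𝓘(ℝ, E) 𝓘(ℝ, E) (extChartAt 𝓘(ℝ, E) m₀) m : E →L[ℝ] E) (σ m) = w := by
    intro m hm
    have h1 := TangentBundle.continuousLinearMapAt_trivializationAt (𝕜 := ℝ) (I := 𝓘(ℝ, E))
      (x₀ := m₀) (x := m) (hbase ▸ hm)
    have h2 : t.continuousLinearMapAt ℝ m (σ m) = w := by
      exact (congrFun (t.coe_linearMapAt_of_mem (R := ℝ) hm) (σ m)).trans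
        (congrArg Prod.snd (t.apply_mk_symm hm w))
    exact (congrArg (fun T : E →L[ℝ] E => T (σ m)) h1).symm.trans h2
  obtain ⟨φ⟩ : Nonempty (SmoothBumpFunction 𝓘(ℝ, E) m₀) := inferInstance
  have hφ : tsupport φ ⊆ t.baseSet := hbase ▸ φ.tsupport_subset_chartAt_source
  refine ⟨(φ : M → ℝ) • σ, ?_, ?_, fun m => ?_⟩
  · exact ContMDiffOn.smul_section_of_tsupport φ.contMDiff.contMDiffOn t.open_baseSet hφ hσ
  · have h0 := hcoord m₀ (hbase ▸ mem_chart_source E m₀)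
    rw [mfderiv_extChartAt_self] at h0
    have h1 : ((φ : M → ℝ) • σ) m₀ = (1 : ℝ) • σ m₀ := by
      rw [Pi.smul_apply', φ.eq_one]
    rw [h1, one_smul]
    exact h0
  · by_cases hm : m ∈ t.baseSet
    · refine Or.inr ⟨by rw [extChartAt_source]; exact hbase ▸ hm, φ m, ?_⟩
      rw [← hcoord m hm]
      exact ContinuousLinearMap.map_smul
        (mfderiv 𝓘(ℝ, E) 𝓘(ℝ, E) (extChartAt 𝓘(ℝ, E) m₀) m : E →L[ℝ] E) (φ m) (σ m)
    · refine Or.inl ?_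
      have h1 : φ m = 0 := image_eq_zero_of_notMem_tsupport fun h => hm (hφ h)
      change φ m • (σ m : E) = 0
      rw [h1, zero_smul]

variable {X : Type*} [TopologicalSpace X] [ChartedSpace (Eu (n + 1)) X]
  [IsManifold (𝓡 (n + 1)) ∞ X]

/-- A tangent vector `w` at `f x₀` is the velocity at `x₀` of a variation of `f` with compact
support, which translates `f x` by multiples of `w` in the chart around `f x₀`. -/
theorem exists_variation_velocity [T2Space X] {f : X → M}
    (hf : ContMDiff (𝓡 (n + 1)) 𝓘(ℝ, E) ∞ f) (x₀ : X) (w : E) :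
    ∃ (Ψ : ℝ → X → M) (ε : ℝ) (U : Set X), 0 < ε ∧ IsCompact U ∧ Ψ 0 = f ∧
      ContMDiffOn (𝓘(ℝ, ℝ).prod (𝓡 (n + 1))) 𝓘(ℝ, E) ∞
        (fun q : ℝ × X => Ψ q.1 q.2) (Ioo (-ε) ε ×ˢ univ) ∧
      (∀ l x, x ∉ U → Ψ l x = f x) ∧ (DForm.velocity (E := E) Ψ x₀ : E) = w ∧
      ∀ l ∈ Ioo (-ε) ε, ∀ x, Ψ l x = f x ∨ f x ∈ (extChartAt 𝓘(ℝ, E) (f x₀)).source ∧ ∃ r : ℝ,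
        extChartAt 𝓘(ℝ, E) (f x₀) (f x) + r • w ∈ (extChartAt 𝓘(ℝ, E) (f x₀)).target ∧
        Ψ l x = (extChartAt 𝓘(ℝ, E) (f x₀)).symm
          (extChartAt 𝓘(ℝ, E) (f x₀) (f x) + r • w) := by
  classical
  set e := extChartAt 𝓘(ℝ, E) (f x₀) with he
  obtain ⟨δ, hδ, hball⟩ := Metric.isOpen_iff.1 (isOpen_extChartAt_target (I := 𝓘(ℝ, E)) (f x₀))
    (e (f x₀)) (mem_extChartAt_target _)
  -- On `W` the coordinates of `f` stay in the half ball, which leaves room for translations.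
  set W : Set X := f ⁻¹' (e.source ∩ e ⁻¹' Metric.ball (e (f x₀)) (δ / 2)) with hW
  have hWo : IsOpen W := ((continuousOn_extChartAt (f x₀)).isOpen_inter_preimage
    (isOpen_extChartAt_source (f x₀)) Metric.isOpen_ball).preimage hf.continuous
  have hx₀ : x₀ ∈ W := ⟨mem_extChartAt_source (f x₀), Metric.mem_ball_self (by linarith)⟩
  obtain ⟨φ, -, hφ⟩ := (SmoothBumpFunction.nhds_basis_tsupport (I := 𝓡 (n + 1)) x₀).mem_iff.1
    (hWo.mem_nhds hx₀)
  set ε : ℝ := δ / (2 * (‖w‖ + 1)) with hε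
  have hw : 0 < ‖w‖ + 1 := by positivity
  have hε0 : 0 < ε := by positivity
  have hεw : ε * (‖w‖ + 1) = δ / 2 := by rw [hε]; field_simp
  let Ψ : ℝ → X → M := fun l x =>
    if x ∈ W then e.symm (e (f x) + (l * φ x) • w) else f x
  have hΨW : ∀ l x, x ∈ W → Ψ l x = e.symm (e (f x) + (l * φ x) • w) := fun l x h => if_pos h
  have hΨφ : ∀ l x, l * φ x = 0 → Ψ l x = f x := by
    intro l x h
    by_cases hx : x ∈ W
    · rw [hΨW l x hx, h, zero_smul, add_zero, e.left_inv hx.1]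
    · exact if_neg hx
  have htarget : ∀ l ∈ Ioo (-ε) ε, ∀ x ∈ W, e (f x) + (l * φ x) • w ∈ e.target := by
    intro l hl x hx
    refine hball ?_
    have h1 : ‖(l * φ x) • w‖ ≤ ε * (‖w‖ + 1) := by
      rw [norm_smul, norm_mul, Real.norm_eq_abs, Real.norm_eq_abs, abs_of_nonneg φ.nonneg]
      have h2 : |l| ≤ ε := (abs_lt.2 hl).le
      have h3 : |l| * φ x ≤ ε * 1 := mul_le_mul h2 φ.le_one φ.nonneg hε0.le
      rw [mul_one] at h3
      exact mul_le_mul h3 (by linarith) (norm_nonneg _) hε0.le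
    have h2 : dist (e (f x)) (e (f x₀)) < δ / 2 := hx.2
    rw [Metric.mem_ball, dist_eq_norm]
    rw [dist_eq_norm] at h2
    calc ‖e (f x) + (l * φ x) • w - e (f x₀)‖
        = ‖(e (f x) - e (f x₀)) + (l * φ x) • w‖ := by congr 1; abel
      _ ≤ ‖e (f x) - e (f x₀)‖ + ‖(l * φ x) • w‖ := norm_add_le _ _
      _ < δ := by linarith
  have h0 : (0 : ℝ) ∈ Ioo (-ε) ε := ⟨by linarith, hε0⟩
  refine ⟨Ψ, ε, tsupport φ, hε0, φ.hasCompactSupport, funext fun x => hΨφ 0 x (zero_mul _), ?_,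
    fun l x hx => hΨφ l x ?_, ?_, fun l hl x => ?_⟩
  · rintro ⟨l, x⟩ ⟨hl, -⟩
    refine ContMDiffAt.contMDiffWithinAt ?_
    by_cases hx : x ∈ W
    · have h1 : ContMDiffAt (𝓘(ℝ, ℝ).prod (𝓡 (n + 1))) 𝓘(ℝ, E) ∞
          (fun q : ℝ × X => e (f q.2)) (l, x) :=
        ContMDiffAt.comp (g := e) (l, x) (DForm.contMDiffAt_extChartAt'' hx.1)
          ((hf x).comp (l, x) contMDiffAt_snd)
      have h2 : ContMDiffAt (𝓘(ℝ, ℝ).prod (𝓡 (n + 1))) 𝓘(ℝ, ℝ) ∞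
          (fun q : ℝ × X => q.1 * φ q.2) (l, x) :=
        contMDiffAt_fst.mul ((φ.contMDiff x).comp (l, x) contMDiffAt_snd)
      have h3 : ContMDiffAt (𝓘(ℝ, ℝ).prod (𝓡 (n + 1))) 𝓘(ℝ, E) ∞
          (fun q : ℝ × X => e (f q.2) + (q.1 * φ q.2) • w) (l, x) :=
        h1.add (h2.smul contMDiffAt_const)
      have h4 : ContMDiffAt (𝓘(ℝ, ℝ).prod (𝓡 (n + 1))) 𝓘(ℝ, E) ∞
          (fun q : ℝ × X => e.symm (e (f q.2) + (q.1 * φ q.2) • w)) (l, x) :=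
        ContMDiffAt.comp (g := e.symm) (l, x)
          ((contMDiffOn_extChartAt_symm (f x₀) _ (htarget l hl x hx)).contMDiffAt
            ((isOpen_extChartAt_target _).mem_nhds (htarget l hl x hx))) h3
      refine h4.congr_of_eventuallyEq ?_
      filter_upwards [(hWo.preimage continuous_snd).mem_nhds hx] with q hq
      exact hΨW _ _ hq
    · have h1 : ContMDiffAt (𝓘(ℝ, ℝ).prod (𝓡 (n + 1))) 𝓘(ℝ, E) ∞
          (fun q : ℝ × X => f q.2) (l, x) := (hf x).comp (l, x) contMDiffAt_snd
      refine h1.congr_of_eventuallyEq ?_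
      filter_upwards [((isClosed_tsupport φ).isOpen_compl.preimage continuous_snd).mem_nhds
        fun h => hx (hφ h)] with q hq
      exact hΨφ _ _ (by rw [image_eq_zero_of_notMem_tsupport hq, mul_zero])
  · rw [image_eq_zero_of_notMem_tsupport hx, mul_zero]
  -- The derivatives of the chart around `f x₀` and of its inverse are the identity at this point.
  · have h1 : (fun l => Ψ l x₀) = e.symm ∘ fun l : ℝ => e (f x₀) + l • w := by
      funext l
      rw [hΨW l x₀ hx₀, φ.eq_one, mul_one]
      rfl
    have h2 : HasMFDerivAt 𝓘(ℝ, ℝ) 𝓘(ℝ, E) (fun l : ℝ => e (f x₀) + l • w) 0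
        (ContinuousLinearMap.toSpanSingleton ℝ w) := by
      have : HasDerivAt (fun l : ℝ => e (f x₀) + l • w) w 0 := by
        simpa using ((hasDerivAt_id (0 : ℝ)).smul_const w).const_add (e (f x₀))
      exact this.hasFDerivAt.hasMFDerivAt
    have hz : e (f x₀) + (0 : ℝ) • w = e (f x₀) := by rw [zero_smul, add_zero]
    have h3 : HasMFDerivAt 𝓘(ℝ, E) 𝓘(ℝ, E) e.symm (e (f x₀) + (0 : ℝ) • w)
        (ContinuousLinearMap.id ℝ E) := by
      rw [hz]
      have h4 := (DForm.mdifferentiableAt_extChartAt_symm'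
        (mem_extChartAt_target (I := 𝓘(ℝ, E)) (f x₀))).hasMFDerivAt
      have h5 := mfderivWithin_range_extChartAt_symm (I := 𝓘(ℝ, E)) (x := f x₀)
      rw [ModelWithCorners.range_eq_univ, mfderivWithin_univ] at h5
      exact h5 ▸ h4
    have h4 := (HasMFDerivAt.comp (0 : ℝ) h3 h2).mfderiv
    rw [← h1] at h4
    have h5 := congrArg (fun T : ℝ →L[ℝ] E => T 1) h4
    refine Eq.trans h5 ?_
    change (1 : ℝ) • w = w
    exact one_smul _ _
  · by_cases hx : x ∈ W
    · exact Or.inr ⟨hx.1, l * φ x, htarget l hl x hx, hΨW l x hx⟩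
    · exact Or.inl (if_neg hx)

end Extensions

/-! ### Vertical fields and vertical variations -/

section CriticalSections

variable {n N : ℕ} {X Y F : Type*}
  [TopologicalSpace X] [ChartedSpace (Eu (n + 1)) X]
  [TopologicalSpace Y] [ChartedSpace (Eu (n + N + 1)) Y]
  [TopologicalSpace F] [ChartedSpace (Eu N) F] {B : FieldBundle n N X Y F}
  [IsManifold (𝓡 (n + 1)) ∞ X] [IsManifold (𝓡 N) ∞ F]

namespace FibreCoords

variable {A : Y → Type*} {V : Type*} [NormedAddCommGroup V] [NormedSpace ℝ V]
  {D : FibreCoords B A V}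

/-- In adapted coordinates, the vertical vectors are those without component along `X`. -/
theorem mfderiv_proj_pt_eq_zero_iff {m m' : D.Total}
    (h : m'.pt ∈ (adaptedChartAt B m.pt).total.source) (v : (Eu (n + 1) × Eu N) × V) :
    (mfderiv 𝓘(ℝ, (Eu (n + 1) × Eu N) × V) (𝓡 (n + 1)) (fun m : D.Total => B.proj m.pt) m' :
      (Eu (n + 1) × Eu N) × V →L[ℝ] Eu (n + 1)) v = 0 ↔
    ((mfderiv 𝓘(ℝ, (Eu (n + 1) × Eu N) × V) 𝓘(ℝ, (Eu (n + 1) × Eu N) × V)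
        (extChartAt 𝓘(ℝ, (Eu (n + 1) × Eu N) × V) m) m' :
          (Eu (n + 1) × Eu N) × V →L[ℝ] (Eu (n + 1) × Eu N) × V) v).1.1 = 0 := by
  rw [← dBase_mfderiv_proj_pt h v]
  exact (ContinuousLinearEquiv.map_eq_zero_iff
    ((adaptedChartAt B m.pt).dBase ((adaptedChartAt B m.pt).proj_mem _ h))).symm

theorem fst_fst_eq_zero_of_vertical [IsManifold 𝓘(ℝ, (Eu (n + 1) × Eu N) × V) ∞ D.Total]
    {m : D.Total} {w : (Eu (n + 1) × Eu N) × V}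
    (hw : (mfderiv 𝓘(ℝ, (Eu (n + 1) × Eu N) × V) (𝓡 (n + 1)) (fun m : D.Total => B.proj m.pt) m :
      (Eu (n + 1) × Eu N) × V →L[ℝ] Eu (n + 1)) w = 0) : w.1.1 = 0 := by
  have h1 := (mfderiv_proj_pt_eq_zero_iff (mem_adaptedChartAt_source B m.pt) w).1 hw
  rw [mfderiv_extChartAt_self] at h1
  exact h1

/-- Vertical tangent vectors extend to smooth vertical vector fields. -/
theorem exists_vertical_extension [FiniteDimensional ℝ V] [T2Space Y] (m₀ : D.Total)
    (w : (Eu (n + 1) × Eu N) × V)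
    (hw : (mfderiv 𝓘(ℝ, (Eu (n + 1) × Eu N) × V) (𝓡 (n + 1)) (fun m : D.Total => B.proj m.pt) m₀ :
      (Eu (n + 1) × Eu N) × V →L[ℝ] Eu (n + 1)) w = 0) :
    ∃ W : ∀ m : D.Total, TangentSpace 𝓘(ℝ, (Eu (n + 1) × Eu N) × V) m,
      ContMDiff 𝓘(ℝ, (Eu (n + 1) × Eu N) × V) 𝓘(ℝ, (Eu (n + 1) × Eu N) × V).tangent ∞
        (fun m => (⟨m, W m⟩ : TangentBundle 𝓘(ℝ, (Eu (n + 1) × Eu N) × V) D.Total)) ∧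
      (∀ m, mfderiv 𝓘(ℝ, (Eu (n + 1) × Eu N) × V) (𝓡 (n + 1))
        (fun m : D.Total => B.proj m.pt) m (W m) = 0) ∧ W m₀ = w := by
  have hw0 := fst_fst_eq_zero_of_vertical hw
  obtain ⟨W, hW, hW0, hWm⟩ := exists_vectorField_extension m₀ w
  refine ⟨W, hW, fun m => ?_, hW0⟩
  rcases hWm m with h | ⟨hm, r, hr⟩
  · exact (congrArg _ h).trans (map_zero
      (mfderiv 𝓘(ℝ, (Eu (n + 1) × Eu N) × V) (𝓡 (n + 1)) (fun m : D.Total => B.proj m.pt) m :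
        (Eu (n + 1) × Eu N) × V →L[ℝ] Eu (n + 1)))
  · refine (mfderiv_proj_pt_eq_zero_iff (mem_extChartAt_source'.1 hm) (W m)).2 ?_
    rw [hr]
    change r • w.1.1 = 0
    rw [hw0, smul_zero]

/-- Translations along the fibre coordinates preserve the projection to `X`. -/
theorem proj_pt_extChartAt_symm_add {m m' : D.Total}
    (h : m' ∈ (extChartAt 𝓘(ℝ, (Eu (n + 1) × Eu N) × V) m).source)
    {w : (Eu (n + 1) × Eu N) × V} (hw : w.1.1 = 0)
    (ht : extChartAt 𝓘(ℝ, (Eu (n + 1) × Eu N) × V) m m' + w ∈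
      (extChartAt 𝓘(ℝ, (Eu (n + 1) × Eu N) × V) m).target) :
    B.proj ((extChartAt 𝓘(ℝ, (Eu (n + 1) × Eu N) × V) m).symm
      (extChartAt 𝓘(ℝ, (Eu (n + 1) × Eu N) × V) m m' + w)).pt = B.proj m'.pt := by
  set c := adaptedChartAt B m.pt with hc
  have h' := mem_extChartAt_source'.1 h
  have ht' := mem_extChartAt_target.1 ht
  rw [pt_extChartAt_symm ht']
  have hs := c.total.map_target ht'
  refine c.base.injOn (c.proj_mem _ hs) (c.proj_mem _ h') ?_
  rw [← c.total_fst _ hs, ← c.total_fst _ h', c.total.right_inv ht', extChartAt_eq h']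
  change (c.total m'.pt).1 + w.1.1 = _
  rw [hw, add_zero]

end FibreCoords

theorem exists_isVerticalField_eq [T2Space Y] (m₀ : PontryaginBundle B) (w : PontryaginModel n N)
    (hw : (mfderiv 𝓘(ℝ, PontryaginModel n N) (𝓡 (n + 1)) projXM m₀ :
      PontryaginModel n N →L[ℝ] Eu (n + 1)) w = 0) :
    ∃ V : ∀ m : PontryaginBundle B, TangentSpace 𝓘(ℝ, PontryaginModel n N) m,
      IsVerticalField V ∧ V m₀ = w := by
  obtain ⟨V, h1, h2, h3⟩ := FibreCoords.exists_vertical_extension m₀ w hw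
  exact ⟨V, ⟨h1, h2⟩, h3⟩

/-- The velocity of a family of sections is vertical. -/
theorem mfderiv_projXM_velocity {Ψ : ℝ → X → PontryaginBundle B} {ε : ℝ} (hε : 0 < ε)
    (hΨ : ContMDiffOn (𝓘(ℝ, ℝ).prod (𝓡 (n + 1))) 𝓘(ℝ, PontryaginModel n N) ∞
      (fun q : ℝ × X => Ψ q.1 q.2) (Ioo (-ε) ε ×ˢ univ))
    {x : X} (h : ∀ l ∈ Ioo (-ε) ε, projXM (Ψ l x) = x) :
    (mfderiv 𝓘(ℝ, PontryaginModel n N) (𝓡 (n + 1)) projXM (Ψ 0 x) :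
      PontryaginModel n N →L[ℝ] Eu (n + 1))
        (DForm.velocity (E := PontryaginModel n N) Ψ x) = 0 := by
  have h0 : (0 : ℝ) ∈ Ioo (-ε) ε := ⟨by linarith, hε⟩
  have h1 : MDifferentiableAt 𝓘(ℝ, ℝ) 𝓘(ℝ, PontryaginModel n N) (fun l => Ψ l x) 0 :=
    (ContMDiffAt.comp (f := fun l : ℝ => (l, x)) (g := fun q : ℝ × X => Ψ q.1 q.2) (0 : ℝ)
      (DForm.contMDiffAt_family hΨ h0 x)
      (contMDiffAt_id.prodMk contMDiffAt_const)).mdifferentiableAt (by simp)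
  have h2 := mfderiv_comp (I'' := 𝓡 (n + 1)) (0 : ℝ) (g := projXM)
    (contMDiff_projXM.mdifferentiable (by simp) (Ψ 0 x)) h1
  have h3 : projXM ∘ (fun l => Ψ l x) =ᶠ[𝓝 0] fun _ => x := by
    filter_upwards [isOpen_Ioo.mem_nhds h0] with l hl
    exact h l hl
  have h4 : mfderiv 𝓘(ℝ, ℝ) (𝓡 (n + 1)) (projXM ∘ (fun l => Ψ l x)) 0 = (0 : ℝ →L[ℝ] Eu (n + 1)) :=
    h3.mfderiv_eq.trans mfderiv_const
  exact congrArg (fun T : ℝ →L[ℝ] Eu (n + 1) => T 1) (h2.symm.trans h4)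

/-- Every vertical tangent vector at `ψ x₀` is the velocity at `x₀` of a compactly supported
vertical variation of `ψ`. -/
theorem exists_verticalVariation_velocity [T2Space X] {ψ : X → PontryaginBundle B}
    (hψ : IsPontryaginSection ψ) (x₀ : X) (w : PontryaginModel n N)
    (hw : (mfderiv 𝓘(ℝ, PontryaginModel n N) (𝓡 (n + 1)) projXM (ψ x₀) :
      PontryaginModel n N →L[ℝ] Eu (n + 1)) w = 0) :
    ∃ (Ψ : ℝ → X → PontryaginBundle B) (U : Set X), IsCompact U ∧ IsVerticalVariation ψ U Ψ ∧
      (DForm.velocity (E := PontryaginModel n N) Ψ x₀ : PontryaginModel n N) = w := by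
  obtain ⟨Ψ, ε, U, hε, hU, hΨ0, hΨ, hΨU, hv, hloc⟩ := exists_variation_velocity hψ.1 x₀ w
  refine ⟨Ψ, U, hU, ⟨hΨ0, ε, hε, hΨ, fun l hl => ⟨⟨DForm.contMDiff_family_slice hΨ hl, fun x => ?_⟩,
    hΨU l⟩⟩, hv⟩
  rcases hloc l hl x with h | ⟨hs, r, ht, h⟩
  · rw [h, hψ.2]
  · have hw0 : w.1.1 = 0 := FibreCoords.fst_fst_eq_zero_of_vertical hw
    rw [h]
    refine Eq.trans ?_ (hψ.2 x)
    refine FibreCoords.proj_pt_extChartAt_symm_add hs (w := r • w) ?_ ht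
    change r • w.1.1 = 0
    rw [hw0, smul_zero]

/-- Rescaling the time of a vertical variation by a bounded function on `X`. -/
theorem IsVerticalVariation.rescale {ψ : X → PontryaginBundle B} {U : Set X}
    {Ψ : ℝ → X → PontryaginBundle B} (h : IsVerticalVariation ψ U Ψ) {g : X → ℝ}
    (hg : ContMDiff (𝓡 (n + 1)) 𝓘(ℝ, ℝ) ∞ g) {C : ℝ} (hC : ∀ x, |g x| ≤ C) :
    IsVerticalVariation ψ U fun l x => Ψ (l * g x) x := by
  obtain ⟨ε, hε, hΨ, hs⟩ := h.exists_interval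
  have hC0 : 0 < |C| + 1 := by positivity
  have hmem : ∀ l ∈ Ioo (-(ε / (|C| + 1))) (ε / (|C| + 1)), ∀ x, l * g x ∈ Ioo (-ε) ε := by
    intro l hl x
    rw [mem_Ioo, ← abs_lt] at hl ⊢
    rw [lt_div_iff₀ hC0] at hl
    rw [abs_mul]
    refine lt_of_le_of_lt (mul_le_mul_of_nonneg_left ?_ (abs_nonneg l)) hl
    exact (hC x).trans ((le_abs_self C).trans (by linarith))
  have hsm : ContMDiffOn (𝓘(ℝ, ℝ).prod (𝓡 (n + 1))) 𝓘(ℝ, PontryaginModel n N) ∞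
      (fun q : ℝ × X => Ψ (q.1 * g q.2) q.2)
      (Ioo (-(ε / (|C| + 1))) (ε / (|C| + 1)) ×ˢ univ) := by
    have h1 : ContMDiff (𝓘(ℝ, ℝ).prod (𝓡 (n + 1))) (𝓘(ℝ, ℝ).prod (𝓡 (n + 1))) ∞
        (fun q : ℝ × X => (q.1 * g q.2, q.2)) :=
      (contMDiff_fst.mul (hg.comp contMDiff_snd)).prodMk contMDiff_snd
    exact hΨ.comp h1.contMDiffOn fun q hq => ⟨hmem q.1 hq.1 q.2, mem_univ _⟩
  refine ⟨?_, ε / (|C| + 1), by positivity, hsm, fun l hl =>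
    ⟨⟨DForm.contMDiff_family_slice (Ψ := fun l x => Ψ (l * g x) x) hsm hl,
      fun x => (hs _ (hmem l hl x)).1.2 x⟩,
      fun x hx => (hs _ (hmem l hl x)).2 x hx⟩⟩
  funext x
  rw [zero_mul, h.zero]

omit [IsManifold (𝓡 (n + 1)) ∞ X] in
theorem DForm.velocity_rescale {E M : Type*} [NormedAddCommGroup E] [NormedSpace ℝ E]
    [TopologicalSpace M] [ChartedSpace E M] {Ψ : ℝ → X → M} {ε : ℝ} (hε : 0 < ε)
    (hΨ : ContMDiffOn (𝓘(ℝ, ℝ).prod (𝓡 (n + 1))) 𝓘(ℝ, E) ∞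
      (fun q : ℝ × X => Ψ q.1 q.2) (Ioo (-ε) ε ×ˢ univ)) (g : X → ℝ) (x : X) :
    (velocity (E := E) (fun l x => Ψ (l * g x) x) x : E) = g x • (velocity (E := E) Ψ x : E) := by
  have h0 : (0 : ℝ) ∈ Ioo (-ε) ε := ⟨by linarith, hε⟩
  have h1 : HasMFDerivAt 𝓘(ℝ, ℝ) 𝓘(ℝ, E) (fun l => Ψ l x) (0 * g x)
      (mfderiv 𝓘(ℝ, ℝ) 𝓘(ℝ, E) (fun l => Ψ l x) 0 : ℝ →L[ℝ] E) := by
    rw [zero_mul]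
    exact ((ContMDiffAt.comp (f := fun l : ℝ => (l, x)) (g := fun q : ℝ × X => Ψ q.1 q.2) (0 : ℝ)
      (contMDiffAt_family hΨ h0 x)
      (contMDiffAt_id.prodMk contMDiffAt_const)).mdifferentiableAt (by simp)).hasMFDerivAt
  have h2 : HasMFDerivAt 𝓘(ℝ, ℝ) 𝓘(ℝ, ℝ) (fun l : ℝ => l * g x) 0
      (ContinuousLinearMap.toSpanSingleton ℝ (g x)) := by
    have : HasDerivAt (fun l : ℝ => l * g x) (g x) 0 := by
      simpa using (hasDerivAt_id (0 : ℝ)).mul_const (g x)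
    exact this.hasFDerivAt.hasMFDerivAt
  have h3 := congrArg (fun T : ℝ →L[ℝ] E => T 1) (HasMFDerivAt.comp (0 : ℝ) h1 h2).mfderiv
  refine Eq.trans h3 ?_
  refine Eq.trans ?_ (ContinuousLinearMap.map_smul
    (mfderiv 𝓘(ℝ, ℝ) 𝓘(ℝ, E) (fun l => Ψ l x) 0 : ℝ →L[ℝ] E) (g x) 1)
  refine congrArg (mfderiv 𝓘(ℝ, ℝ) 𝓘(ℝ, E) (fun l => Ψ l x) 0 : ℝ →L[ℝ] E) ?_
  change (1 : ℝ) • g x = g x • (1 : ℝ)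
  rw [smul_eq_mul, smul_eq_mul, mul_comm]

end CriticalSections

/-! ### Critical sections and the implicit Euler–Lagrange equations -/

section EulerLagrange

variable {n N : ℕ} {X Y F : Type*}
  [TopologicalSpace X] [ChartedSpace (Eu (n + 1)) X]
  [TopologicalSpace Y] [ChartedSpace (Eu (n + N + 1)) Y]
  [TopologicalSpace F] [ChartedSpace (Eu N) F] {B : FieldBundle n N X Y F}

/-- The contraction with the velocity is linear in the velocity. -/
theorem DForm.contractAlong_apply_eq_smul {E M : Type*} [NormedAddCommGroup E] [NormedSpace ℝ E]
    [TopologicalSpace M] [ChartedSpace E M] {m : ℕ} {Ψ Ψ' : ℝ → X → M} (h : Ψ' 0 = Ψ 0) {x : X}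
    {r : ℝ} (hv : (velocity (E := E) Ψ' x : E) = r • (velocity (E := E) Ψ x : E))
    (γ : DForm 𝓘(ℝ, E) M (m + 1)) :
    contractAlong (n := n) Ψ' γ x = r • contractAlong (n := n) Ψ γ x := by
  have key : ∀ (f f' : X → M) (u u' : E) (v : Fin m → Eu (n + 1)), f' = f → u' = r • u →
      ContinuousAlternatingMap.curryLeft (E := E) (γ (f' x)) u'
        (fun i => (mfderiv (𝓡 (n + 1)) 𝓘(ℝ, E) f' x : Eu (n + 1) →L[ℝ] E) (v i)) =
      r • ContinuousAlternatingMap.curryLeft (E := E) (γ (f x)) u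
        (fun i => (mfderiv (𝓡 (n + 1)) 𝓘(ℝ, E) f x : Eu (n + 1) →L[ℝ] E) (v i)) := by
    rintro f _ u _ v rfl rfl
    rw [map_smul]
    rfl
  exact form_ext fun v => key (Ψ 0) (Ψ' 0) (velocity Ψ x) (velocity Ψ' x) v h hv

variable [IsManifold (𝓡 (n + 1)) ∞ X] [IsManifold (𝓡 N) ∞ F]
  (η : VolForm (n + 1) X) {L : JetBundle B → ℝ}
  (hL : ContMDiff 𝓘(ℝ, JetModel n N) 𝓘(ℝ, ℝ) ∞ L)
include hL

/-- If the vector field `V` takes the value of the velocity of the variation at `ψ x`, the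
Euler–Lagrange expression of `V` at `x` is, up to sign, the integrand of the first variation. -/
theorem pullback_interior_omegaE_apply {ψ : X → PontryaginBundle B}
    {Ψ : ℝ → X → PontryaginBundle B} (h0 : Ψ 0 = ψ)
    {V : ∀ m : PontryaginBundle B, TangentSpace 𝓘(ℝ, PontryaginModel n N) m} {x : X}
    (hV : (V (ψ x) : PontryaginModel n N) = DForm.velocity (E := PontryaginModel n N) Ψ x) :
    DForm.pullback (𝓡 (n + 1)) 𝓘(ℝ, PontryaginModel n N) ψ
        (DForm.interior 𝓘(ℝ, PontryaginModel n N) V (omegaE η L)) x =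
      -DForm.contractAlong (n := n) Ψ
        (DForm.d 𝓘(ℝ, PontryaginModel n N) (thetaM B - energyForm η L)) x := by
  subst h0
  rw [omegaE_eq η hL]
  refine DForm.form_ext fun v => ?_
  exact congrArg (fun u : PontryaginModel n N =>
    -(DForm.d 𝓘(ℝ, PontryaginModel n N) (thetaM B - energyForm η L) (Ψ 0 x) :
      PontryaginModel n N [⋀^Fin (n + 2)]→L[ℝ] ℝ) (Fin.cons u fun i =>
        (mfderiv (𝓡 (n + 1)) 𝓘(ℝ, PontryaginModel n N) (Ψ 0) x :
          Eu (n + 1) →L[ℝ] PontryaginModel n N) (v i))) hV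

/-- The first variation of the Hamilton–Pontryagin action. -/
theorem hasDerivAt_hpAction [T2Space X] [SigmaCompactSpace X] [MeasurableSpace X] [BorelSpace X]
    {ψ : X → PontryaginBundle B} {U : Set X} (hU : IsCompact U)
    {Ψ : ℝ → X → PontryaginBundle B} (hΨ : IsVerticalVariation ψ U Ψ) :
    HasDerivAt (fun l => hpAction η L U (Ψ l))
      (DForm.integral η U (DForm.contractAlong Ψ
        (DForm.d 𝓘(ℝ, PontryaginModel n N) (thetaM B - energyForm η L)))) 0 := by
  obtain ⟨ε, hε, hs, hl⟩ := hΨ.exists_interval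
  refine DForm.hasDerivAt_integral_pullback_family hs η ⟨by linarith, hε⟩
    (isSmooth_thetaM_sub_energyForm η hL) hU fun l hl' x hx => ?_
  rw [(hl l hl').2 x hx, hΨ.zero]

/-- At a critical section, the integrand of the first variation vanishes for each vertical
variation: this is the fundamental lemma of the calculus of variations, applied to the variations
obtained by rescaling time with test functions. -/
theorem contractAlong_eq_zero_of_isHPCritical [T2Space X] [SigmaCompactSpace X] [MeasurableSpace X]
    [BorelSpace X] {ψ : X → PontryaginBundle B} (hcrit : IsHPCritical η L ψ) {U : Set X}
    (hU : IsCompact U) {Ψ : ℝ → X → PontryaginBundle B} (hΨ : IsVerticalVariation ψ U Ψ) (x : X) :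
    DForm.contractAlong (n := n) Ψ
      (DForm.d 𝓘(ℝ, PontryaginModel n N) (thetaM B - energyForm η L)) x = 0 := by
  set γ := DForm.d 𝓘(ℝ, PontryaginModel n N) (thetaM B - energyForm η L) with hγ
  obtain ⟨ε, hε, hs, hl⟩ := hΨ.exists_interval
  have h0 : (0 : ℝ) ∈ Ioo (-ε) ε := ⟨by linarith, hε⟩
  have := DForm.isLocallyFiniteMeasure_measure η.isSmooth
  have := DForm.isOpenPosMeasure_measure η
  set μ := DForm.measure η.form with hμ
  have hcont : Continuous (DForm.ratio η (DForm.contractAlong Ψ γ)) :=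
    DForm.continuous_ratio_contractAlong_d hs η h0 (isSmooth_thetaM_sub_energyForm η hL)
  have hout : ∀ x, x ∉ U → DForm.ratio η (DForm.contractAlong Ψ γ) x = 0 := by
    intro x hx
    have h2 : (fun l => Ψ l x) =ᶠ[𝓝 0] fun _ => Ψ 0 x := by
      filter_upwards [isOpen_Ioo.mem_nhds h0] with l hl'
      rw [(hl l hl').2 x hx, hΨ.zero]
    have h3 : (mfderiv 𝓘(ℝ, ℝ) 𝓘(ℝ, PontryaginModel n N) (fun l => Ψ l x) 0 :
        ℝ →L[ℝ] PontryaginModel n N) = 0 := h2.mfderiv_eq.trans mfderiv_const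
    have h4 : (DForm.velocity (E := PontryaginModel n N) Ψ x : PontryaginModel n N) =
        (0 : ℝ) • (DForm.velocity (E := PontryaginModel n N) Ψ x : PontryaginModel n N) := by
      rw [zero_smul]
      exact congrArg (fun T : ℝ →L[ℝ] PontryaginModel n N => T 1) h3
    rw [DForm.ratio, DForm.contractAlong_apply_eq_smul rfl h4, zero_smul]
    exact zero_div _
  have hint : ∀ g : X → ℝ, ContMDiff (𝓡 (n + 1)) 𝓘(ℝ, ℝ) ∞ g → HasCompactSupport g →
      ∫ x, g x • DForm.ratio η (DForm.contractAlong Ψ γ) x ∂μ = 0 := by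
    intro g hg hgc
    obtain ⟨C, hC⟩ := hg.continuous.bounded_above_of_compact_support hgc
    have hΨ' := hΨ.rescale hg hC
    -- The rescaled variation `Ψ (l * g x) x` has velocity `g` times that of `Ψ`.
    have h1 := (hasDerivAt_hpAction η hL hU hΨ').unique (hcrit U _ hU hΨ')
    have h2 : ∀ x, DForm.ratio η (DForm.contractAlong (fun l x => Ψ (l * g x) x) γ) x =
        g x • DForm.ratio η (DForm.contractAlong Ψ γ) x := by
      intro x
      rw [DForm.ratio, DForm.contractAlong_apply_eq_smul (Ψ := Ψ) (r := g x)
        (by rw [hΨ'.zero, hΨ.zero]) (DForm.velocity_rescale hε hs g x)]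
      exact mul_div_assoc _ _ _
    rw [← h1, DForm.integral, ← setIntegral_eq_integral_of_forall_compl_eq_zero (s := U)
      fun x hx => by rw [hout x hx, smul_zero]]
    exact integral_congr_ae (Filter.Eventually.of_forall fun x => (h2 x).symm)
  have hae := ae_eq_zero_of_integral_contMDiff_smul_eq_zero (𝓡 (n + 1))
    (hcont.locallyIntegrable (μ := μ)) hint
  -- The integrand is continuous and the measure of `η` is positive on nonempty open sets.
  have hzero : DForm.ratio η (DForm.contractAlong Ψ γ) = 0 :=
    (hcont.ae_eq_iff_eq μ continuous_const).1 hae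
  refine ContinuousAlternatingMap.eq_zero_of_stdFrame ?_
  have hη : (η.form x : Eu (n + 1) [⋀^Fin (n + 1)]→L[ℝ] ℝ) (stdFrame (n + 1)) ≠ 0 := fun h =>
    η.ne_zero x (ContinuousAlternatingMap.eq_zero_of_stdFrame h)
  exact (div_eq_zero_iff.1 (congrFun hzero x)).resolve_right hη

end EulerLagrange

end

theorem mainTheorem3 {n N : ℕ} {X Y F : Type*}
    [TopologicalSpace X] [ChartedSpace (Eu (n + 1)) X] [IsManifold (𝓡 (n + 1)) ∞ X]
    [T2Space X] [SigmaCompactSpace X] [MeasurableSpace X] [BorelSpace X]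
    [TopologicalSpace Y] [ChartedSpace (Eu (n + N + 1)) Y] [IsManifold (𝓡 (n + N + 1)) ∞ Y]
    [T2Space Y] [SigmaCompactSpace Y]
    [TopologicalSpace F] [ChartedSpace (Eu N) F] [IsManifold (𝓡 N) ∞ F]
    (B : FieldBundle n N X Y F) (η : VolForm (n + 1) X)
    (L : JetBundle B → ℝ) (hL : ContMDiff 𝓘(ℝ, JetModel n N) 𝓘(ℝ, ℝ) ∞ L)
    (ψ : X → PontryaginBundle B) (hψ : IsPontryaginSection ψ) :
    IsHPCritical η L ψ ↔
      ∀ V : (∀ m : PontryaginBundle B, TangentSpace 𝓘(ℝ, PontryaginModel n N) m),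
        IsVerticalField V →
          DForm.pullback (𝓡 (n + 1)) 𝓘(ℝ, PontryaginModel n N) ψ
            (DForm.interior 𝓘(ℝ, PontryaginModel n N) V (omegaE η L)) = 0 := by
  constructor
  · intro hcrit V hV
    funext x
    -- The value of `V` at `ψ x` is the velocity at `x` of a variation of `ψ`.
    obtain ⟨Ψ, U, hU, hΨ, hv⟩ := exists_verticalVariation_velocity hψ x (V (ψ x)) (hV.2 (ψ x))
    rw [pullback_interior_omegaE_apply η hL hΨ.zero hv.symm,
      contractAlong_eq_zero_of_isHPCritical η hL hcrit hU hΨ x, neg_zero]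
    rfl
  · intro hEL U Ψ hU hΨ
    have hzero : ∀ x, DForm.contractAlong (n := n) Ψ
        (DForm.d 𝓘(ℝ, PontryaginModel n N) (thetaM B - energyForm η L)) x = 0 := by
      intro x
      obtain ⟨ε, hε, hs, hl⟩ := hΨ.exists_interval
      -- The velocity of the variation at `x` extends to a vertical field on `M`.
      obtain ⟨V, hV, hVx⟩ := exists_isVerticalField_eq (Ψ 0 x)
        (DForm.velocity (E := PontryaginModel n N) Ψ x)
        (mfderiv_projXM_velocity hε hs fun l hl' => (hl l hl').1.2 x)
      rw [hΨ.zero] at hVx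
      have h := pullback_interior_omegaE_apply η hL hΨ.zero hVx
      rw [hEL V hV] at h
      exact neg_eq_zero.1 h.symm
    have hd := hasDerivAt_hpAction η hL hU hΨ
    have hI : DForm.integral η U (DForm.contractAlong Ψ
        (DForm.d 𝓘(ℝ, PontryaginModel n N) (thetaM B - energyForm η L))) = 0 := by
      refine integral_eq_zero_of_ae (Filter.Eventually.of_forall fun x => ?_)
      rw [DForm.ratio, hzero x]
      exact zero_div _
    rwa [hI] at hd
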